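/- Let $a<b$, $\theta=(a+b)/2$, $0<\varepsilon<(b-a)/2$, $\theta_\pm=\theta\pm\varepsilon$, and $I=[a,\theta_-)\cup(\theta_-,\theta_+)\cup(\theta_+,b]$. Let $q:I\to\mathbb R$ be continuous with finite one-sided limits at $\theta_-$ and $\theta_+$, and let $\beta_1,\beta_2,\alpha_1,\alpha_2,\alpha_1',\alpha_2',\delta,\gamma\in\mathbb R$ with $|\beta_1|+|\beta_2|\ne0$, $\delta\ne0$, $\gamma\ne0$ and $\alpha_1'\alpha_2-\alpha_1\alpha_2'>0$. For $\lambda\in\mathbb C$ let $\phi_\lambda$ and $\chi_\lambda$ be the solutions of $-u''+qu=\lambda u$ on $I$ that satisfy the transmission conditions $$u^{(k)}(\theta_--)=\delta u^{(k)}(\theta_-+),\qquad \delta u^{(k)}(\theta_+-)=\gamma u^{(k)}(\theta_++)\qquad(k=0,1)$$ and, respectively, $\phi_\lambda(a)=\beta_2$, $\phi_\lambda'(a)=-\beta_1$, and $\chi_\lambda(b)=\lambda\alpha_2'+\alpha_2$, $\chi_\lambda'(b)=\lambda\alpha_1'+\alpha_1$. Let $\omega(\lambda)=\phi_\lambda\chi_\lambda'-\phi_\lambda'\chi_\lambda$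 be their Wronskian on $[a,\theta_-)$, which does not depend on $x$, and let $$G(x,y,\lambda)=\frac1{\omega(\lambda)}\begin{cases}\chi_\lambda(x)\phi_\lambda(y),& y\le x,\\ \chi_\lambda(y)\phi_\lambda(x),& x\le y,\end{cases}\qquad x,y\in I,$$ be Green's function. Then the zeros of $\omega$ form a strictly increasing sequence of real numbers $\lambda_0<\lambda_1<\dots$, all simple, and the canonical product $\tilde\omega(\lambda)=\prod_n(1-\lambda/\lambda_n)$ converges for every $\lambda$ (if some $\lambda_k=0$, the factor with $n=k$ is replaced by $\lambda$). Let $\Omega$ be either $\omega$ or $\tilde\omega$, let $y_0\in I$ and $g\in L_2(a,b)$, let $G(x,\lambda)=\Omega(\lambda)G(x,y_0,\lambda)$, which extends for each $x\in I$ to an entire function of $\lambda$, and put $$F(\lambda)=\int_a^{\theta_-}G(x,\lambda)\overline{g(x)}\,dx+\delta^2\int_{\theta_-}^{\theta_+}G(x,\lambda)\overline{g(x)}\,dx+\gamma^2\int_{\theta_+}^bG(x,\lambda)\overline{g(x)}\,dx .$$ These integrals exist. The function $F$ is entire of exponential type at most $b-a$, and so is $s\mapsto F(s^2)$; here an entire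 function $f$ is of exponential type at most $\sigma$ if for every $\eta>0$ there is $C$ with $|f(z)|\le Ce^{(\sigma+\eta)|z|}$ for all $z\in\mathbb C$. Moreover $\Omega'(\lambda_n)\ne0$ for all $n$, and $$F(\lambda)=\sum_{n=0}^\infty F(\lambda_n)\frac{\Omega(\lambda)}{(\lambda-\lambda_n)\Omega'(\lambda_n)}\qquad(\lambda\in\mathbb C),$$ where the fraction is understood as its limit $1$ at $\lambda=\lambda_n$. The series converges absolutely for every $\lambda\in\mathbb C$ and uniformly on compact subsets of $\mathbb C$. -/

import Mathlib

open Filter Topology MeasureTheory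

noncomputable section

/-- The data of the Sturm-Liouville problem `-u'' + q u = z u` on `[a, b]` with two interior points of
discontinuity `θ ± ε`, `θ = (a + b) / 2`, transmission conditions with real coefficients `δ, γ` there,
and the spectral parameter `z` in the boundary condition at `b`. -/
structure SLProblem where
  (a b ε : ℝ)
  (β₁ β₂ α₁ α₂ α₁' α₂' δ γ : ℝ)
  q : ℝ → ℝ
  ε_pos : 0 < ε
  ε_lt : ε < (b - a) / 2
  β_ne : |β₁| + |β₂| ≠ 0
  δ_ne : δ ≠ 0
  γ_ne : γ ≠ 0
  ρ_pos : 0 < α₁' * α₂ - α₁ * α₂'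
  q_cont_left : ContinuousOn q (Set.Ico a ((a + b) / 2 - ε))
  q_cont_mid : ContinuousOn q (Set.Ioo ((a + b) / 2 - ε) ((a + b) / 2 + ε))
  q_cont_right : ContinuousOn q (Set.Ioc ((a + b) / 2 + ε) b)
  q_lim₁ : ∃ l, Tendsto q (𝓝[<] ((a + b) / 2 - ε)) (𝓝 l)
  q_lim₂ : ∃ l, Tendsto q (𝓝[>] ((a + b) / 2 - ε)) (𝓝 l)
  q_lim₃ : ∃ l, Tendsto q (𝓝[<] ((a + b) / 2 + ε)) (𝓝 l)
  q_lim₄ : ∃ l, Tendsto q (𝓝[>] ((a + b) / 2 + ε)) (𝓝 l)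

namespace SLProblem

variable (P : SLProblem)

/-- The left point of discontinuity. -/
def θm : ℝ := (P.a + P.b) / 2 - P.ε

/-- The right point of discontinuity. -/
def θp : ℝ := (P.a + P.b) / 2 + P.ε

/-- `I = [a, θ₋) ∪ (θ₋, θ₊) ∪ (θ₊, b]`. -/
def I : Set ℝ := Set.Ico P.a P.θm ∪ Set.Ioo P.θm P.θp ∪ Set.Ioc P.θp P.b

/-- `u`, with derivative `u'`, solves `-u'' + q u = z u` on `I` (one-sided derivatives at `a`, `b`). -/
def IsSolution (z : ℂ) (u u' : ℝ → ℂ) : Prop :=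
  ∀ x ∈ P.I, HasDerivWithinAt u (u' x) P.I x ∧
    HasDerivWithinAt u' (((P.q x : ℂ) - z) * u x) P.I x

/-- `u` has finite one-sided limits at `p`, and `c * u(p-) = d * u(p+)`. -/
def JumpCondition (p : ℝ) (c d : ℂ) (u : ℝ → ℂ) : Prop :=
  ∃ l r : ℂ, Tendsto u (𝓝[<] p) (𝓝 l) ∧ Tendsto u (𝓝[>] p) (𝓝 r) ∧ c * l = d * r

/-- The four transmission conditions `u(θ₋-) = δ u(θ₋+)`, `δ u(θ₊-) = γ u(θ₊+)`, and the same
for `u'`. -/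
def Transmission (u u' : ℝ → ℂ) : Prop :=
  JumpCondition P.θm 1 P.δ u ∧ JumpCondition P.θm 1 P.δ u' ∧
  JumpCondition P.θp P.δ P.γ u ∧ JumpCondition P.θp P.δ P.γ u'

/-- The pair `(u, u')` is the solution with `u(a) = β₂`, `u'(a) = -β₁`, continued from left to right
by the transmission conditions. -/
def IsPhi (z : ℂ) (w : (ℝ → ℂ) × (ℝ → ℂ)) : Prop :=
  P.IsSolution z w.1 w.2 ∧ P.Transmission w.1 w.2 ∧ w.1 P.a = P.β₂ ∧ w.2 P.a = -P.β₁

/-- The pair `(u, u')` is the solution with `u(b) = z α₂' + α₂`, `u'(b) = z α₁' + α₁`, continued from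
right to left by the transmission conditions. -/
def IsChi (z : ℂ) (w : (ℝ → ℂ) × (ℝ → ℂ)) : Prop :=
  P.IsSolution z w.1 w.2 ∧ P.Transmission w.1 w.2 ∧
    w.1 P.b = z * P.α₂' + P.α₂ ∧ w.2 P.b = z * P.α₁' + P.α₁

/-- The solution `φ_z` with its derivative: the pair satisfying `IsPhi`, which exists and is unique
on `I` by the theory of linear differential equations. -/
def phiPair (z : ℂ) : (ℝ → ℂ) × (ℝ → ℂ) := Classical.epsilon (P.IsPhi z)

/-- The solution `χ_z` with its derivative: the pair satisfying `IsChi`, unique on `I`. -/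
def chiPair (z : ℂ) : (ℝ → ℂ) × (ℝ → ℂ) := Classical.epsilon (P.IsChi z)

def phi (z : ℂ) (x : ℝ) : ℂ := (P.phiPair z).1 x
def phi' (z : ℂ) (x : ℝ) : ℂ := (P.phiPair z).2 x
def chi (z : ℂ) (x : ℝ) : ℂ := (P.chiPair z).1 x
def chi' (z : ℂ) (x : ℝ) : ℂ := (P.chiPair z).2 x

/-- `ω(z)`: the Wronskian `φ χ' - φ' χ` on `[a, θ₋)`, where it is constant in `x`, taken at `a`. -/
def omega (z : ℂ) : ℂ := P.phi z P.a * P.chi' z P.a - P.phi' z P.a * P.chi z P.a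

/-- Green's function `G(x, y, z)`; it has poles at the zeros of `ω`, where the value here is `0`. -/
def green (x y : ℝ) (z : ℂ) : ℂ :=
  (1 / P.omega z) * (if y ≤ x then P.chi z x * P.phi z y else P.chi z y * P.phi z x)

/-- `G(x, z) = Ω(z) G(x, y₀, z)`, with the removable singularities at the poles of Green's function
removed. -/
def regGreen (Ω : ℂ → ℂ) (y₀ x : ℝ) (z : ℂ) : ℂ :=
  limUnder (𝓝[≠] z) (fun s => Ω s * P.green x y₀ s)

/-- `F(z) = ∫ G(x, z) conj (g x) dx` with weights `1`, `δ²`, `γ²` on the three subintervals. -/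
def transform (Ω : ℂ → ℂ) (y₀ : ℝ) (g : ℝ → ℂ) (z : ℂ) : ℂ :=
  (∫ x in P.a..P.θm, P.regGreen Ω y₀ x z * (starRingEnd ℂ) (g x)) +
  (P.δ : ℂ) ^ 2 * (∫ x in P.θm..P.θp, P.regGreen Ω y₀ x z * (starRingEnd ℂ) (g x)) +
  (P.γ : ℂ) ^ 2 * (∫ x in P.θp..P.b, P.regGreen Ω y₀ x z * (starRingEnd ℂ) (g x))

end SLProblem

/-- The factor of the canonical product at the zero `lam n`: `1 - z / lam n`, or `z` if `lam n = 0`. -/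
def canonicalFactor (lam : ℕ → ℝ) (z : ℂ) (n : ℕ) : ℂ :=
  if lam n = 0 then z else 1 - z / (lam n : ℂ)

/-- The canonical product with the (simple) zeros `lam n`: `∏ (1 - z / lam n)` if no `lam n` vanishes,
`z * ∏_{lam n ≠ 0} (1 - z / lam n)` otherwise. -/
def canonicalProduct (lam : ℕ → ℝ) (z : ℂ) : ℂ := ∏' n, canonicalFactor lam z n

/-- `f` is entire of exponential type (at most) `σ`:
`f` is entire and `limsup_{r → ∞} log (max_{|z| = r} |f z|) / r ≤ σ`. -/
def EntireOfExpType (σ : ℝ) (f : ℂ → ℂ) : Prop :=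
  Differentiable ℂ f ∧ ∀ η > 0, ∃ C : ℝ, ∀ z : ℂ, ‖f z‖ ≤ C * Real.exp ((σ + η) * ‖z‖)

/-- The sampling function `Ω(z) / ((z - c) Ω'(c))` at a simple zero `c` of `Ω`, with its limit `1`
at `z = c`. -/
def samplingFun (Ω : ℂ → ℂ) (c z : ℂ) : ℂ :=
  if z = c then 1 else Ω z / ((z - c) * deriv Ω c)

end

noncomputable section

/-!
Multiplication by the step function with the values `1`, `δ`, `γ` turns the transmission problem
into a Sturm-Liouville problem on all of `[a, b]`, with a bounded measurable potential and without
transmission conditions. Its solutions come from a Volterra equation, so they are entire in `z` and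
grow at most like `exp ((b - a) |s|)` for `z = s²`; the solutions from the two ends, glued at `y`,
give Green's function.

Since the condition at `b` contains `z` with `α₁' α₂ - α₁ α₂' > 0`, the problem is self-adjoint in
`L²(a, b) ⊕ ℂ`. Concretely, Lagrange's identity and the energy identity show that the zeros of the
Wronskian are real, simple and bounded below, and together with a Sobolev inequality they bound
Green's function off the real axis. Bessel's inequality for the eigenvectors in `L² ⊕ ℂ` makes the
sampling series converge absolutely. The difference of `F / ω` and the sampling series divided by
`ω` extends to an entire function `H` with `|Im z| |H z| = o(|z|)`, so `H = 0`. Finally `ω`, of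
growth order `1 / 2`, is a constant multiple of its canonical product by Hadamard's theorem, and the
constant cancels from the series.
-/

section Volterra

variable {𝕜 E : Type*} [RCLike 𝕜] [NormedAddCommGroup E] [NormedSpace 𝕜 E] {A : ℝ → E →L[𝕜] E}
  {K : ℝ}

lemma aestronglyMeasurable_clm_apply (hA : StronglyMeasurable A) {f : ℝ → E}
    (hf : Continuous f) : AEStronglyMeasurable (fun t => A t (f t)) volume :=
  (ContinuousLinearMap.id 𝕜 (E →L[𝕜] E)).aestronglyMeasurable_comp₂ hA.aestronglyMeasurable
    hf.aestronglyMeasurable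

lemma intervalIntegrable_clm_apply (hA : StronglyMeasurable A) (hK : ∀ t, ‖A t‖ ≤ K)
    {f : ℝ → E} (hf : Continuous f) (c d : ℝ) :
    IntervalIntegrable (fun t => A t (f t)) volume c d :=
  ((continuous_const.mul hf.norm).intervalIntegrable c d).mono_fun (f := fun t => K * ‖f t‖)
    (aestronglyMeasurable_clm_apply hA hf).restrict
    (.of_forall fun t => ((A t).le_of_opNorm_le (hK t) (f t)).trans (le_abs_self _))

variable [NormedSpace ℝ E] {a b : ℝ} (hab : a ≤ b)

lemma continuous_integral_clm_apply (hA : StronglyMeasurable A) (hK : ∀ t, ‖A t‖ ≤ K)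
    (f : C(Set.Icc a b, E)) :
    Continuous fun x => ∫ t in a..x, A t (Set.IccExtend hab f t) :=
  intervalIntegral.continuous_primitive
    (fun c d => intervalIntegrable_clm_apply hA hK (f.continuous.Icc_extend' (h := hab)) c d) a

lemma norm_integral_clm_apply_le (hK : ∀ t, ‖A t‖ ≤ K) (f : C(Set.Icc a b, E)) {x : ℝ}
    (hx : x ∈ Set.Icc a b) :
    ‖∫ t in a..x, A t (Set.IccExtend hab f t)‖ ≤ K * (b - a) * ‖f‖ := by
  have hK0 : 0 ≤ K := (norm_nonneg _).trans (hK a)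
  calc ‖∫ t in a..x, A t (Set.IccExtend hab f t)‖ ≤ K * ‖f‖ * |x - a| :=
        intervalIntegral.norm_integral_le_of_norm_le_const fun t _ =>
          ((A t).le_of_opNorm_le (hK t) _).trans
            (mul_le_mul_of_nonneg_left (f.norm_coe_le_norm _) hK0)
    _ = K * (x - a) * ‖f‖ := by rw [abs_of_nonneg (sub_nonneg.2 hx.1)]; ring
    _ ≤ K * (b - a) * ‖f‖ := by gcongr; exact hx.2

variable [SMulCommClass ℝ 𝕜 E]

/-- The Volterra operator `f ↦ (x ↦ ∫_a^x A(t) f(t) dt)` on the continuous functions on `[a, b]`,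
for a bounded strongly measurable operator-valued kernel `A`. -/
def volterra (hA : StronglyMeasurable A) (hK : ∀ t, ‖A t‖ ≤ K) :
    C(Set.Icc a b, E) →L[𝕜] C(Set.Icc a b, E) :=
  LinearMap.mkContinuous
    { toFun f := ⟨fun x => ∫ t in a..(x : ℝ), A t (Set.IccExtend hab f t),
        (continuous_integral_clm_apply hab hA hK f).comp continuous_subtype_val⟩
      map_add' f g := by
        ext x
        simp only [ContinuousMap.coe_mk, ContinuousMap.add_apply]
        rw [← intervalIntegral.integral_add
          (intervalIntegrable_clm_apply hA hK (f.continuous.Icc_extend' (h := hab)) _ _)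
          (intervalIntegrable_clm_apply hA hK (g.continuous.Icc_extend' (h := hab)) _ _)]
        exact intervalIntegral.integral_congr fun t _ => map_add (A t) _ _
      map_smul' c f := by
        ext x
        simp only [ContinuousMap.coe_mk, ContinuousMap.smul_apply, RingHom.id_apply]
        rw [← intervalIntegral.integral_smul]
        exact intervalIntegral.integral_congr fun t _ => map_smul (A t) c _ }
    (K * (b - a)) fun f => (ContinuousMap.norm_le _ (mul_nonneg (mul_nonneg
        ((norm_nonneg _).trans (hK a)) (sub_nonneg.2 hab)) (norm_nonneg f))).2 fun x =>
      norm_integral_clm_apply_le hab hK f x.2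

lemma volterra_apply (hA : StronglyMeasurable A) (hK : ∀ t, ‖A t‖ ≤ K) (f : C(Set.Icc a b, E))
    (x : Set.Icc a b) :
    volterra hab hA hK f x = ∫ t in a..(x : ℝ), A t (Set.IccExtend hab f t) := rfl

lemma norm_volterra_pow_apply_le (hA : StronglyMeasurable A) (hK : ∀ t, ‖A t‖ ≤ K)
    (f : C(Set.Icc a b, E)) (n : ℕ) (x : Set.Icc a b) :
    ‖(volterra hab hA hK ^ n) f x‖ ≤ (K * ((x : ℝ) - a)) ^ n / n.factorial * ‖f‖ := by
  have hK0 : 0 ≤ K := (norm_nonneg _).trans (hK a)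
  induction n generalizing x with
  | zero => simpa using f.norm_coe_le_norm x
  | succ n ih =>
    rw [pow_succ', mul_apply_eq_comp, volterra_apply]
    calc ‖∫ t in a..(x : ℝ), A t (Set.IccExtend hab ((volterra hab hA hK ^ n) f) t)‖
        ≤ ∫ t in a..(x : ℝ), K * ((K * (t - a)) ^ n / n.factorial * ‖f‖) := by
          refine intervalIntegral.norm_integral_le_of_norm_le x.2.1
            (.of_forall fun t ht => ?_) (Continuous.intervalIntegrable (by fun_prop) _ _)
          have ht' : t ∈ Set.Icc a b := ⟨ht.1.le, ht.2.trans x.2.2⟩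
          rw [Set.IccExtend_of_mem hab _ ht']
          exact ((A t).le_of_opNorm_le (hK t) _).trans
            (mul_le_mul_of_nonneg_left (ih ⟨t, ht'⟩) hK0)
      _ = K ^ (n + 1) / n.factorial * ‖f‖ * ∫ t in a..(x : ℝ), (t - a) ^ n := by
          rw [← intervalIntegral.integral_const_mul]
          refine intervalIntegral.integral_congr fun t _ => ?_
          simp only [mul_pow]
          ring
      _ = (K * ((x : ℝ) - a)) ^ (n + 1) / (n + 1).factorial * ‖f‖ := by
          rw [intervalIntegral.integral_comp_sub_right (fun t => t ^ n), integral_pow,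
            Nat.factorial_succ, sub_self, zero_pow n.succ_ne_zero, sub_zero, mul_pow]
          push_cast
          field_simp

lemma isUnit_one_sub_volterra [CompleteSpace E] (hA : StronglyMeasurable A)
    (hK : ∀ t, ‖A t‖ ≤ K) : IsUnit (1 - volterra hab hA hK) := by
  set T := volterra hab hA hK
  have hK0 : 0 ≤ K := (norm_nonneg _).trans (hK a)
  have : 0 ≤ b - a := sub_nonneg.2 hab
  obtain ⟨n, hn⟩ := ((FloorSemiring.tendsto_pow_div_factorial_atTop (K * (b - a))).eventually
    (gt_mem_nhds one_pos)).exists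
  have hTn : ‖T ^ n‖ < 1 := by
    refine lt_of_le_of_lt (ContinuousLinearMap.opNorm_le_bound _ (by positivity) fun f => ?_) hn
    refine (ContinuousMap.norm_le _ (by positivity)).2 fun x => ?_
    refine (norm_volterra_pow_apply_le hab hA hK f n x).trans ?_
    have hxa : 0 ≤ (x : ℝ) - a := sub_nonneg.2 x.2.1
    gcongr
    exact x.2.2
  have hunit : IsUnit (1 - T ^ n) :=
    isUnit_one_sub_of_norm_lt_one (R := C(Set.Icc a b, E) →L[𝕜] C(Set.Icc a b, E)) hTn
  rw [← mul_neg_geom_sum] at hunit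
  have hcomm : Commute (1 - T) (∑ i ∈ Finset.range n, T ^ i) :=
    (Commute.one_left _).sub_left (Commute.sum_right _ _ _ fun i _ => Commute.self_pow T i)
  exact (hcomm.isUnit_mul_iff.1 hunit).1

end Volterra

lemma differentiable_ringInverse_one_sub_apply {𝕜 F : Type*} [NontriviallyNormedField 𝕜]
    [NormedAddCommGroup F] [NormedSpace 𝕜 F] [CompleteSpace F] {T : 𝕜 → F →L[𝕜] F} {W : F →L[𝕜] F}
    (hT : ∀ z, T z = T 0 - z • W) (hunit : ∀ z, IsUnit (1 - T z)) {f : 𝕜 → F}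
    (hf : Differentiable 𝕜 f) : Differentiable 𝕜 fun z => Ring.inverse (1 - T z) (f z) := by
  have hsub : Differentiable 𝕜 fun z => 1 - T z := by
    rw [funext hT]
    fun_prop
  exact Differentiable.clm_apply (fun z =>
    (differentiableAt_inverse (hunit z)).comp z (f := fun z => 1 - T z) (hsub z)) hf

lemma le_mul_exp_of_le_add_integral {a b A K : ℝ} (hK : 0 ≤ K) {f : ℝ → ℝ}
    (hf : ContinuousOn f (Set.Icc a b))
    (h : ∀ x ∈ Set.Icc a b, f x ≤ A + K * ∫ t in a..x, f t) {x : ℝ} (hx : x ∈ Set.Icc a b) :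
    f x ≤ A * Real.exp (K * (x - a)) := by
  have hint : IntervalIntegrable f volume a b :=
    ContinuousOn.intervalIntegrable (by rwa [Set.uIcc_of_le (hx.1.trans hx.2)])
  have hderiv : ∀ y ∈ Set.Icc a b, HasDerivWithinAt (fun y => A + K * ∫ t in a..y, f t) (K * f y)
      (Set.Icc a b) y := fun y hy => by
    have : Fact (y ∈ Set.Icc a b) := ⟨hy⟩
    refine ((intervalIntegral.integral_hasDerivWithinAt_right (hint.mono_set ?_)
      (hf.stronglyMeasurableAtFilter_nhdsWithin measurableSet_Icc y) (hf y hy)).const_mul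
        K).const_add A
    exact Set.uIcc_subset_uIcc Set.left_mem_uIcc (Set.Icc_subset_uIcc hy)
  rw [← gronwallBound_ε0]
  refine (h x hx).trans (le_gronwallBound_of_liminf_deriv_right_le (f' := fun y => K * f y)
    (fun y hy => (hderiv y hy).continuousWithinAt) (fun y hy r hr => ?_) (by simp)
    (fun y hy => ?_) x hx)
  · have hIci := (hderiv y (Set.Ico_subset_Icc_self hy)).mono_of_mem_nhdsWithin
      (Icc_mem_nhdsGE_of_mem hy)
    simpa only [slope_def_field, div_eq_inv_mul] using hIci.liminf_right_slope_le hr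
  · rw [add_zero]
    exact mul_le_mul_of_nonneg_left (h y (Set.Ico_subset_Icc_self hy)) hK

lemma intervalIntegrable_bdd_mul {𝕜 : Type*} [RCLike 𝕜] {m f : ℝ → 𝕜} (hm : Measurable m)
    {K : ℝ} (hK : ∀ x, ‖m x‖ ≤ K) {c d : ℝ} (hf : IntervalIntegrable f volume c d) :
    IntervalIntegrable (fun x => m x * f x) volume c d := by
  rw [intervalIntegrable_iff] at hf ⊢
  exact hf.bdd_mul hm.aestronglyMeasurable (.of_forall hK)

section Piecewise

variable {E : Type*} [NormedAddCommGroup E] {f g : ℝ → E} {a b y : ℝ}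

lemma intervalIntegrable_ite_le (hy : y ∈ Set.Icc a b) (hf : IntervalIntegrable f volume a y)
    (hg : IntervalIntegrable g volume y b) :
    IntervalIntegrable (fun x => if x ≤ y then f x else g x) volume a b := by
  refine (hf.congr fun x hx => ?_).trans (hg.congr fun x hx => ?_)
  · rw [Set.uIoc_of_le hy.1] at hx
    simp [hx.2]
  · rw [Set.uIoc_of_le hy.2] at hx
    simp [hx.1]

lemma integral_ite_le_eq_add [NormedSpace ℝ E] (hy : y ∈ Set.Icc a b)
    (hf : IntervalIntegrable f volume a y) (hg : IntervalIntegrable g volume y b) :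
    ∫ x in a..b, (if x ≤ y then f x else g x) = (∫ x in a..y, f x) + ∫ x in y..b, g x := by
  have hleft : Set.EqOn f (fun x => if x ≤ y then f x else g x) (Set.uIoc a y) := fun x hx => by
    rw [Set.uIoc_of_le hy.1] at hx
    simp [hx.2]
  have hright : Set.EqOn g (fun x => if x ≤ y then f x else g x) (Set.uIoc y b) := fun x hx => by
    rw [Set.uIoc_of_le hy.2] at hx
    simp [hx.1]
  rw [← intervalIntegral.integral_add_adjacent_intervals (hf.congr hleft) (hg.congr hright),
    intervalIntegral.integral_congr_ae (.of_forall fun x hx => hleft hx),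
    intervalIntegral.integral_congr_ae (.of_forall fun x hx => hright hx)]

end Piecewise

section Sobolev

variable {E : Type*} [NormedAddCommGroup E] [InnerProductSpace ℝ E] {a b τ : ℝ} {S : Set ℝ}
  {u u' : ℝ → E}

lemma norm_two_mul_inner_le (hτ : 0 < τ) (v w : E) :
    ‖2 * inner ℝ v w‖ ≤ τ * ‖w‖ ^ 2 + 1 / τ * ‖v‖ ^ 2 := by
  have hinner : ‖inner ℝ v w‖ ≤ ‖v‖ * ‖w‖ := norm_inner_le_norm _ _
  have hsq : 0 ≤ (τ * ‖w‖ - ‖v‖) ^ 2 / τ := by positivity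
  have hexpand : (τ * ‖w‖ - ‖v‖) ^ 2 / τ =
      τ * ‖w‖ ^ 2 + 1 / τ * ‖v‖ ^ 2 - 2 * (‖v‖ * ‖w‖) := by
    field_simp
    ring
  rw [norm_mul, Real.norm_ofNat]
  linarith

lemma norm_sq_sub_norm_sq_eq_integral (hS : S.Countable) (hu : ContinuousOn u (Set.Icc a b))
    (hd : ∀ x ∈ Set.Ioo a b \ S, HasDerivAt u (u' x) x) {x y : ℝ} (hx : x ∈ Set.Icc a b)
    (hy : y ∈ Set.Icc a b)
    (hi : IntervalIntegrable (fun t => 2 * inner ℝ (u t) (u' t)) volume y x) :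
    ‖u x‖ ^ 2 - ‖u y‖ ^ 2 = ∫ t in y..x, 2 * inner ℝ (u t) (u' t) :=
  (integral_eq_of_hasDerivAt_off_countable (fun t => ‖u t‖ ^ 2) _ hS
    ((hu.norm.pow 2).mono (Set.uIcc_subset_Icc hy hx))
    (fun _ ht => (hd _ ⟨⟨(le_min hy.1 hx.1).trans_lt ht.1.1,
      ht.1.2.trans_le (max_le hy.2 hx.2)⟩, ht.2⟩).norm_sq) hi).symm

-- The idea is `(‖u‖²)' = 2⟪u, u'⟫ ≤ τ‖u'‖² + ‖u‖² / τ`.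
lemma norm_sq_sub_norm_sq_le (hab : a ≤ b) (hS : S.Countable) (hu : ContinuousOn u (Set.Icc a b))
    (hd : ∀ x ∈ Set.Ioo a b \ S, HasDerivAt u (u' x) x)
    (hi : IntervalIntegrable u' volume a b)
    (hi2 : IntervalIntegrable (fun x => ‖u' x‖ ^ 2) volume a b) (hτ : 0 < τ) {x y : ℝ}
    (hx : x ∈ Set.Icc a b) (hy : y ∈ Set.Icc a b) :
    ‖u x‖ ^ 2 - ‖u y‖ ^ 2 ≤ ∫ t in a..b, (τ * ‖u' t‖ ^ 2 + 1 / τ * ‖u t‖ ^ 2) := by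
  have hu2 : IntervalIntegrable (fun x => ‖u x‖ ^ 2) volume a b :=
    ContinuousOn.intervalIntegrable (by rw [Set.uIcc_of_le hab]; exact hu.norm.pow 2)
  have hsum : IntervalIntegrable (fun t => τ * ‖u' t‖ ^ 2 + 1 / τ * ‖u t‖ ^ 2) volume a b :=
    (hi2.const_mul τ).add (hu2.const_mul _)
  have hsum' := (intervalIntegrable_iff_integrableOn_Ioc_of_le hab).1 hsum
  have hbound : ∀ t, ‖2 * inner ℝ (u t) (u' t)‖ ≤ τ * ‖u' t‖ ^ 2 + 1 / τ * ‖u t‖ ^ 2 :=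
    fun t => norm_two_mul_inner_le hτ _ _
  have hyx : Set.uIcc y x ⊆ Set.Icc a b := Set.uIcc_subset_Icc hy hx
  have hyx' : Set.uIoc y x ⊆ Set.Ioc a b :=
    Set.Ioc_subset_Ioc (le_min hy.1 hx.1) (max_le hy.2 hx.2)
  have hinner : IntervalIntegrable (fun t => 2 * inner ℝ (u t) (u' t)) volume y x := by
    have hmeas : AEStronglyMeasurable u (volume.restrict (Set.uIoc y x)) :=
      ((hu.mono hyx).aestronglyMeasurable measurableSet_uIcc).mono_measure
        (Measure.restrict_mono Set.uIoc_subset_uIcc le_rfl)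
    rw [← Set.uIcc_of_le hab] at hyx
    exact (hsum.mono_set hyx).mono_fun ((hmeas.inner (𝕜 := ℝ)
      (intervalIntegrable_iff.1 (hi.mono_set hyx)).aestronglyMeasurable).const_mul 2)
      (.of_forall fun t => (hbound t).trans (le_abs_self _))
  calc ‖u x‖ ^ 2 - ‖u y‖ ^ 2
      = ∫ t in y..x, 2 * inner ℝ (u t) (u' t) :=
        norm_sq_sub_norm_sq_eq_integral hS hu hd hx hy hinner
    _ ≤ ∫ t in Set.uIoc y x, ‖2 * inner ℝ (u t) (u' t)‖ :=
        (Real.le_norm_self _).trans intervalIntegral.norm_integral_le_integral_norm_uIoc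
    _ ≤ ∫ t in Set.uIoc y x, (τ * ‖u' t‖ ^ 2 + 1 / τ * ‖u t‖ ^ 2) :=
        integral_mono_of_nonneg (.of_forall fun t => norm_nonneg _) (hsum'.mono_set hyx')
          (.of_forall hbound)
    _ ≤ ∫ t in Set.Ioc a b, (τ * ‖u' t‖ ^ 2 + 1 / τ * ‖u t‖ ^ 2) :=
        setIntegral_mono_set hsum' (.of_forall fun t => (norm_nonneg _).trans (hbound t))
          hyx'.eventuallyLE
    _ = ∫ t in a..b, (τ * ‖u' t‖ ^ 2 + 1 / τ * ‖u t‖ ^ 2) :=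
        (intervalIntegral.integral_of_le hab).symm

lemma norm_sq_le_integral_add_integral_deriv (hab : a < b) (hS : S.Countable)
    (hu : ContinuousOn u (Set.Icc a b))
    (hd : ∀ x ∈ Set.Ioo a b \ S, HasDerivAt u (u' x) x)
    (hi : IntervalIntegrable u' volume a b)
    (hi2 : IntervalIntegrable (fun x => ‖u' x‖ ^ 2) volume a b) (hτ : 0 < τ) {x : ℝ}
    (hx : x ∈ Set.Icc a b) :
    ‖u x‖ ^ 2 ≤ (1 / (b - a) + 1 / τ) * (∫ t in a..b, ‖u t‖ ^ 2) +
      τ * ∫ t in a..b, ‖u' t‖ ^ 2 := by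
  have hu2 : ContinuousOn (fun x => ‖u x‖ ^ 2) (Set.uIcc a b) := by
    rw [Set.uIcc_of_le hab.le]
    exact hu.norm.pow 2
  obtain ⟨y, hy, hmean⟩ := exists_eq_interval_average hab.ne hu2
  rw [Set.uIoo_of_le hab.le] at hy
  have hosc := norm_sq_sub_norm_sq_le hab.le hS hu hd hi hi2 hτ hx (Set.Ioo_subset_Icc_self hy)
  rw [intervalIntegral.integral_add (hi2.const_mul τ) (hu2.intervalIntegrable.const_mul _),
    intervalIntegral.integral_const_mul, intervalIntegral.integral_const_mul] at hosc
  rw [interval_average_eq_div, div_eq_mul_one_div] at hmean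
  linarith

end Sobolev

lemma ofReal_norm_sq_eq_mul_conj (w : ℂ) : ((‖w‖ ^ 2 : ℝ) : ℂ) = w * starRingEnd ℂ w := by
  rw [Complex.mul_conj, Complex.normSq_eq_norm_sq]

lemma integral_mul_conj_self (u : ℝ → ℂ) (c d : ℝ) :
    ∫ x in c..d, u x * starRingEnd ℂ (u x) = ((∫ x in c..d, ‖u x‖ ^ 2 : ℝ) : ℂ) := by
  simp_rw [← ofReal_norm_sq_eq_mul_conj]
  exact intervalIntegral.integral_ofReal

lemma eq_zero_of_integral_mul_conj_eq_zero {u : ℝ → ℂ} {a b x : ℝ} (hab : a < b)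
    (hu : Continuous u) (h : ∫ x in a..b, u x * starRingEnd ℂ (u x) = 0)
    (hx : x ∈ Set.Icc a b) : u x = 0 := by
  rw [integral_mul_conj_self, Complex.ofReal_eq_zero] at h
  by_contra hne
  exact (intervalIntegral.integral_pos hab (hu.norm.pow 2).continuousOn
    (fun _ _ => sq_nonneg _) ⟨x, hx, pow_pos (norm_pos_iff.2 hne) 2⟩).ne' h

lemma exists_eq_mul_of_mul_eq_mul {K : Type*} [Field K] {a b c d : K} (hab : ¬(a = 0 ∧ b = 0))
    (h : a * d = b * c) : ∃ m, c = m * a ∧ d = m * b := by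
  by_cases ha : a = 0
  · have hb : b ≠ 0 := fun hb => hab ⟨ha, hb⟩
    have hc : c = 0 := by simpa [ha, hb] using h.symm
    exact ⟨d / b, by simp [ha, hc], (div_mul_cancel₀ d hb).symm⟩
  · refine ⟨c / a, (div_mul_cancel₀ c ha).symm, ?_⟩
    field_simp
    linear_combination h

lemma differentiable_integral_clm_apply_mul {𝕜 X E : Type*} [RCLike 𝕜] [TopologicalSpace X]
    [CompactSpace X] [NormedAddCommGroup E] [NormedSpace 𝕜 E] {Φ : 𝕜 → C(X, E)}
    (hΦ : Differentiable 𝕜 Φ) (ℓ : E →L[𝕜] 𝕜) {m : ℝ → X} (hm : Continuous m) {h : ℝ → 𝕜}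
    {c d : ℝ} (hh : IntervalIntegrable h volume c d) :
    Differentiable 𝕜 fun z => ∫ x in c..d, ℓ (Φ z (m x)) * h x := by
  have hint : ∀ f : C(X, E), IntervalIntegrable (fun x => ℓ (f (m x)) * h x) volume c d :=
    fun f => hh.continuousOn_mul (ℓ.continuous.comp (f.continuous.comp hm)).continuousOn
  let L : C(X, E) →ₗ[𝕜] 𝕜 :=
    { toFun f := ∫ x in c..d, ℓ (f (m x)) * h x
      map_add' f g := by
        rw [← intervalIntegral.integral_add (hint f) (hint g)]
        exact intervalIntegral.integral_congr fun x _ => by simp [add_mul]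
      map_smul' r f := by
        rw [RingHom.id_apply, smul_eq_mul, ← intervalIntegral.integral_const_mul]
        exact intervalIntegral.integral_congr fun x _ => by simp [mul_assoc] }
  have hL : ∀ f, ‖L f‖ ≤ ‖ℓ‖ * |∫ x in c..d, ‖h x‖| * ‖f‖ := fun f => by
    calc ‖L f‖ ≤ |∫ x in c..d, ‖ℓ‖ * ‖f‖ * ‖h x‖| := by
          refine intervalIntegral.norm_integral_le_abs_of_norm_le (.of_forall fun x => ?_)
            (hh.norm.const_mul _)
          rw [norm_mul]
          gcongr
          exact ℓ.le_opNorm_of_le (f.norm_coe_le_norm _)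
      _ = ‖ℓ‖ * |∫ x in c..d, ‖h x‖| * ‖f‖ := by
          rw [intervalIntegral.integral_const_mul, abs_mul, abs_mul, abs_norm, abs_norm]
          ring
  exact (L.mkContinuous _ hL).differentiable.comp hΦ

lemma sum_norm_inner_sq_div_le {𝕜 ι H : Type*} [RCLike 𝕜] [NormedAddCommGroup H]
    [InnerProductSpace 𝕜 H] {e : ι → H} (he : ∀ i, e i ≠ 0)
    (ho : Pairwise fun i j => inner 𝕜 (e i) (e j) = 0) (s : Finset ι) (f : H) :
    ∑ i ∈ s, ‖inner 𝕜 (e i) f‖ ^ 2 / ‖e i‖ ^ 2 ≤ ‖f‖ ^ 2 := by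
  have hon : Orthonormal 𝕜 fun i => (‖e i‖⁻¹ : 𝕜) • e i :=
    ⟨fun i => norm_smul_inv_norm (he i), fun i j hij => by
      simp only
      rw [inner_smul_left, inner_smul_right, ho hij, mul_zero, mul_zero]⟩
  refine le_trans (Finset.sum_le_sum fun i _ => ?_) (hon.sum_inner_products_le f (s := s))
  rw [inner_smul_left, norm_mul, mul_pow, RCLike.norm_conj, norm_inv, RCLike.norm_ofReal,
    abs_norm, inv_pow, div_eq_inv_mul]

lemma sum_norm_inner_mul_norm_inner_div_le {𝕜 ι H : Type*} [RCLike 𝕜] [NormedAddCommGroup H]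
    [InnerProductSpace 𝕜 H] {e : ι → H} (he : ∀ i, e i ≠ 0)
    (ho : Pairwise fun i j => inner 𝕜 (e i) (e j) = 0) (s : Finset ι) (f g : H) :
    ∑ i ∈ s, ‖inner 𝕜 (e i) f‖ * ‖inner 𝕜 (e i) g‖ / ‖e i‖ ^ 2 ≤ ‖f‖ * ‖g‖ := by
  have hcauchy := Finset.sum_mul_sq_le_sq_mul_sq s (fun i => ‖inner 𝕜 (e i) f‖ / ‖e i‖)
    (fun i => ‖inner 𝕜 (e i) g‖ / ‖e i‖)
  simp_rw [div_mul_div_comm, ← sq, div_pow] at hcauchy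
  refine (sq_le_sq₀ (Finset.sum_nonneg fun _ _ => by positivity) (by positivity)).1 ?_
  rw [mul_pow]
  exact hcauchy.trans (mul_le_mul (sum_norm_inner_sq_div_le he ho s f)
    (sum_norm_inner_sq_div_le he ho s g) (Finset.sum_nonneg fun _ _ => by positivity)
    (sq_nonneg _))

lemma isBounded_image_Ioo {E : Type*} [MetricSpace E] {f : ℝ → E} {c d : ℝ} {l r : E}
    (hf : ContinuousOn f (Set.Ioo c d)) (hl : Tendsto f (𝓝[>] c) (𝓝 l))
    (hr : Tendsto f (𝓝[<] d) (𝓝 r)) : Bornology.IsBounded (f '' Set.Ioo c d) := by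
  refine (isCompact_Icc.image_of_continuousOn
    (continuousOn_Icc_extendFrom_Ioo hf hl hr)).isBounded.subset ?_
  rintro _ ⟨x, hx, rfl⟩
  exact ⟨x, Set.Ioo_subset_Icc_self hx, extendFrom_extends hf x hx⟩

lemma tendsto_add_mul_sqrt_div_atTop (A c : ℝ) :
    Tendsto (fun r : ℝ => (A + c * √r) / r) atTop (𝓝 0) := by
  have hsqrt : Tendsto (fun r : ℝ => √r / r) atTop (𝓝 0) := by
    simp only [Real.sqrt_div_self', one_div]
    exact tendsto_inv_atTop_zero.comp Real.tendsto_sqrt_atTop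
  have hsum := (tendsto_inv_atTop_zero.const_mul A).add (hsqrt.const_mul c)
  simp only [mul_zero, add_zero] at hsum
  exact hsum.congr fun r => by ring

section Enumeration

variable {S : Set ℝ}

lemma exists_strictMono_enumeration (hS : S.Infinite) (hf : ∀ r, (S ∩ Set.Iic r).Finite) :
    ∃ e : ℕ ≃ S, StrictMono fun n => (e n : ℝ) := by
  let _ : LocallyFiniteOrder S := LocallyFiniteOrder.ofFiniteIcc fun x y =>
    .of_finite_image ((hf y).subset (Set.image_subset_iff.2 fun z hz => ⟨z.2, hz.2⟩))
      Subtype.val_injective.injOn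
  obtain ⟨x₀, hx₀⟩ := hS.nonempty
  obtain ⟨m, hm, hmin⟩ := Set.exists_min_image (S ∩ Set.Iic x₀) id (hf x₀)
    ⟨x₀, hx₀, Set.self_mem_Iic⟩
  let _ : OrderBot S :=
    { bot := ⟨m, hm.1⟩
      bot_le x := (le_total (x : ℝ) x₀).elim (fun h => hmin x ⟨x.2, h⟩)
        (show m ≤ x₀ from hm.2).trans }
  have : NoMaxOrder S := ⟨fun x => by
    by_contra! h
    exact hS ((hf x).subset fun y hy => ⟨hy, h ⟨y, hy⟩⟩)⟩
  let _ : SuccOrder S := LinearLocallyFiniteOrder.succOrder S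
  let _ : PredOrder S := LinearLocallyFiniteOrder.predOrder S
  let o : ℕ ≃o S := orderIsoNatOfLinearSuccPredArch.symm
  exact ⟨o.toEquiv, fun i j hij => Subtype.coe_lt_coe.2 (o.strictMono hij)⟩

lemma tendsto_atTop_of_enumeration (hf : ∀ r, (S ∩ Set.Iic r).Finite) {lam : ℕ → ℝ}
    (hmono : StrictMono lam) (hS : ∀ n, lam n ∈ S) : Tendsto lam atTop atTop := by
  refine tendsto_atTop_atTop_of_monotone hmono.monotone fun b => ?_
  by_contra! h
  refine Set.infinite_range_of_injective hmono.injective ((hf b).subset ?_)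
  rintro _ ⟨n, rfl⟩
  exact ⟨hS n, (h n).le⟩

end Enumeration

section Entire

lemma deriv_eq_of_sub_mul_eq {𝕜 : Type*} [NontriviallyNormedField 𝕜] {f g : 𝕜 → 𝕜} {c : 𝕜}
    (hg : DifferentiableAt 𝕜 g c) (h : ∀ z, (z - c) * g z = f z) : deriv f c = g c := by
  rw [← funext h, (((hasDerivAt_id' c).sub_const c).fun_mul hg.hasDerivAt).deriv]
  simp

lemma differentiable_dslope {f : ℂ → ℂ} (hf : Differentiable ℂ f) (c : ℂ) :
    Differentiable ℂ (dslope f c) :=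
  differentiableOn_univ.1 ((Complex.differentiableOn_dslope univ_mem).2 hf.differentiableOn)

lemma exists_eq_mul_of_simple_zeros {f w : ℂ → ℂ} (hf : Differentiable ℂ f)
    (hw : Differentiable ℂ w) (h : ∀ z, w z = 0 → f z = 0 ∧ deriv w z ≠ 0) :
    ∃ H : ℂ → ℂ, Differentiable ℂ H ∧ ∀ z, f z = H z * w z := by
  classical
  refine ⟨fun z => if w z = 0 then deriv f z / deriv w z else f z / w z, fun c => ?_,
    fun z => ?_⟩
  · by_cases hc : w c = 0
    · have hslope : dslope w c c ≠ 0 := by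
        rw [dslope_same]
        exact (h c hc).2
      refine ((differentiable_dslope hf c c).div (differentiable_dslope hw c c)
        hslope).congr_of_eventuallyEq ?_
      filter_upwards [(differentiable_dslope hw c).continuous.continuousAt.eventually_ne hslope]
        with z hz
      rcases eq_or_ne z c with rfl | hzc
      · simp only [if_pos hc, Pi.div_apply, dslope_same]
      · have hw_eq := sub_smul_dslope_of_zero hc z
        have hf_eq := sub_smul_dslope_of_zero (h c hc).1 z
        rw [smul_eq_mul] at hw_eq hf_eq
        have hzc' := sub_ne_zero.2 hzc
        simp only [Pi.div_apply]
        rw [if_neg (by rw [← hw_eq]; exact mul_ne_zero hzc' hz), ← hw_eq, ← hf_eq,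
          mul_div_mul_left _ _ hzc']
    · refine ((hf c).div (hw c) hc).congr_of_eventuallyEq ?_
      filter_upwards [hw.continuous.continuousAt.eventually_ne hc] with z hz
      rw [if_neg hz, Pi.div_apply]
  · by_cases hz : w z = 0
    · rw [hz, (h z hz).1, mul_zero]
    · simp only [if_neg hz, div_mul_cancel₀ _ hz]

-- On the circle `‖z‖ = r` one has `z² - r² = z (z - z̄)`, so the factor `z² - r²` absorbs `Im z`.
lemma norm_sq_sub_sq_mul_le {H : ℂ → ℂ} (hH : Differentiable ℂ H) {r B : ℝ} (hr : 0 < r)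
    (h : ∀ z : ℂ, ‖z‖ = r → ‖H z‖ * |z.im| ≤ B) {z : ℂ} (hz : ‖z‖ ≤ r) :
    ‖(z ^ 2 - (r : ℂ) ^ 2) * H z‖ ≤ 2 * r * B := by
  have hd : Differentiable ℂ fun z => (z ^ 2 - (r : ℂ) ^ 2) * H z := by fun_prop
  refine Complex.norm_le_of_forall_mem_frontier_norm_le (U := Metric.ball 0 r)
    Metric.isBounded_ball hd.diffContOnCl (fun w hw => ?_)
    (by rwa [closure_ball _ hr.ne', mem_closedBall_zero_iff])
  rw [frontier_ball _ hr.ne', mem_sphere_zero_iff_norm] at hw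
  have hfactor : w ^ 2 - (r : ℂ) ^ 2 = w * (2 * w.im * Complex.I) := by
    have hconj : (r : ℂ) ^ 2 = w * starRingEnd ℂ w := by rw [Complex.mul_conj', hw]
    have hsub := Complex.sub_conj w
    push_cast at hsub
    rw [hconj, ← hsub]
    ring
  calc ‖(w ^ 2 - (r : ℂ) ^ 2) * H w‖ = 2 * r * (‖H w‖ * |w.im|) := by
        simp only [hfactor, norm_mul, hw, Complex.norm_I, Complex.norm_real, Complex.norm_ofNat,
          Real.norm_eq_abs, mul_one]
        ring
    _ ≤ 2 * r * B := by gcongr; exact h w hw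

lemma eq_zero_of_norm_mul_abs_im_le {H : ℂ → ℂ} (hH : Differentiable ℂ H) {B : ℝ → ℝ}
    (hB : Tendsto (fun r => B r / r) atTop (𝓝 0)) (h : ∀ z : ℂ, ‖H z‖ * |z.im| ≤ B ‖z‖)
    (z : ℂ) : H z = 0 := by
  have hbound : ∀ r : ℝ, 0 < r → 2 * ‖z‖ ≤ r → ‖H z‖ ≤ 8 / 3 * (B r / r) := by
    intro r hr hzr
    have hmax := norm_sq_sub_sq_mul_le hH hr (fun w hw => hw ▸ h w)
      (z := z) (by linarith [norm_nonneg z])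
    have hlower : 3 / 4 * r ^ 2 ≤ ‖z ^ 2 - (r : ℂ) ^ 2‖ := by
      have htri := norm_sub_norm_le ((r : ℂ) ^ 2) (z ^ 2)
      rw [norm_sub_rev, norm_pow, norm_pow, Complex.norm_real, Real.norm_eq_abs,
        abs_of_pos hr] at htri
      nlinarith [pow_le_pow_left₀ (norm_nonneg z) (by linarith : ‖z‖ ≤ r / 2) 2]
    rw [norm_mul] at hmax
    have hmul : 3 / 4 * r ^ 2 * ‖H z‖ ≤ 2 * r * B r :=
      (mul_le_mul_of_nonneg_right hlower (norm_nonneg _)).trans hmax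
    rw [mul_div_assoc', le_div_iff₀ hr]
    nlinarith
  refine norm_le_zero_iff.1 (ge_of_tendsto (by simpa using hB.const_mul (8 / 3)) ?_)
  filter_upwards [eventually_gt_atTop 0, eventually_ge_atTop (2 * ‖z‖)] with r hr hzr
  exact hbound r hr hzr

lemma norm_dslope_le_of_norm_deriv_le {w : ℂ → ℂ} (hw : Differentiable ℂ w) {s : Set ℂ}
    (hs : Convex ℝ s) {D : ℝ} (hD : ∀ x ∈ s, ‖deriv w x‖ ≤ D) {c z : ℂ} (hc : c ∈ s)
    (hz : z ∈ s) : ‖dslope w c z‖ ≤ D := by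
  rcases eq_or_ne z c with rfl | hzc
  · rw [dslope_same]
    exact hD z hz
  · rw [dslope_of_ne _ hzc, slope_def_field, norm_div,
      div_le_iff₀ (norm_pos_iff.2 (sub_ne_zero.2 hzc))]
    exact hs.norm_image_sub_le_of_norm_deriv_le (fun x _ => hw x) hD hc hz

lemma exists_norm_dslope_le {w : ℂ → ℂ} (hw : Differentiable ℂ w) {K : Set ℂ}
    (hK : IsCompact K) :
    ∃ M : ℝ, ∀ z ∈ K, ∀ c, w c = 0 → ‖dslope w c z‖ ≤ M := by
  obtain ⟨D, hD⟩ := (hK.cthickening (r := 1)).exists_bound_of_continuousOn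
    (hw.contDiff.continuous_deriv le_top : Continuous (deriv w)).continuousOn
  obtain ⟨E, hE⟩ := hK.exists_bound_of_continuousOn hw.continuous.continuousOn
  refine ⟨max D E, fun z hz c hc => ?_⟩
  rcases le_or_gt 1 ‖z - c‖ with hfar | hnear
  · have hzc : z ≠ c := by
      rintro rfl
      norm_num at hfar
    rw [dslope_of_ne _ hzc, slope_def_field, hc, sub_zero, norm_div]
    exact (div_le_self (norm_nonneg _) hfar).trans ((hE z hz).trans (le_max_right _ _))
  · refine (norm_dslope_le_of_norm_deriv_le hw (convex_ball z 1) (fun x hx => hD x ?_)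
      (by rwa [mem_ball_iff_norm']) (Metric.mem_ball_self one_pos)).trans (le_max_left _ _)
    exact Metric.mem_cthickening_of_dist_le x z 1 K hz (Metric.mem_ball.1 hx).le

-- `(p - c) dslope w c z = (p - z) dslope w c z + w z` when `w c = 0`.
lemma exists_norm_dslope_mul_le {w : ℂ → ℂ} (hw : Differentiable ℂ w) {K : Set ℂ}
    (hK : IsCompact K) (p : ℂ) :
    ∃ M : ℝ, ∀ z ∈ K, ∀ c, w c = 0 → ‖dslope w c z‖ * ‖p - c‖ ≤ M := by
  obtain ⟨D, hD⟩ := exists_norm_dslope_le hw hK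
  obtain ⟨E, hE⟩ := hK.exists_bound_of_continuousOn hw.continuous.continuousOn
  obtain ⟨R, hR⟩ := hK.exists_bound_of_continuousOn
    (f := fun z => p - z) (by fun_prop)
  refine ⟨D * R + E, fun z hz c hc => ?_⟩
  have hdslope := sub_smul_dslope_of_zero hc z
  calc ‖dslope w c z‖ * ‖p - c‖ = ‖dslope w c z * (p - z) + w z‖ := by
        rw [← norm_mul, ← hdslope, smul_eq_mul]
        ring_nf
    _ ≤ ‖dslope w c z‖ * ‖p - z‖ + ‖w z‖ := (norm_add_le _ _).trans_eq (by rw [norm_mul])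
    _ ≤ D * R + E := by
        gcongr
        · exact (norm_nonneg _).trans (hD z hz c hc)
        · exact hD z hz c hc
        · exact hR z hz
        · exact hE z hz

lemma samplingFun_eq_dslope {w : ℂ → ℂ} {c : ℂ} (hc : w c = 0) (hd : deriv w c ≠ 0) (z : ℂ) :
    samplingFun w c z = dslope w c z / deriv w c := by
  rw [samplingFun]
  split_ifs with h
  · rw [h, dslope_same, div_self hd]
  · rw [dslope_of_ne _ h, slope_def_field, hc, sub_zero, div_div]

lemma samplingFun_const_mul {f : ℂ → ℂ} {κ : ℂ} (hκ : κ ≠ 0) (c z : ℂ) :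
    samplingFun (fun z => κ * f z) c z = samplingFun f c z := by
  rw [samplingFun, samplingFun, deriv_const_mul_field]
  split_ifs
  · rfl
  · rw [mul_left_comm, mul_div_mul_left _ _ hκ]

lemma exists_sq_growth_bound {f : ℂ → ℂ} (hf : Differentiable ℂ f) {C σ : ℝ} {k : ℕ}
    (h : ∀ s : ℂ, 1 ≤ ‖s‖ → ‖f (s ^ 2)‖ ≤ C * ‖s‖ ^ k * Real.exp (σ * ‖s‖))
    (hσ : 0 ≤ σ) {η : ℝ} (hη : 0 < η) :
    ∃ C' : ℝ, 0 ≤ C' ∧ ∀ s : ℂ, ‖f (s ^ 2)‖ ≤ C' * Real.exp ((σ + η) * ‖s‖) := by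
  obtain ⟨M, hM⟩ := (isCompact_closedBall (0 : ℂ) 1).exists_bound_of_continuousOn
    (f := fun s => f (s ^ 2)) (hf.continuous.comp (continuous_pow 2)).continuousOn
  refine ⟨max (|C| * (k.factorial / η ^ k)) |M|, by positivity, fun s => ?_⟩
  rcases le_total 1 ‖s‖ with hs | hs
  · have hpow : ‖s‖ ^ k ≤ k.factorial / η ^ k * Real.exp (η * ‖s‖) := by
      have hexp := Real.pow_div_factorial_le_exp (x := η * ‖s‖) (by positivity) k
      rw [div_le_iff₀ (by positivity), mul_pow] at hexp
      rw [div_mul_eq_mul_div, le_div_iff₀ (by positivity)]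
      linarith
    calc ‖f (s ^ 2)‖ ≤ |C| * ‖s‖ ^ k * Real.exp (σ * ‖s‖) := by
          refine (h s hs).trans ?_
          gcongr
          exact le_abs_self C
      _ ≤ |C| * (k.factorial / η ^ k * Real.exp (η * ‖s‖)) * Real.exp (σ * ‖s‖) := by gcongr
      _ = |C| * (k.factorial / η ^ k) * Real.exp ((σ + η) * ‖s‖) := by
        rw [add_mul, Real.exp_add]
        ring
      _ ≤ _ := by gcongr; exact le_max_left _ _
  · calc ‖f (s ^ 2)‖ ≤ |M| := (hM s (by simpa using hs)).trans (le_abs_self M)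
      _ ≤ max (|C| * (k.factorial / η ^ k)) |M| := le_max_right _ _
      _ ≤ _ := le_mul_of_one_le_right (by positivity) (Real.one_le_exp (by positivity))

lemma entireOfExpType_of_sq_growth {f : ℂ → ℂ} (hf : Differentiable ℂ f) {C σ : ℝ} (hσ : 0 ≤ σ)
    {k : ℕ} (h : ∀ s : ℂ, 1 ≤ ‖s‖ → ‖f (s ^ 2)‖ ≤ C * ‖s‖ ^ k * Real.exp (σ * ‖s‖)) :
    EntireOfExpType σ f ∧ EntireOfExpType σ fun s => f (s ^ 2) := by
  refine ⟨⟨hf, fun η hη => ?_⟩, hf.comp (differentiable_pow 2), fun η hη => ?_⟩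
  · obtain ⟨C', hC'0, hC'⟩ := exists_sq_growth_bound hf h hσ hη
    refine ⟨C' * Real.exp (σ + η), fun z => ?_⟩
    obtain ⟨s, rfl⟩ := IsAlgClosed.exists_pow_nat_eq z (n := 2) (by norm_num)
    have hs : ‖s‖ ≤ 1 + ‖s ^ 2‖ := by
      rw [norm_pow]
      nlinarith [sq_nonneg (‖s‖ - 1), norm_nonneg s]
    calc ‖f (s ^ 2)‖ ≤ C' * Real.exp ((σ + η) * ‖s‖) := hC' s
      _ ≤ C' * Real.exp ((σ + η) * (1 + ‖s ^ 2‖)) := by gcongr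
      _ = C' * Real.exp (σ + η) * Real.exp ((σ + η) * ‖s ^ 2‖) := by
        rw [mul_assoc, ← Real.exp_add]
        ring_nf
  · obtain ⟨C', -, hC'⟩ := exists_sq_growth_bound hf h hσ hη
    exact ⟨C', hC'⟩

lemma EntireOfExpType.const_mul {σ : ℝ} {f : ℂ → ℂ} (hf : EntireOfExpType σ f) (k : ℂ) :
    EntireOfExpType σ fun z => k * f z := by
  refine ⟨hf.1.const_mul k, fun η hη => ?_⟩
  obtain ⟨C, hC⟩ := hf.2 η hη
  refine ⟨‖k‖ * C, fun z => ?_⟩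
  rw [norm_mul, mul_assoc]
  exact mul_le_mul_of_nonneg_left (hC z) (norm_nonneg k)

end Entire

section Logarithm

variable {h : ℂ → ℂ} {R : ℝ}

lemma exists_log_of_ne_zero (hR : 0 < R) (hd : DifferentiableOn ℂ h (Metric.ball 0 R))
    (h0 : ∀ z ∈ Metric.ball (0 : ℂ) R, h z ≠ 0) :
    ∃ g : ℂ → ℂ, DifferentiableOn ℂ g (Metric.ball 0 R) ∧ g 0 = 0 ∧
      ∀ z ∈ Metric.ball (0 : ℂ) R, h z = h 0 * Complex.exp (g z) := by
  obtain ⟨g, hg0, hg⟩ :=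
    ((hd.deriv Metric.isOpen_ball).div hd h0).isExactOn_ball.with_val_at 0 0
  refine ⟨g, fun x hx => (hg x hx).differentiableAt.differentiableWithinAt, hg0, fun z hz => ?_⟩
  have hder : ∀ x ∈ Metric.ball (0 : ℂ) R,
      HasDerivAt (fun x => h x * Complex.exp (-g x)) 0 x := fun x hx => by
    have hh := (hd.differentiableAt (Metric.isOpen_ball.mem_nhds hx)).hasDerivAt
    refine (hh.mul (hg x hx).neg.cexp).congr_deriv ?_
    have := h0 x hx
    simp only [Pi.neg_apply, Pi.div_apply]
    field_simp
    ring
  have hconst : h z * Complex.exp (-g z) = h 0 := by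
    simpa [hg0] using Metric.isOpen_ball.is_const_of_deriv_eq_zero
      (convex_ball (0 : ℂ) R).isPreconnected
      (fun x hx => (hder x hx).differentiableAt.differentiableWithinAt)
      (fun x hx => (hder x hx).deriv) hz (Metric.mem_ball_self hR)
  rw [← hconst, mul_assoc, ← Complex.exp_add, neg_add_cancel, Complex.exp_zero, mul_one]

-- Borel–Carathéodory, applied to the logarithm of `h`.
lemma exists_eq_mul_exp_of_ne_zero {M : ℝ} (hd : DifferentiableOn ℂ h (Metric.ball 0 R))
    (h0 : ∀ z ∈ Metric.ball (0 : ℂ) R, h z ≠ 0) (hM : 0 < M)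
    (hb : ∀ z ∈ Metric.ball (0 : ℂ) R, ‖h z‖ ≤ ‖h 0‖ * Real.exp M)
    {z : ℂ} (hz : z ∈ Metric.ball (0 : ℂ) R) :
    ∃ g : ℂ, h z = h 0 * Complex.exp g ∧ ‖g‖ ≤ 2 * M * ‖z‖ / (R - ‖z‖) := by
  have hR : 0 < R := Metric.pos_of_mem_ball hz
  obtain ⟨g, hg, hg0, heq⟩ := exists_log_of_ne_zero hR hd h0
  refine ⟨g z, heq z hz, Complex.borelCaratheodory_zero hM hg (fun w hw => ?_) hR hz hg0⟩
  have hw' := hb w hw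
  rw [heq w hw, norm_mul, Complex.norm_exp] at hw'
  exact Real.exp_le_exp.1 (le_of_mul_le_mul_left hw'
    (norm_pos_iff.2 (h0 0 (Metric.mem_ball_self hR))))

lemma tendsto_of_zero_free_of_norm_le_exp {h : ℕ → ℂ → ℂ} {R M : ℕ → ℝ} {κ : ℂ}
    (hR : Tendsto R atTop atTop) (hMR : Tendsto (fun n => M n / R n) atTop (𝓝 0))
    (hM : ∀ᶠ n in atTop, 0 < M n) (hκ : ∀ᶠ n in atTop, h n 0 = κ)
    (hd : ∀ n, DifferentiableOn ℂ (h n) (Metric.ball 0 (R n)))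
    (h0 : ∀ n, ∀ z ∈ Metric.ball (0 : ℂ) (R n), h n z ≠ 0)
    (hb : ∀ᶠ n in atTop, ∀ z ∈ Metric.ball (0 : ℂ) (R n), ‖h n z‖ ≤ ‖κ‖ * Real.exp (M n))
    (z : ℂ) : Tendsto (fun n => h n z) atTop (𝓝 κ) := by
  have hlog : ∀ᶠ n in atTop, ∃ g : ℂ, h n z = κ * Complex.exp g ∧
      ‖g‖ ≤ 2 * M n * ‖z‖ / (R n - ‖z‖) := by
    filter_upwards [hM, hκ, hb, hR.eventually (eventually_gt_atTop ‖z‖)] with n hMn hκn hbn hzn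
    rw [← hκn] at hbn ⊢
    exact exists_eq_mul_exp_of_ne_zero (hd n) (h0 n) hMn hbn (mem_ball_zero_iff.2 hzn)
  have hbound : Tendsto (fun n => 2 * M n * ‖z‖ / (R n - ‖z‖)) atTop (𝓝 0) := by
    have hlim := ((hMR.const_mul 2).mul_const ‖z‖).div
      (tendsto_const_nhds.sub (hR.const_div_atTop ‖z‖) : Tendsto _ _ (𝓝 ((1 : ℝ) - 0)))
      (by norm_num)
    rw [mul_zero, zero_mul, zero_div] at hlim
    refine hlim.congr' ?_
    filter_upwards [hR.eventually (eventually_gt_atTop 0)] with n hRn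
    rw [Pi.div_apply]
    field_simp
  choose! g hg using fun n (hn : ∃ g : ℂ, h n z = κ * Complex.exp g ∧
    ‖g‖ ≤ 2 * M n * ‖z‖ / (R n - ‖z‖)) => hn
  have hg0 : Tendsto g atTop (𝓝 0) :=
    squeeze_zero_norm' (hlog.mono fun n hn => (hg n hn).2) hbound
  have hexp := ((Complex.continuous_exp.tendsto 0).comp hg0).const_mul κ
  rw [Complex.exp_zero, mul_one] at hexp
  exact hexp.congr' (hlog.mono fun n hn => (hg n hn).1.symm)

end Logarithm

section CanonicalProduct

variable {f : ℂ → ℂ} {lam : ℕ → ℝ}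

lemma canonicalFactor_mul_ite (z : ℂ) (n : ℕ) : canonicalFactor lam z n *
    (if lam n = 0 then 1 else -(lam n : ℂ)) = z - lam n := by
  rw [canonicalFactor]
  split_ifs with h
  · simp [h]
  · have : (lam n : ℂ) ≠ 0 := by exact_mod_cast h
    field_simp
    ring

lemma canonicalFactor_eq_zero_iff {z : ℂ} {n : ℕ} : canonicalFactor lam z n = 0 ↔ z = lam n := by
  have hscale : (if lam n = 0 then 1 else -(lam n : ℂ)) ≠ 0 := by
    split_ifs with h0
    · exact one_ne_zero
    · exact neg_ne_zero.2 (by exact_mod_cast h0)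
  rw [← sub_eq_zero (a := z), ← canonicalFactor_mul_ite, mul_eq_zero, or_iff_left hscale]

lemma one_le_norm_canonicalFactor {z : ℂ} {n : ℕ} (h1 : 1 ≤ ‖z‖) (h2 : 2 * |lam n| ≤ ‖z‖) :
    1 ≤ ‖canonicalFactor lam z n‖ := by
  rw [canonicalFactor]
  split_ifs with h
  · exact h1
  · have hquot : 2 ≤ ‖z / (lam n : ℂ)‖ := by
      rw [norm_div, Complex.norm_real, Real.norm_eq_abs, le_div_iff₀ (abs_pos.2 h)]
      exact h2
    have htri := norm_sub_norm_le (z / (lam n : ℂ)) 1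
    rw [norm_one, norm_sub_rev] at htri
    linarith

lemma differentiable_prod_canonicalFactor (n : ℕ) :
    Differentiable ℂ fun z => ∏ i ∈ Finset.range n, canonicalFactor lam z i := by
  refine Differentiable.fun_finsetProd fun i _ => ?_
  unfold canonicalFactor
  split_ifs <;> fun_prop

/-- The quotient of `f` by the first `n` factors of the canonical product with zeros `lam`, as an
iterated divided difference. -/
def canonicalQuotient (f : ℂ → ℂ) (lam : ℕ → ℝ) : ℕ → ℂ → ℂ
  | 0 => f
  | n + 1 => fun z => (if lam n = 0 then 1 else -(lam n : ℂ)) *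
      dslope (canonicalQuotient f lam n) (lam n) z

lemma differentiable_canonicalQuotient (hf : Differentiable ℂ f) (n : ℕ) :
    Differentiable ℂ (canonicalQuotient f lam n) := by
  induction n with
  | zero => exact hf
  | succ n ih => exact (differentiable_dslope ih _).const_mul _

lemma prod_canonicalFactor_apply_ne_zero (hinj : Function.Injective lam) (n : ℕ) :
    ∏ i ∈ Finset.range n, canonicalFactor lam (lam n) i ≠ 0 := by
  refine Finset.prod_ne_zero_iff.2 fun i hi => ?_
  rw [Ne, canonicalFactor_eq_zero_iff]
  exact fun h => (Finset.mem_range.1 hi).ne' (hinj (by exact_mod_cast h))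

lemma eq_prod_mul_canonicalQuotient (hinj : Function.Injective lam) (hz : ∀ n, f (lam n) = 0)
    (n : ℕ) (z : ℂ) :
    f z = (∏ i ∈ Finset.range n, canonicalFactor lam z i) * canonicalQuotient f lam n z := by
  induction n generalizing z with
  | zero => simp [canonicalQuotient]
  | succ n ih =>
    have hzero : canonicalQuotient f lam n (lam n) = 0 :=
      (mul_eq_zero.1 ((ih (lam n)).symm.trans (hz n))).resolve_left
        (prod_canonicalFactor_apply_ne_zero hinj n)
    have hdslope := sub_smul_dslope_of_zero hzero z
    rw [smul_eq_mul] at hdslope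
    rw [ih z, Finset.prod_range_succ, ← hdslope, canonicalQuotient, ← canonicalFactor_mul_ite]
    ring

lemma canonicalQuotient_apply_self (hinj : Function.Injective lam) (hz : ∀ n, f (lam n) = 0)
    (n : ℕ) : canonicalQuotient f lam n (lam n) = 0 :=
  (mul_eq_zero.1 ((eq_prod_mul_canonicalQuotient hinj hz n _).symm.trans (hz n))).resolve_left
    (prod_canonicalFactor_apply_ne_zero hinj n)

lemma canonicalQuotient_apply_zero_eq (hmono : StrictMono lam) (hz : ∀ n, f (lam n) = 0) {N n : ℕ}
    (hN : 0 < lam N) (hn : N ≤ n) : canonicalQuotient f lam n 0 = canonicalQuotient f lam N 0 := by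
  induction n, hn using Nat.le_induction with
  | base => rfl
  | succ n hn ih =>
    have hdslope := sub_smul_dslope_of_zero (canonicalQuotient_apply_self hmono.injective hz n) 0
    rw [zero_sub, smul_eq_mul, ih] at hdslope
    rw [← hdslope, canonicalQuotient, if_neg (hN.trans_le (hmono.monotone hn)).ne']

lemma canonicalQuotient_ne_zero (hf : Differentiable ℂ f) (hmono : StrictMono lam)
    (hz : ∀ z, f z = 0 ↔ ∃ n, z = (lam n : ℂ)) (hd : ∀ n, deriv f (lam n : ℂ) ≠ 0) {n : ℕ} {z : ℂ}
    (hzn : ‖z‖ < lam n) : canonicalQuotient f lam n z ≠ 0 := by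
  have heq := eq_prod_mul_canonicalQuotient hmono.injective (fun n => (hz _).2 ⟨n, rfl⟩) n
  intro hq
  obtain ⟨m, rfl⟩ := (hz z).1 (by rw [heq z, hq, mul_zero])
  rw [Complex.norm_real] at hzn
  have hmn : m < n := hmono.lt_iff_lt.1 ((le_abs_self _).trans_lt hzn)
  have hprod : (∏ i ∈ Finset.range n, canonicalFactor lam (lam m : ℂ) i) = 0 :=
    Finset.prod_eq_zero (Finset.mem_range.2 hmn) (canonicalFactor_eq_zero_iff.2 rfl)
  apply hd m
  rw [funext heq, deriv_fun_mul (differentiable_prod_canonicalFactor n _)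
    (differentiable_canonicalQuotient hf n _), hprod, hq, mul_zero, zero_mul, add_zero]

-- By the maximum principle on the ball of radius `2 lam n`: on its boundary every factor that has
-- been divided out has modulus at least `1`.
lemma norm_canonicalQuotient_le (hf : Differentiable ℂ f) (hmono : StrictMono lam)
    (hz : ∀ n, f (lam n) = 0) {C c : ℝ} (hg : ∀ s : ℂ, ‖f (s ^ 2)‖ ≤ C * Real.exp (c * ‖s‖))
    {n : ℕ} (h1 : 1 ≤ lam n) (h0 : |lam 0| ≤ lam n) {z : ℂ} (hzn : ‖z‖ < lam n) :
    ‖canonicalQuotient f lam n z‖ ≤ C * Real.exp (c * √(2 * lam n)) := by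
  refine Complex.norm_le_of_forall_mem_frontier_norm_le (U := Metric.ball 0 (2 * lam n))
    Metric.isBounded_ball (differentiable_canonicalQuotient hf n).diffContOnCl (fun w hw => ?_)
    (subset_closure (by rw [mem_ball_zero_iff]; linarith))
  rw [frontier_ball _ (by linarith), mem_sphere_zero_iff_norm] at hw
  obtain ⟨s, rfl⟩ := IsAlgClosed.exists_pow_nat_eq w (n := 2) (by norm_num)
  have hs : ‖s‖ = √(2 * lam n) := by
    rw [← hw, norm_pow, Real.sqrt_sq (norm_nonneg _)]
  have hprod : 1 ≤ ‖∏ i ∈ Finset.range n, canonicalFactor lam (s ^ 2) i‖ := by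
    rw [norm_prod]
    refine Finset.one_le_prod fun i hi => one_le_norm_canonicalFactor (by linarith) ?_
    have hin : lam i ≤ lam n := hmono.monotone (Finset.mem_range.1 hi).le
    have h0i : lam 0 ≤ lam i := hmono.monotone (Nat.zero_le i)
    have hi : |lam i| ≤ lam n := abs_le.2 ⟨by linarith [neg_abs_le (lam 0)], hin⟩
    rw [hw]
    linarith
  have hgrowth := hg s
  rw [eq_prod_mul_canonicalQuotient hmono.injective hz n, norm_mul, hs] at hgrowth
  exact (le_mul_of_one_le_left (norm_nonneg _) hprod).trans hgrowth

lemma tendsto_prod_canonicalFactor (hf : Differentiable ℂ f) (hmono : StrictMono lam)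
    (htop : Tendsto lam atTop atTop) (hz : ∀ z, f z = 0 ↔ ∃ n, z = (lam n : ℂ))
    (hd : ∀ n, deriv f (lam n : ℂ) ≠ 0)
    {C c : ℝ} (hg : ∀ s : ℂ, ‖f (s ^ 2)‖ ≤ C * Real.exp (c * ‖s‖)) :
    ∃ κ : ℂ, κ ≠ 0 ∧ ∀ z, Tendsto (fun n => ∏ i ∈ Finset.range n, canonicalFactor lam z i) atTop
      (𝓝 (f z / κ)) := by
  have hz' : ∀ n, f (lam n) = 0 := fun n => (hz _).2 ⟨n, rfl⟩
  have hlarge := (htop.eventually_ge_atTop 1).and (htop.eventually_ge_atTop |lam 0|)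
  obtain ⟨N, hN, -⟩ := hlarge.exists
  set κ := canonicalQuotient f lam N 0
  have hκ : κ ≠ 0 := canonicalQuotient_ne_zero hf hmono hz hd (by rw [norm_zero]; linarith)
  obtain ⟨D, hD0, hD⟩ : ∃ D, 0 < D ∧ |C| ≤ ‖κ‖ * Real.exp D := by
    have hlim : Tendsto (fun D => ‖κ‖ * Real.exp D) atTop atTop :=
      Real.tendsto_exp_atTop.const_mul_atTop (norm_pos_iff.2 hκ)
    exact ((eventually_gt_atTop 0).and (hlim.eventually_ge_atTop |C|)).exists
  have hbound : ∀ᶠ n in atTop, ∀ w ∈ Metric.ball (0 : ℂ) (lam n),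
      ‖canonicalQuotient f lam n w‖ ≤ ‖κ‖ * Real.exp (D + |c| * √2 * √(lam n)) := by
    filter_upwards [hlarge] with n hn w hw
    calc ‖canonicalQuotient f lam n w‖ ≤ C * Real.exp (c * √(2 * lam n)) :=
          norm_canonicalQuotient_le hf hmono hz' hg hn.1 hn.2 (mem_ball_zero_iff.1 hw)
      _ ≤ |C| * Real.exp (|c| * √(2 * lam n)) := by
          gcongr
          · exact le_abs_self C
          · exact le_abs_self c
      _ ≤ ‖κ‖ * Real.exp D * Real.exp (|c| * √(2 * lam n)) := by gcongr
      _ = ‖κ‖ * Real.exp (D + |c| * √2 * √(lam n)) := by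
          rw [mul_assoc, ← Real.exp_add, Real.sqrt_mul (by norm_num), mul_assoc]
  have hquot : ∀ z, Tendsto (fun n => canonicalQuotient f lam n z) atTop (𝓝 κ) :=
    tendsto_of_zero_free_of_norm_le_exp htop ((tendsto_add_mul_sqrt_div_atTop _ _).comp htop)
      (.of_forall fun n => by positivity)
      ((eventually_ge_atTop N).mono fun n =>
        canonicalQuotient_apply_zero_eq hmono hz' (by linarith))
      (fun n => (differentiable_canonicalQuotient hf n).differentiableOn)
      (fun n w hw => canonicalQuotient_ne_zero hf hmono hz hd (mem_ball_zero_iff.1 hw)) hbound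
  refine ⟨κ, hκ, fun z => (tendsto_const_nhds.div (hquot z) hκ).congr' ?_⟩
  filter_upwards [(hquot z).eventually_ne hκ] with n hn
  rw [Pi.div_apply, div_eq_iff hn]
  exact eq_prod_mul_canonicalQuotient hmono.injective hz' n z

lemma one_add_sum_le_prod_one_add {ι : Type*} {a : ι → ℝ} (ha : ∀ i, 0 ≤ a i) (s : Finset ι) :
    1 + ∑ i ∈ s, a i ≤ ∏ i ∈ s, (1 + a i) := by
  classical
  induction s using Finset.induction_on with
  | empty => simp
  | insert i s hi ih =>
    have hprod : 1 ≤ ∏ j ∈ s, (1 + a j) := Finset.one_le_prod fun j _ => by linarith [ha j]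
    rw [Finset.sum_insert hi, Finset.prod_insert hi]
    nlinarith [ha i]

-- Evaluating the partial products at a negative point `-t` bounds `∏ (1 + t / lam n)`.
lemma summable_inv_of_bddAbove_prod_canonicalFactor {t : ℝ} (ht : 0 < t)
    (hne : ∀ n, lam n ≠ -t) (hpos : ∀ᶠ n in atTop, 0 < lam n)
    (hbdd : BddAbove (Set.range fun n =>
      ‖∏ i ∈ Finset.range n, canonicalFactor lam (-(t : ℂ)) i‖)) :
    Summable fun n => (lam n)⁻¹ := by
  obtain ⟨K, hK⟩ := hbdd
  obtain ⟨N, hN⟩ := eventually_atTop.1 hpos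
  have hterm : ∀ n, 0 ≤ t * (lam (N + n))⁻¹ := fun n => by
    have := hN (N + n) (by omega)
    positivity
  have hfactor : ∀ n, ‖canonicalFactor lam (-(t : ℂ)) (N + n)‖ = 1 + t * (lam (N + n))⁻¹ :=
    fun n => by
      have hn := hN (N + n) (by omega)
      rw [canonicalFactor, if_neg hn.ne', ← Complex.ofReal_neg, ← Complex.ofReal_div,
        ← Complex.ofReal_one, ← Complex.ofReal_sub, Complex.norm_real, neg_div, sub_neg_eq_add,
        div_eq_mul_inv, Real.norm_of_nonneg (by linarith [hterm n])]
  set p := ‖∏ i ∈ Finset.range N, canonicalFactor lam (-(t : ℂ)) i‖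
  have hp : 0 < p := norm_pos_iff.2 (Finset.prod_ne_zero_iff.2 fun i _ => by
    rw [Ne, canonicalFactor_eq_zero_iff]
    exact fun h => hne i (by exact_mod_cast h.symm))
  have hsum : Summable fun n => t * (lam (N + n))⁻¹ := by
    refine summable_of_sum_range_le (c := K / p) hterm fun n => ?_
    have hprod : ‖∏ i ∈ Finset.range (N + n), canonicalFactor lam (-(t : ℂ)) i‖ ≤ K :=
      hK ⟨N + n, rfl⟩
    rw [Finset.prod_range_add, norm_mul, norm_prod (Finset.range n), mul_comm, ← le_div_iff₀ hp,
      Finset.prod_congr rfl fun i _ => hfactor i] at hprod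
    have := one_add_sum_le_prod_one_add hterm (Finset.range n)
    linarith
  rw [← summable_nat_add_iff N]
  simpa only [add_comm N] using (summable_mul_left_iff ht.ne').1 hsum

lemma multipliable_canonicalFactor (hpos : ∀ᶠ n in atTop, 0 < lam n)
    (hsum : Summable fun n => (lam n)⁻¹) (z : ℂ) : Multipliable (canonicalFactor lam z) := by
  have hfactor : Summable fun n => ‖canonicalFactor lam z n - 1‖ := by
    refine (summable_congr_atTop ?_).1 (hsum.mul_left ‖z‖)
    filter_upwards [hpos] with n hn
    rw [canonicalFactor, if_neg hn.ne', sub_sub_cancel_left, norm_neg, norm_div,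
      Complex.norm_real, Real.norm_of_nonneg hn.le, div_eq_mul_inv]
  simpa only [add_sub_cancel] using multipliable_one_add_of_summable hfactor

theorem exists_eq_mul_canonicalProduct (hf : Differentiable ℂ f) (hmono : StrictMono lam)
    (htop : Tendsto lam atTop atTop) (hz : ∀ z, f z = 0 ↔ ∃ n, z = (lam n : ℂ))
    (hd : ∀ n, deriv f (lam n : ℂ) ≠ 0)
    {C c : ℝ} (hg : ∀ s : ℂ, ‖f (s ^ 2)‖ ≤ C * Real.exp (c * ‖s‖)) :
    (∀ z, Multipliable (canonicalFactor lam z)) ∧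
      ∃ κ : ℂ, κ ≠ 0 ∧ ∀ z, f z = κ * canonicalProduct lam z := by
  obtain ⟨κ, hκ, hlim⟩ := tendsto_prod_canonicalFactor hf hmono htop hz hd hg
  have hne : ∀ n, lam n ≠ -(|lam 0| + 1) := fun n => by
    linarith [hmono.monotone (Nat.zero_le n), neg_abs_le (lam 0)] |> ne_of_gt
  have hsum := summable_inv_of_bddAbove_prod_canonicalFactor (by positivity) hne
    (htop.eventually_gt_atTop 0) (hlim _).norm.bddAbove_range
  have hmul := multipliable_canonicalFactor (htop.eventually_gt_atTop 0) hsum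
  refine ⟨hmul, κ, hκ, fun z => ?_⟩
  rw [canonicalProduct, tendsto_nhds_unique (hmul z).hasProd.tendsto_prod_nat (hlim z),
    mul_div_cancel₀ _ hκ]

end CanonicalProduct

/-- A real potential `Q` on `[a, b]`: a bounded measurable function, continuous off the countable
set `S`. The function is defined on all of `ℝ`, so that the bound and the measurability are global
statements. -/
structure Potential where
  (a b bound : ℝ)
  Q : ℝ → ℝ
  S : Set ℝ
  a_lt_b : a < b
  measurable : Measurable Q
  abs_le : ∀ x, |Q x| ≤ bound
  countable : S.Countable
  continuousWithinAt : ∀ x ∈ Set.Icc a b \ S, ContinuousWithinAt Q (Set.Icc a b) x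

namespace Potential

variable (p : Potential)

lemma a_le_b : p.a ≤ p.b := p.a_lt_b.le

lemma left_mem : p.a ∈ Set.Icc p.a p.b := Set.left_mem_Icc.2 p.a_le_b

lemma right_mem : p.b ∈ Set.Icc p.a p.b := Set.right_mem_Icc.2 p.a_le_b

lemma bound_nonneg : 0 ≤ p.bound := (abs_nonneg _).trans (p.abs_le 0)

/-- `u`, with derivative `u'`, is a Carathéodory solution of `-u'' + Q u = z u` on `[a, b]`: both
functions are continuous, and the equation holds off the exceptional set. -/
structure IsSol (z : ℂ) (u u' : ℝ → ℂ) : Prop where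
  cont : ContinuousOn u (Set.Icc p.a p.b)
  cont' : ContinuousOn u' (Set.Icc p.a p.b)
  deriv : ∀ x ∈ Set.Icc p.a p.b \ p.S, HasDerivWithinAt u (u' x) (Set.Icc p.a p.b) x
  deriv' : ∀ x ∈ Set.Icc p.a p.b \ p.S,
    HasDerivWithinAt u' (((p.Q x : ℂ) - z) * u x) (Set.Icc p.a p.b) x

variable {p} {z ζ : ℂ} {u u' v v' : ℝ → ℂ} {c d x : ℝ}

lemma intervalIntegrable_of_continuousOn {E : Type*} [NormedAddCommGroup E] {f : ℝ → E}
    (hf : ContinuousOn f (Set.Icc p.a p.b)) (hc : c ∈ Set.Icc p.a p.b)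
    (hd : d ∈ Set.Icc p.a p.b) : IntervalIntegrable f volume c d :=
  (hf.mono (Set.uIcc_subset_Icc hc hd)).intervalIntegrable

lemma integral_eq_sub {E : Type*} [NormedAddCommGroup E] [NormedSpace ℝ E] [CompleteSpace E]
    {f f' : ℝ → E} (hc : c ∈ Set.Icc p.a p.b) (hd : d ∈ Set.Icc p.a p.b)
    (hf : ContinuousOn f (Set.Icc p.a p.b))
    (hf' : ∀ x ∈ Set.Icc p.a p.b \ p.S, HasDerivWithinAt f (f' x) (Set.Icc p.a p.b) x)
    (hi : IntervalIntegrable f' volume c d) : ∫ x in c..d, f' x = f d - f c := by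
  refine integral_eq_of_hasDerivAt_off_countable f f' p.countable
    (hf.mono (Set.uIcc_subset_Icc hc hd)) (fun x hx => ?_) hi
  have hax : p.a < x := (le_min hc.1 hd.1).trans_lt hx.1.1
  have hxb : x < p.b := hx.1.2.trans_le (max_le hc.2 hd.2)
  exact (hf' x ⟨⟨hax.le, hxb.le⟩, hx.2⟩).hasDerivAt (Icc_mem_nhds hax hxb)

lemma measurable_coeff (z : ℂ) : Measurable fun x => ((p.Q x : ℂ) - z) :=
  (Complex.measurable_ofReal.comp p.measurable).sub_const z

lemma norm_coeff_le (z : ℂ) (x : ℝ) : ‖(p.Q x : ℂ) - z‖ ≤ p.bound + ‖z‖ := by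
  refine (norm_sub_le _ _).trans ?_
  rw [Complex.norm_real]
  exact add_le_add_left (p.abs_le x) _

section IsSol

lemma IsSol.intervalIntegrable (h : p.IsSol z u u') (hc : c ∈ Set.Icc p.a p.b)
    (hd : d ∈ Set.Icc p.a p.b) :
    IntervalIntegrable (fun x => ((p.Q x : ℂ) - z) * u x) volume c d :=
  intervalIntegrable_bdd_mul (measurable_coeff z) (norm_coeff_le z)
    (intervalIntegrable_of_continuousOn h.cont hc hd)

lemma IsSol.integral_deriv (h : p.IsSol z u u') (hx : x ∈ Set.Icc p.a p.b) :
    ∫ t in p.a..x, u' t = u x - u p.a :=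
  integral_eq_sub p.left_mem hx h.cont h.deriv
    (intervalIntegrable_of_continuousOn h.cont' p.left_mem hx)

lemma IsSol.integral_deriv' (h : p.IsSol z u u') (hx : x ∈ Set.Icc p.a p.b) :
    ∫ t in p.a..x, ((p.Q t : ℂ) - z) * u t = u' x - u' p.a :=
  integral_eq_sub p.left_mem hx h.cont' h.deriv' (h.intervalIntegrable p.left_mem hx)

lemma IsSol.const_mul (h : p.IsSol z u u') (c : ℂ) :
    p.IsSol z (fun x => c * u x) (fun x => c * u' x) where
  cont := continuousOn_const.mul h.cont
  cont' := continuousOn_const.mul h.cont'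
  deriv x hx := (h.deriv x hx).const_mul c
  deriv' x hx := by
    rw [mul_left_comm]
    exact (h.deriv' x hx).const_mul c

lemma IsSol.conj (h : p.IsSol z u u') :
    p.IsSol (starRingEnd ℂ z) (fun x => starRingEnd ℂ (u x)) (fun x => starRingEnd ℂ (u' x)) where
  cont := Complex.continuous_conj.comp_continuousOn h.cont
  cont' := Complex.continuous_conj.comp_continuousOn h.cont'
  deriv x hx := (h.deriv x hx).star
  deriv' x hx := by
    have hstar : star (((p.Q x : ℂ) - z) * u x) =
        ((p.Q x : ℂ) - starRingEnd ℂ z) * starRingEnd ℂ (u x) := by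
      rw [← starRingEnd_apply, map_mul, map_sub, Complex.conj_ofReal]
    exact hstar ▸ (h.deriv' x hx).star

lemma IsSol.lagrange (hu : p.IsSol z u u') (hv : p.IsSol ζ v v')
    (hc : c ∈ Set.Icc p.a p.b) (hd : d ∈ Set.Icc p.a p.b) :
    (z - ζ) * ∫ x in c..d, u x * v x =
      (u d * v' d - u' d * v d) - (u c * v' c - u' c * v c) := by
  rw [← intervalIntegral.integral_const_mul]
  refine integral_eq_sub (f := fun x => u x * v' x - u' x * v x) hc hd
    ((hu.cont.mul hv.cont').sub (hu.cont'.mul hv.cont)) (fun x hx => ?_)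
    (intervalIntegrable_of_continuousOn (continuousOn_const.mul (hu.cont.mul hv.cont)) hc hd)
  refine (((hu.deriv x hx).mul (hv.deriv' x hx)).sub
    ((hu.deriv' x hx).mul (hv.deriv x hx))).congr_deriv ?_
  ring

lemma IsSol.wronskian_eq (hu : p.IsSol z u u') (hv : p.IsSol z v v')
    (hx : x ∈ Set.Icc p.a p.b) :
    u x * v' x - u' x * v x = u p.a * v' p.a - u' p.a * v p.a := by
  have h := hu.lagrange hv p.left_mem hx
  rw [sub_self, zero_mul] at h
  exact sub_eq_zero.1 h.symm

lemma IsSol.energy (hu : p.IsSol z u u') (hc : c ∈ Set.Icc p.a p.b)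
    (hd : d ∈ Set.Icc p.a p.b) :
    ((∫ x in c..d, ‖u' x‖ ^ 2 : ℝ) : ℂ) + ((∫ x in c..d, p.Q x * ‖u x‖ ^ 2 : ℝ) : ℂ) -
      z * ((∫ x in c..d, ‖u x‖ ^ 2 : ℝ) : ℂ) =
      u' d * starRingEnd ℂ (u d) - u' c * starRingEnd ℂ (u c) := by
  have hcont : ContinuousOn (fun x => ((‖u x‖ ^ 2 : ℝ) : ℂ)) (Set.Icc p.a p.b) :=
    Complex.continuous_ofReal.comp_continuousOn (hu.cont.norm.pow 2)
  have hkin : IntervalIntegrable (fun x => ((‖u' x‖ ^ 2 : ℝ) : ℂ)) volume c d :=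
    intervalIntegrable_of_continuousOn
      (Complex.continuous_ofReal.comp_continuousOn (hu.cont'.norm.pow 2)) hc hd
  have hpot : IntervalIntegrable (fun x => ((p.Q x * ‖u x‖ ^ 2 : ℝ) : ℂ)) volume c d := by
    simp_rw [Complex.ofReal_mul]
    exact intervalIntegrable_bdd_mul (Complex.measurable_ofReal.comp p.measurable)
      (fun x => (Complex.norm_real _).le.trans (p.abs_le x))
      (intervalIntegrable_of_continuousOn hcont hc hd)
  have hmass : IntervalIntegrable (fun x => z * ((‖u x‖ ^ 2 : ℝ) : ℂ)) volume c d :=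
    intervalIntegrable_of_continuousOn (continuousOn_const.mul hcont) hc hd
  rw [← intervalIntegral.integral_ofReal, ← intervalIntegral.integral_ofReal,
    ← intervalIntegral.integral_ofReal, ← intervalIntegral.integral_const_mul,
    ← intervalIntegral.integral_add hkin hpot,
    ← intervalIntegral.integral_sub (hkin.add hpot) hmass]
  refine integral_eq_sub (f := fun x => u' x * starRingEnd ℂ (u x)) hc hd
    (hu.cont'.mul hu.conj.cont) (fun x hx => ?_) ((hkin.add hpot).sub hmass)
  refine ((hu.deriv' x hx).mul (hu.conj.deriv x hx)).congr_deriv ?_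
  rw [Complex.ofReal_mul, ofReal_norm_sq_eq_mul_conj, ofReal_norm_sq_eq_mul_conj]
  ring

lemma IsSol.norm_le_add_integral (h : p.IsSol z u u') (hx : x ∈ Set.Icc p.a p.b) :
    ‖u x‖ ≤ ‖u p.a‖ + ∫ t in p.a..x, ‖u' t‖ := by
  rw [← add_sub_cancel (u p.a) (u x), ← h.integral_deriv hx]
  exact (norm_add_le _ _).trans
    (add_le_add_right (intervalIntegral.norm_integral_le_integral_norm hx.1) _)

lemma IsSol.norm_le_add_integral' (h : p.IsSol z u u') (hx : x ∈ Set.Icc p.a p.b) :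
    ‖u' x‖ ≤ ‖u' p.a‖ + (p.bound + ‖z‖) * ∫ t in p.a..x, ‖u t‖ := by
  rw [← add_sub_cancel (u' p.a) (u' x), ← h.integral_deriv' hx,
    ← intervalIntegral.integral_const_mul]
  refine (norm_add_le _ _).trans (add_le_add_right
    (intervalIntegral.norm_integral_le_of_norm_le hx.1 (.of_forall fun t _ => ?_)
      ((intervalIntegrable_of_continuousOn h.cont p.left_mem hx).norm.const_mul _)) _)
  rw [norm_mul]
  exact mul_le_mul_of_nonneg_right (norm_coeff_le z t) (norm_nonneg _)

-- In terms of a square root `s` of the spectral parameter, `‖s‖ ‖u‖ + ‖u'‖` satisfies a Gronwall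
-- inequality whose rate is `‖s‖ + O(1)`.
lemma IsSol.norm_add_norm_le_mul_exp {s : ℂ} (hs : s ≠ 0) (h : p.IsSol (s ^ 2) u u')
    (hx : x ∈ Set.Icc p.a p.b) :
    ‖s‖ * ‖u x‖ + ‖u' x‖ ≤ (‖s‖ * ‖u p.a‖ + ‖u' p.a‖) *
      Real.exp ((‖s‖ + p.bound / ‖s‖) * (x - p.a)) := by
  have hs0 : 0 < ‖s‖ := norm_pos_iff.2 hs
  have hdiv : 0 ≤ p.bound / ‖s‖ := div_nonneg p.bound_nonneg hs0.le
  refine le_mul_exp_of_le_add_integral (f := fun x => ‖s‖ * ‖u x‖ + ‖u' x‖)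
    (add_nonneg hs0.le hdiv)
    ((continuousOn_const.mul h.cont.norm).add h.cont'.norm) (fun y hy => ?_) hx
  rw [intervalIntegral.integral_add
    ((intervalIntegrable_of_continuousOn h.cont.norm p.left_mem hy).const_mul _)
    (intervalIntegrable_of_continuousOn h.cont'.norm p.left_mem hy),
    intervalIntegral.integral_const_mul]
  have hI : 0 ≤ ∫ t in p.a..y, ‖u' t‖ :=
    intervalIntegral.integral_nonneg hy.1 fun _ _ => norm_nonneg _
  calc ‖s‖ * ‖u y‖ + ‖u' y‖
      ≤ ‖s‖ * (‖u p.a‖ + ∫ t in p.a..y, ‖u' t‖) +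
        (‖u' p.a‖ + (p.bound + ‖s ^ 2‖) * ∫ t in p.a..y, ‖u t‖) := by
        gcongr
        exacts [h.norm_le_add_integral hy, h.norm_le_add_integral' hy]
    _ ≤ ‖s‖ * ‖u p.a‖ + ‖u' p.a‖ + (‖s‖ * (∫ t in p.a..y, ‖u' t‖) +
        (p.bound + ‖s ^ 2‖) * (∫ t in p.a..y, ‖u t‖) +
        p.bound / ‖s‖ * ∫ t in p.a..y, ‖u' t‖) := by
        linarith [mul_nonneg hdiv hI]
    _ = ‖s‖ * ‖u p.a‖ + ‖u' p.a‖ + (‖s‖ + p.bound / ‖s‖) *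
        (‖s‖ * (∫ t in p.a..y, ‖u t‖) + ∫ t in p.a..y, ‖u' t‖) := by
        rw [norm_pow]
        field_simp
        ring

lemma IsSol.norm_le {s : ℂ} (hs : 1 ≤ ‖s‖) (h : p.IsSol (s ^ 2) u u')
    (hx : x ∈ Set.Icc p.a p.b) {N : ℝ} (hN : ‖s‖ * ‖u p.a‖ + ‖u' p.a‖ ≤ N) :
    ‖u x‖ ≤ N * Real.exp ((‖s‖ + p.bound) * (x - p.a)) ∧
      ‖u' x‖ ≤ N * Real.exp ((‖s‖ + p.bound) * (x - p.a)) := by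
  have hs0 : 0 < ‖s‖ := one_pos.trans_le hs
  have hxa : 0 ≤ x - p.a := sub_nonneg.2 hx.1
  have hN0 : 0 ≤ N := le_trans (by positivity) hN
  have hsum : ‖s‖ * ‖u x‖ + ‖u' x‖ ≤ N * Real.exp ((‖s‖ + p.bound) * (x - p.a)) := by
    refine (h.norm_add_norm_le_mul_exp (norm_pos_iff.1 hs0) hx).trans ?_
    gcongr
    exact div_le_self p.bound_nonneg hs
  have hu : ‖u x‖ ≤ ‖s‖ * ‖u x‖ := le_mul_of_one_le_left (norm_nonneg _) hs
  constructor <;> linarith [norm_nonneg (u' x), norm_nonneg (u x)]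

end IsSol

section InitialValueProblem

/-- The nilpotent matrix `(u, v) ↦ (v, 0)`. -/
def shiftUp : ℂ × ℂ →L[ℂ] ℂ × ℂ :=
  (ContinuousLinearMap.inl ℂ ℂ ℂ).comp (ContinuousLinearMap.snd ℂ ℂ ℂ)

/-- The nilpotent matrix `(u, v) ↦ (0, u)`, the coefficient of `Q - z` in the first order system. -/
def shiftDown : ℂ × ℂ →L[ℂ] ℂ × ℂ :=
  (ContinuousLinearMap.inr ℂ ℂ ℂ).comp (ContinuousLinearMap.fst ℂ ℂ ℂ)

lemma norm_shiftUp_le : ‖shiftUp‖ ≤ 1 :=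
  ContinuousLinearMap.opNorm_le_bound _ zero_le_one fun v => by simp [shiftUp, Prod.norm_def]

lemma norm_shiftDown_le : ‖shiftDown‖ ≤ 1 :=
  ContinuousLinearMap.opNorm_le_bound _ zero_le_one fun v => by simp [shiftDown, Prod.norm_def]

variable (p) in
/-- The matrix of the first order system `(u, u')' = (u', (Q - z) u)` equivalent to
`-u'' + Q u = z u`. -/
def sys (z : ℂ) (t : ℝ) : ℂ × ℂ →L[ℂ] ℂ × ℂ := shiftUp + ((p.Q t : ℂ) - z) • shiftDown

lemma sys_apply (z : ℂ) (t : ℝ) (v : ℂ × ℂ) :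
    p.sys z t v = (v.2, ((p.Q t : ℂ) - z) * v.1) := by
  ext <;> simp [sys, shiftUp, shiftDown]

lemma stronglyMeasurable_sys (z : ℂ) : StronglyMeasurable (p.sys z) :=
  stronglyMeasurable_const.add ((measurable_coeff z).stronglyMeasurable.smul_const _)

lemma norm_sys_le (z : ℂ) (t : ℝ) : ‖p.sys z t‖ ≤ 1 + (p.bound + ‖z‖) := by
  refine (norm_add_le _ _).trans (add_le_add norm_shiftUp_le ?_)
  rw [norm_smul]
  exact (mul_le_of_le_one_right (norm_nonneg _) norm_shiftDown_le).trans (norm_coeff_le z t)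

variable (p) in
/-- The Volterra operator of the first order system. -/
def sysVolterra (z : ℂ) :
    C(Set.Icc p.a p.b, ℂ × ℂ) →L[ℂ] C(Set.Icc p.a p.b, ℂ × ℂ) :=
  volterra p.a_le_b (stronglyMeasurable_sys (p := p) z) (norm_sys_le z)

variable (p) in
/-- Minus the linear coefficient of `sysVolterra`, as an affine function of `z`. -/
def shiftVolterra : C(Set.Icc p.a p.b, ℂ × ℂ) →L[ℂ] C(Set.Icc p.a p.b, ℂ × ℂ) :=
  volterra p.a_le_b (A := fun _ => shiftDown) stronglyMeasurable_const fun _ => norm_shiftDown_le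

lemma sysVolterra_eq_sub_smul (z : ℂ) :
    p.sysVolterra z = p.sysVolterra 0 - z • p.shiftVolterra := by
  ext f x : 2
  have hf := f.continuous.Icc_extend' (h := p.a_le_b)
  simp only [sysVolterra, shiftVolterra, sub_apply, smul_apply, ContinuousMap.sub_apply,
    ContinuousMap.smul_apply, volterra_apply]
  rw [← intervalIntegral.integral_smul, ← intervalIntegral.integral_sub
    (intervalIntegrable_clm_apply (stronglyMeasurable_sys 0) (norm_sys_le 0) hf _ _)
    (Continuous.intervalIntegrable (by fun_prop) _ _)]
  refine intervalIntegral.integral_congr fun t _ => ?_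
  simp only [sys, sub_zero, sub_smul, add_apply, smul_apply]
  abel

lemma isUnit_one_sub_sysVolterra (z : ℂ) : IsUnit (1 - p.sysVolterra z) :=
  isUnit_one_sub_volterra p.a_le_b (stronglyMeasurable_sys z) (norm_sys_le z)

variable (p) in
/-- The solution with initial values `(u(a), u'(a)) = v`, as a continuous function on `[a, b]`. -/
def solMap (z : ℂ) (v : ℂ × ℂ) : C(Set.Icc p.a p.b, ℂ × ℂ) :=
  Ring.inverse (1 - p.sysVolterra z) (ContinuousMap.const _ v)

lemma differentiable_solMap {v : ℂ → ℂ × ℂ} (hv : Differentiable ℂ v) :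
    Differentiable ℂ fun z => p.solMap z (v z) := by
  have hconst : Differentiable ℂ fun z => ContinuousMap.const (Set.Icc p.a p.b) (v z) :=
    (ContinuousLinearMap.const ℂ (Set.Icc p.a p.b) :
      ℂ × ℂ →L[ℂ] C(Set.Icc p.a p.b, ℂ × ℂ)).differentiable.comp hv
  exact differentiable_ringInverse_one_sub_apply sysVolterra_eq_sub_smul isUnit_one_sub_sysVolterra
    hconst

lemma solMap_eq_iff {v : ℂ × ℂ} {f : C(Set.Icc p.a p.b, ℂ × ℂ)} :
    p.solMap z v = f ↔ ∀ x : Set.Icc p.a p.b,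
      f x = v + ∫ t in p.a..(x : ℝ), p.sys z t (Set.IccExtend p.a_le_b f t) := by
  have hunit := isUnit_one_sub_sysVolterra (p := p) z
  have hsolve : p.solMap z v = f ↔ (1 - p.sysVolterra z) f = ContinuousMap.const _ v := by
    refine ⟨fun h => ?_, fun h => ?_⟩
    · rw [← h, solMap, ← mul_apply_eq_comp, Ring.mul_inverse_cancel _ hunit, one_apply_eq_self]
    · rw [solMap, ← h, ← mul_apply_eq_comp, Ring.inverse_mul_cancel _ hunit, one_apply_eq_self]
  rw [hsolve, ContinuousMap.ext_iff]
  exact forall_congr' fun x => sub_eq_iff_eq_add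

variable (p) in
/-- The solution with initial values `(u(a), u'(a)) = v` and its derivative, extended from `[a, b]`
to `ℝ` by constants. -/
def sol (z : ℂ) (v : ℂ × ℂ) : ℝ → ℂ × ℂ := Set.IccExtend p.a_le_b (p.solMap z v)

lemma sol_of_mem (z : ℂ) (v : ℂ × ℂ) (hx : x ∈ Set.Icc p.a p.b) :
    p.sol z v x = p.solMap z v ⟨x, hx⟩ :=
  Set.IccExtend_of_mem _ _ hx

lemma continuous_sol (z : ℂ) (v : ℂ × ℂ) : Continuous (p.sol z v) :=
  (p.solMap z v).continuous.Icc_extend'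

lemma sol_eq_integral (z : ℂ) (v : ℂ × ℂ) (hx : x ∈ Set.Icc p.a p.b) :
    p.sol z v x = v + ∫ t in p.a..x, p.sys z t (p.sol z v t) :=
  (sol_of_mem z v hx).trans (solMap_eq_iff.1 rfl ⟨x, hx⟩)

lemma sol_left (z : ℂ) (v : ℂ × ℂ) : p.sol z v p.a = v := by
  rw [sol_eq_integral z v p.left_mem, intervalIntegral.integral_same, add_zero]

lemma differentiable_sol {v : ℂ → ℂ × ℂ} (hv : Differentiable ℂ v) (x : ℝ) :
    Differentiable ℂ fun z => p.sol z (v z) x :=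
  (ContinuousMap.evalCLM ℂ (Set.projIcc p.a p.b p.a_le_b x) :
    C(Set.Icc p.a p.b, ℂ × ℂ) →L[ℂ] ℂ × ℂ).differentiable.comp (differentiable_solMap hv)

lemma differentiable_integral_sol_mul {v : ℂ → ℂ × ℂ} (hv : Differentiable ℂ v) {h : ℝ → ℂ}
    (hh : IntervalIntegrable h volume c d) :
    Differentiable ℂ fun z => ∫ x in c..d, (p.sol z (v z) x).1 * h x :=
  differentiable_integral_clm_apply_mul (differentiable_solMap hv)
    (ContinuousLinearMap.fst ℂ ℂ ℂ) continuous_projIcc hh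

lemma hasDerivWithinAt_sol (z : ℂ) (v : ℂ × ℂ) (hx : x ∈ Set.Icc p.a p.b \ p.S) :
    HasDerivWithinAt (p.sol z v) ((p.sol z v x).2, ((p.Q x : ℂ) - z) * (p.sol z v x).1)
      (Set.Icc p.a p.b) x := by
  have : Fact (x ∈ Set.Icc p.a p.b) := ⟨hx.1⟩
  have hsol := continuous_sol (p := p) z v
  have hcont : ContinuousWithinAt (fun t => p.sys z t (p.sol z v t)) (Set.Icc p.a p.b) x := by
    simp_rw [sys_apply]
    exact hsol.continuousWithinAt.snd.prodMk
      (((Complex.continuous_ofReal.continuousAt.comp_continuousWithinAt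
        (p.continuousWithinAt x hx)).sub continuousWithinAt_const).mul hsol.continuousWithinAt.fst)
  rw [← sys_apply]
  exact ((intervalIntegral.integral_hasDerivWithinAt_right
    (intervalIntegrable_clm_apply (stronglyMeasurable_sys z) (norm_sys_le z) hsol _ _)
    (aestronglyMeasurable_clm_apply (stronglyMeasurable_sys z) hsol).stronglyMeasurableAtFilter
    hcont).const_add v).congr (fun y hy => sol_eq_integral z v hy) (sol_eq_integral z v hx.1)

lemma isSol_sol (z : ℂ) (v : ℂ × ℂ) :
    p.IsSol z (fun x => (p.sol z v x).1) (fun x => (p.sol z v x).2) where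
  cont := (continuous_sol z v).fst.continuousOn
  cont' := (continuous_sol z v).snd.continuousOn
  deriv _ hx := (hasDerivWithinAt_sol z v hx).fst
  deriv' _ hx := (hasDerivWithinAt_sol z v hx).snd

lemma IsSol.integral_sys (h : p.IsSol z u u') (hx : x ∈ Set.Icc p.a p.b) :
    ∫ t in p.a..x, p.sys z t (u t, u' t) = (u x, u' x) - (u p.a, u' p.a) := by
  simp_rw [sys_apply]
  refine integral_eq_sub (f := fun t => (u t, u' t)) p.left_mem hx (h.cont.prodMk h.cont')
    (fun t ht => (h.deriv t ht).prodMk (h.deriv' t ht)) ?_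
  exact intervalIntegrable_iff.2 ((intervalIntegrable_iff.1
    (intervalIntegrable_of_continuousOn h.cont' p.left_mem hx)).prodMk
    (intervalIntegrable_iff.1 (h.intervalIntegrable p.left_mem hx)))

lemma IsSol.eq_sol (h : p.IsSol z u u') (hx : x ∈ Set.Icc p.a p.b) :
    p.sol z (u p.a, u' p.a) x = (u x, u' x) := by
  set f : C(Set.Icc p.a p.b, ℂ × ℂ) :=
    ⟨fun y => (u y, u' y), h.cont.domRestrict.prodMk h.cont'.domRestrict⟩
  suffices hsol : p.solMap z (u p.a, u' p.a) = f by rw [sol_of_mem _ _ hx, hsol]; rfl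
  refine solMap_eq_iff.2 fun y => ?_
  have hcongr : ∫ t in p.a..(y : ℝ), p.sys z t (Set.IccExtend p.a_le_b f t) =
      ∫ t in p.a..(y : ℝ), p.sys z t (u t, u' t) := by
    refine intervalIntegral.integral_congr fun t ht => ?_
    rw [Set.uIcc_of_le y.2.1] at ht
    simp only [Set.IccExtend_of_mem p.a_le_b _ ⟨ht.1, ht.2.trans y.2.2⟩]
    rfl
  rw [hcongr, h.integral_sys y.2, add_sub_cancel]
  rfl

lemma IsSol.eq_of_left_eq (hu : p.IsSol z u u') (hv : p.IsSol z v v')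
    (h : u p.a = v p.a) (h' : u' p.a = v' p.a) (hx : x ∈ Set.Icc p.a p.b) :
    u x = v x ∧ u' x = v' x := by
  rw [← Prod.mk.injEq, ← hu.eq_sol hx, ← hv.eq_sol hx, h, h']

end InitialValueProblem

section Reflect

variable (p) in
/-- The potential reflected about the midpoint of `[a, b]`; it turns initial values at `b` into
initial values at `a`. -/
def reflect : Potential where
  a := p.a
  b := p.b
  bound := p.bound
  Q x := p.Q (p.a + p.b - x)
  S := (fun x => p.a + p.b - x) ⁻¹' p.S
  a_lt_b := p.a_lt_b
  measurable := p.measurable.comp (measurable_const.sub measurable_id)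
  abs_le x := p.abs_le _
  countable := p.countable.preimage_of_injOn (sub_right_injective.injOn)
  continuousWithinAt x hx :=
    ContinuousWithinAt.comp (f := fun x => p.a + p.b - x)
      (p.continuousWithinAt (p.a + p.b - x)
        ⟨⟨by linarith [hx.1.2], by linarith [hx.1.1]⟩, hx.2⟩)
      (by fun_prop) (fun y hy => ⟨by linarith [hy.2], by linarith [hy.1]⟩)

lemma reflect_reflect : p.reflect.reflect = p := by
  cases p
  simp [reflect, Set.preimage]

lemma mapsTo_reflect :
    Set.MapsTo (fun x => p.a + p.b - x) (Set.Icc p.a p.b) (Set.Icc p.a p.b) :=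
  fun _ hy => ⟨by linarith [hy.2], by linarith [hy.1]⟩

lemma IsSol.of_reflect (h : p.reflect.IsSol z u u') :
    p.IsSol z (fun x => u (p.a + p.b - x)) (fun x => -u' (p.a + p.b - x)) := by
  have hd : ∀ x, HasDerivWithinAt (fun x => p.a + p.b - x) (-1) (Set.Icc p.a p.b) x := fun x =>
    ((hasDerivAt_id x).const_sub (p.a + p.b)).hasDerivWithinAt
  have hmem : ∀ x ∈ Set.Icc p.a p.b \ p.S,
      p.a + p.b - x ∈ Set.Icc p.reflect.a p.reflect.b \ p.reflect.S := fun x hx =>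
    ⟨mapsTo_reflect hx.1, by simpa [Potential.reflect] using hx.2⟩
  refine ⟨h.cont.comp (by fun_prop) mapsTo_reflect,
    (h.cont'.comp (by fun_prop) mapsTo_reflect).neg, fun x hx => ?_, fun x hx => ?_⟩
  · have hu := HasDerivWithinAt.scomp x (h.deriv _ (hmem x hx)) (hd x) mapsTo_reflect
    rwa [neg_one_smul] at hu
  · have hu' := (HasDerivWithinAt.scomp x (h.deriv' _ (hmem x hx)) (hd x) mapsTo_reflect).neg
    have hQ : p.reflect.Q (p.a + p.b - x) = p.Q x := congrArg p.Q (sub_sub_self _ _)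
    rwa [neg_one_smul, neg_neg, hQ] at hu'

lemma IsSol.reflect (h : p.IsSol z u u') :
    p.reflect.IsSol z (fun x => u (p.a + p.b - x)) (fun x => -u' (p.a + p.b - x)) :=
  IsSol.of_reflect (p := p.reflect) (by rwa [reflect_reflect])

lemma IsSol.eq_of_right_eq (hu : p.IsSol z u u') (hv : p.IsSol z v v')
    (h : u p.b = v p.b) (h' : u' p.b = v' p.b) (hx : x ∈ Set.Icc p.a p.b) :
    u x = v x ∧ u' x = v' x := by
  have hrefl := hu.reflect.eq_of_left_eq hv.reflect (x := p.a + p.b - x)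
    (by simpa [Potential.reflect] using h) (by simpa [Potential.reflect] using h')
    (mapsTo_reflect hx)
  simpa only [sub_sub_self, neg_inj] using hrefl

lemma IsSol.norm_le_of_right {s : ℂ} (hs : 1 ≤ ‖s‖) (h : p.IsSol (s ^ 2) u u')
    (hx : x ∈ Set.Icc p.a p.b) {N : ℝ} (hN : ‖s‖ * ‖u p.b‖ + ‖u' p.b‖ ≤ N) :
    ‖u x‖ ≤ N * Real.exp ((‖s‖ + p.bound) * (p.b - x)) ∧
      ‖u' x‖ ≤ N * Real.exp ((‖s‖ + p.bound) * (p.b - x)) := by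
  have hrefl := h.reflect.norm_le hs (mapsTo_reflect hx)
    (by simpa [Potential.reflect] using hN)
  have hsub : p.a + p.b - x - p.a = p.b - x := by ring
  simpa only [Potential.reflect, sub_sub_self, norm_neg, hsub] using hrefl

variable (p) in
/-- The solution with `(u(b), u'(b)) = v` and its derivative. -/
def solRight (z : ℂ) (v : ℂ × ℂ) (x : ℝ) : ℂ × ℂ :=
  ((p.reflect.sol z (v.1, -v.2) (p.a + p.b - x)).1,
    -(p.reflect.sol z (v.1, -v.2) (p.a + p.b - x)).2)

lemma isSol_solRight (z : ℂ) (v : ℂ × ℂ) :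
    p.IsSol z (fun x => (p.solRight z v x).1) (fun x => (p.solRight z v x).2) :=
  (isSol_sol z _).of_reflect

lemma continuous_solRight (z : ℂ) (v : ℂ × ℂ) : Continuous (p.solRight z v) := by
  have hsol : Continuous fun x => p.reflect.sol z (v.1, -v.2) (p.a + p.b - x) :=
    (continuous_sol z _).comp (by fun_prop)
  exact hsol.fst.prodMk hsol.snd.neg

lemma solRight_right (z : ℂ) (v : ℂ × ℂ) : p.solRight z v p.b = v := by
  have hleft : p.reflect.sol z (v.1, -v.2) (p.a + p.b - p.b) = (v.1, -v.2) := by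
    rw [add_sub_cancel_right]
    exact sol_left (p := p.reflect) z _
  rw [solRight, hleft, neg_neg]

lemma differentiable_solRight {v : ℂ → ℂ × ℂ} (hv : Differentiable ℂ v) (x : ℝ) :
    Differentiable ℂ fun z => p.solRight z (v z) x :=
  have hsol := differentiable_sol (p := p.reflect) (hv.fst.prodMk hv.snd.neg) (p.a + p.b - x)
  hsol.fst.prodMk hsol.snd.neg

lemma differentiable_integral_solRight_mul {v : ℂ → ℂ × ℂ} (hv : Differentiable ℂ v)
    {h : ℝ → ℂ} (hh : IntervalIntegrable h volume c d) :
    Differentiable ℂ fun z => ∫ x in c..d, (p.solRight z (v z) x).1 * h x :=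
  differentiable_integral_clm_apply_mul
    (differentiable_solMap (p := p.reflect) (hv.fst.prodMk hv.snd.neg))
    (ContinuousLinearMap.fst ℂ ℂ ℂ)
    (continuous_projIcc.comp (continuous_const.sub continuous_id)) hh

end Reflect

end Potential

/-- A Sturm-Liouville problem on `[a, b]` without transmission conditions, with the spectral
parameter in the boundary condition at `b`. -/
structure RegularSL extends Potential where
  (β₁ β₂ α₁ α₂ α₁' α₂' : ℝ)
  β_ne : ¬(β₁ = 0 ∧ β₂ = 0)
  ρ_pos : 0 < α₁' * α₂ - α₁ * α₂'

namespace RegularSL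

variable (R : RegularSL)

/-- The determinant of the boundary condition at `b`. -/
def ρ : ℝ := R.α₁' * R.α₂ - R.α₁ * R.α₂'

lemma rho_pos : 0 < R.ρ := R.ρ_pos

/-- The solution that satisfies the boundary condition at `a`. -/
def psi (z : ℂ) (x : ℝ) : ℂ := (R.sol z (R.β₂, -R.β₁) x).1

/-- The derivative of `psi`. -/
def psi' (z : ℂ) (x : ℝ) : ℂ := (R.sol z (R.β₂, -R.β₁) x).2

/-- The solution that satisfies the boundary condition at `b`. -/
def chi (z : ℂ) (x : ℝ) : ℂ := (R.solRight z (z * R.α₂' + R.α₂, z * R.α₁' + R.α₁) x).1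

/-- The derivative of `chi`. -/
def chi' (z : ℂ) (x : ℝ) : ℂ := (R.solRight z (z * R.α₂' + R.α₂, z * R.α₁' + R.α₁) x).2

/-- The Wronskian of `psi` and `chi`, whose zeros are the eigenvalues. -/
def wronskian (z : ℂ) : ℂ := R.psi z R.a * R.chi' z R.a - R.psi' z R.a * R.chi z R.a

variable {R} {z k A B s : ℂ} {x y : ℝ}

lemma isSol_psi (z : ℂ) : R.IsSol z (R.psi z) (R.psi' z) := Potential.isSol_sol z _

lemma isSol_chi (z : ℂ) : R.IsSol z (R.chi z) (R.chi' z) := Potential.isSol_solRight z _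

lemma psi_left (z : ℂ) : R.psi z R.a = R.β₂ := by rw [psi, Potential.sol_left]

lemma psi'_left (z : ℂ) : R.psi' z R.a = -R.β₁ := by rw [psi', Potential.sol_left]

lemma chi_right (z : ℂ) : R.chi z R.b = z * R.α₂' + R.α₂ := by rw [chi, Potential.solRight_right]

lemma chi'_right (z : ℂ) : R.chi' z R.b = z * R.α₁' + R.α₁ := by
  rw [chi', Potential.solRight_right]

lemma continuous_psi (z : ℂ) : Continuous (R.psi z) := (Potential.continuous_sol z _).fst

lemma continuous_psi' (z : ℂ) : Continuous (R.psi' z) := (Potential.continuous_sol z _).snd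

lemma continuous_chi (z : ℂ) : Continuous (R.chi z) := (Potential.continuous_solRight z _).fst

lemma continuous_chi' (z : ℂ) : Continuous (R.chi' z) := (Potential.continuous_solRight z _).snd

lemma differentiable_psi (x : ℝ) : Differentiable ℂ fun z => R.psi z x :=
  (Potential.differentiable_sol (differentiable_const _) x).fst

lemma differentiable_psi' (x : ℝ) : Differentiable ℂ fun z => R.psi' z x :=
  (Potential.differentiable_sol (differentiable_const _) x).snd

lemma differentiable_chi (x : ℝ) : Differentiable ℂ fun z => R.chi z x :=
  (Potential.differentiable_solRight (by fun_prop) x).fst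

lemma differentiable_chi' (x : ℝ) : Differentiable ℂ fun z => R.chi' z x :=
  (Potential.differentiable_solRight (by fun_prop) x).snd

lemma differentiable_wronskian : Differentiable ℂ R.wronskian :=
  ((differentiable_psi _).mul (differentiable_chi' _)).sub
    ((differentiable_psi' _).mul (differentiable_chi _))

lemma psi_mul_chi'_sub_psi'_mul_chi (z : ℂ) (hx : x ∈ Set.Icc R.a R.b) :
    R.psi z x * R.chi' z x - R.psi' z x * R.chi z x = R.wronskian z :=
  (isSol_psi z).wronskian_eq (isSol_chi z) hx

lemma wronskian_eq_right (z : ℂ) : R.wronskian z =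
    R.psi z R.b * (z * R.α₁' + R.α₁) - R.psi' z R.b * (z * R.α₂' + R.α₂) := by
  rw [← psi_mul_chi'_sub_psi'_mul_chi z R.right_mem, chi_right, chi'_right]

lemma chi_right_ne_zero (z : ℂ) : ¬(R.chi z R.b = 0 ∧ R.chi' z R.b = 0) := by
  rw [chi_right, chi'_right]
  rintro ⟨hchi, hchi'⟩
  have hdet : ((R.α₁' * R.α₂ - R.α₁ * R.α₂' : ℝ) : ℂ) = 0 := by
    push_cast
    linear_combination (R.α₁' : ℂ) * hchi - (R.α₂' : ℂ) * hchi'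
  exact R.ρ_pos.ne' (Complex.ofReal_eq_zero.1 hdet)

variable (R) in
/-- `k` is the factor of proportionality `ψ / χ`, so that `z` is an eigenvalue if `k ≠ 0`. -/
def IsRatio (z k : ℂ) : Prop :=
  ∀ x ∈ Set.Icc R.a R.b, R.psi z x = k * R.chi z x ∧ R.psi' z x = k * R.chi' z x

lemma exists_isRatio (hz : R.wronskian z = 0) : ∃ k : ℂ, k ≠ 0 ∧ R.IsRatio z k := by
  have hpsi : ¬(R.psi z R.a = 0 ∧ R.psi' z R.a = 0) := by
    rw [psi_left, psi'_left, neg_eq_zero, Complex.ofReal_eq_zero, Complex.ofReal_eq_zero]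
    exact fun h => R.β_ne h.symm
  obtain ⟨m, hm, hm'⟩ := exists_eq_mul_of_mul_eq_mul hpsi (sub_eq_zero.1 hz)
  have hchi : ∀ x ∈ Set.Icc R.a R.b, R.chi z x = m * R.psi z x ∧ R.chi' z x = m * R.psi' z x :=
    fun x hx => (isSol_chi z).eq_of_left_eq ((isSol_psi z).const_mul m) hm hm' hx
  have hm0 : m ≠ 0 := by
    rintro rfl
    simpa only [zero_mul, chi_right_ne_zero] using hchi R.b R.right_mem
  refine ⟨m⁻¹, inv_ne_zero hm0, fun x hx => ?_⟩
  rw [(hchi x hx).1, (hchi x hx).2, inv_mul_cancel_left₀ hm0, inv_mul_cancel_left₀ hm0]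
  exact ⟨rfl, rfl⟩

section Glue

variable (R)

/-- The function `A ψ` on `[a, y]` and `B χ` on `[y, b]`. Both eigenfunctions and Green's function
have this form. -/
def glue (z : ℂ) (y : ℝ) (A B : ℂ) (x : ℝ) : ℂ := if x ≤ y then A * R.psi z x else B * R.chi z x

/-- The derivative of `glue` away from `y`. -/
def glue' (z : ℂ) (y : ℝ) (A B : ℂ) (x : ℝ) : ℂ :=
  if x ≤ y then A * R.psi' z x else B * R.chi' z x

/-- `glue z y A B` is continuous at `y`, and its derivative jumps by `s` there. -/
structure IsGlued (z : ℂ) (y : ℝ) (A B s : ℂ) : Prop where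
  mem : y ∈ Set.Icc R.a R.b
  eq : A * R.psi z y = B * R.chi z y
  jump : B * R.chi' z y - A * R.psi' z y = s

/-- The squared norm of `glue z y A B` in `L²(a, b) ⊕ ℂ`, the second component being weighted
with `ρ`. -/
def glueNormSq (z : ℂ) (y : ℝ) (A B : ℂ) : ℝ :=
  (∫ x in R.a..R.b, ‖R.glue z y A B x‖ ^ 2) + R.ρ * ‖B‖ ^ 2

/-- The Dirichlet integral of `glue z y A B`. -/
def glueDirichlet (z : ℂ) (y : ℝ) (A B : ℂ) : ℝ := ∫ x in R.a..R.b, ‖R.glue' z y A B x‖ ^ 2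

variable {R}

lemma IsRatio.isGlued (hk : R.IsRatio z k) (hy : y ∈ Set.Icc R.a R.b) : R.IsGlued z y 1 k 0 where
  mem := hy
  eq := by rw [one_mul, (hk y hy).1]
  jump := by rw [one_mul, (hk y hy).2, sub_self]

lemma isGlued_green (hz : R.wronskian z ≠ 0) (hy : y ∈ Set.Icc R.a R.b) :
    R.IsGlued z y (R.chi z y / R.wronskian z) (R.psi z y / R.wronskian z) 1 where
  mem := hy
  eq := by ring
  jump := by
    rw [div_mul_eq_mul_div, div_mul_eq_mul_div, ← sub_div, div_eq_one_iff_eq hz,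
      ← psi_mul_chi'_sub_psi'_mul_chi z hy]
    ring

lemma IsRatio.glue_eq_psi (hk : R.IsRatio z k) (y : ℝ) (hx : x ∈ Set.Icc R.a R.b) :
    R.glue z y 1 k x = R.psi z x := by
  rw [glue, ← (hk x hx).1, one_mul, ite_self]

lemma glue_const_mul (z : ℂ) (y : ℝ) (c A B : ℂ) (x : ℝ) :
    R.glue z y (c * A) (c * B) x = c * R.glue z y A B x := by
  simp only [glue, mul_assoc, mul_ite]

lemma IsGlued.continuous_glue (h : R.IsGlued z y A B s) : Continuous (R.glue z y A B) :=
  Continuous.if_le (continuous_const.mul (continuous_psi z))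
    (continuous_const.mul (continuous_chi z)) continuous_id continuous_const
    fun x hx => by rw [hx, h.eq]

lemma hasDerivAt_glue (hx : x ∈ Set.Ioo R.a R.b \ (R.S ∪ {y})) :
    HasDerivAt (R.glue z y A B) (R.glue' z y A B x) x := by
  have hxI : x ∈ Set.Icc R.a R.b \ R.S :=
    ⟨Set.Ioo_subset_Icc_self hx.1, fun h => hx.2 (Or.inl h)⟩
  have hnhds := Icc_mem_nhds hx.1.1 hx.1.2
  have hxy : x ≠ y := fun h => hx.2 (Or.inr h)
  rcases lt_or_gt_of_ne hxy with h | h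
  · rw [glue', if_pos h.le]
    refine (((isSol_psi z).deriv x hxI).hasDerivAt hnhds).const_mul A |>.congr_of_eventuallyEq ?_
    filter_upwards [gt_mem_nhds h] with t ht
    rw [glue, if_pos ht.le]
  · rw [glue', if_neg h.not_ge]
    refine (((isSol_chi z).deriv x hxI).hasDerivAt hnhds).const_mul B |>.congr_of_eventuallyEq ?_
    filter_upwards [lt_mem_nhds h] with t ht
    rw [glue, if_neg ht.not_ge]

lemma norm_sq_glue (x : ℝ) : ‖R.glue z y A B x‖ ^ 2 =
    if x ≤ y then ‖A * R.psi z x‖ ^ 2 else ‖B * R.chi z x‖ ^ 2 :=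
  apply_ite (fun w : ℂ => ‖w‖ ^ 2) _ _ _

lemma norm_sq_glue' (x : ℝ) : ‖R.glue' z y A B x‖ ^ 2 =
    if x ≤ y then ‖A * R.psi' z x‖ ^ 2 else ‖B * R.chi' z x‖ ^ 2 :=
  apply_ite (fun w : ℂ => ‖w‖ ^ 2) _ _ _

lemma intervalIntegrable_glue' (hy : y ∈ Set.Icc R.a R.b) :
    IntervalIntegrable (R.glue' z y A B) volume R.a R.b :=
  intervalIntegrable_ite_le hy
    ((continuous_const.mul (continuous_psi' z)).intervalIntegrable _ _)
    ((continuous_const.mul (continuous_chi' z)).intervalIntegrable _ _)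

lemma intervalIntegrable_norm_sq_glue' (hy : y ∈ Set.Icc R.a R.b) :
    IntervalIntegrable (fun x => ‖R.glue' z y A B x‖ ^ 2) volume R.a R.b := by
  simp_rw [norm_sq_glue']
  exact intervalIntegrable_ite_le hy
    (((continuous_const.mul (continuous_psi' z)).norm.pow 2).intervalIntegrable _ _)
    (((continuous_const.mul (continuous_chi' z)).norm.pow 2).intervalIntegrable _ _)

lemma integral_norm_sq_glue (hy : y ∈ Set.Icc R.a R.b) :
    ∫ x in R.a..R.b, ‖R.glue z y A B x‖ ^ 2 =
      (∫ x in R.a..y, ‖A * R.psi z x‖ ^ 2) + ∫ x in y..R.b, ‖B * R.chi z x‖ ^ 2 := by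
  simp_rw [norm_sq_glue]
  exact integral_ite_le_eq_add hy
    (((continuous_const.mul (continuous_psi z)).norm.pow 2).intervalIntegrable _ _)
    (((continuous_const.mul (continuous_chi z)).norm.pow 2).intervalIntegrable _ _)

lemma glueDirichlet_eq_add (hy : y ∈ Set.Icc R.a R.b) : R.glueDirichlet z y A B =
    (∫ x in R.a..y, ‖A * R.psi' z x‖ ^ 2) + ∫ x in y..R.b, ‖B * R.chi' z x‖ ^ 2 := by
  simp_rw [glueDirichlet, norm_sq_glue']
  exact integral_ite_le_eq_add hy
    (((continuous_const.mul (continuous_psi' z)).norm.pow 2).intervalIntegrable _ _)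
    (((continuous_const.mul (continuous_chi' z)).norm.pow 2).intervalIntegrable _ _)

lemma integral_Q_mul_norm_sq_glue (hy : y ∈ Set.Icc R.a R.b) :
    ∫ x in R.a..R.b, R.Q x * ‖R.glue z y A B x‖ ^ 2 =
      (∫ x in R.a..y, R.Q x * ‖A * R.psi z x‖ ^ 2) +
        ∫ x in y..R.b, R.Q x * ‖B * R.chi z x‖ ^ 2 := by
  simp_rw [norm_sq_glue, mul_ite]
  exact integral_ite_le_eq_add hy
    (intervalIntegrable_bdd_mul R.measurable R.abs_le
      (((continuous_const.mul (continuous_psi z)).norm.pow 2).intervalIntegrable _ _))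
    (intervalIntegrable_bdd_mul R.measurable R.abs_le
      (((continuous_const.mul (continuous_chi z)).norm.pow 2).intervalIntegrable _ _))

lemma integral_norm_sq_glue_nonneg : 0 ≤ ∫ x in R.a..R.b, ‖R.glue z y A B x‖ ^ 2 :=
  intervalIntegral.integral_nonneg R.a_le_b fun _ _ => sq_nonneg _

lemma rho_mul_norm_sq_le_glueNormSq : R.ρ * ‖B‖ ^ 2 ≤ R.glueNormSq z y A B :=
  le_add_of_nonneg_left integral_norm_sq_glue_nonneg

lemma integral_norm_sq_glue_le_glueNormSq :
    ∫ x in R.a..R.b, ‖R.glue z y A B x‖ ^ 2 ≤ R.glueNormSq z y A B :=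
  le_add_of_nonneg_right (mul_nonneg R.rho_pos.le (sq_nonneg _))

lemma glueNormSq_nonneg : 0 ≤ R.glueNormSq z y A B :=
  integral_norm_sq_glue_nonneg.trans integral_norm_sq_glue_le_glueNormSq

lemma glueNormSq_pos (hB : B ≠ 0) : 0 < R.glueNormSq z y A B :=
  (mul_pos R.rho_pos (pow_pos (norm_pos_iff.2 hB) 2)).trans_le rho_mul_norm_sq_le_glueNormSq

lemma glueDirichlet_nonneg : 0 ≤ R.glueDirichlet z y A B :=
  intervalIntegral.integral_nonneg R.a_le_b fun _ _ => sq_nonneg _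

lemma IsGlued.norm_sq_glue_le (h : R.IsGlued z y A B s) {τ : ℝ} (hτ : 0 < τ)
    (hx : x ∈ Set.Icc R.a R.b) : ‖R.glue z y A B x‖ ^ 2 ≤
      (1 / (R.b - R.a) + 1 / τ) * R.glueNormSq z y A B + τ * R.glueDirichlet z y A B := by
  have hba := sub_pos.2 R.a_lt_b
  refine (norm_sq_le_integral_add_integral_deriv R.a_lt_b
    (R.countable.union (Set.countable_singleton y)) h.continuous_glue.continuousOn
    (fun x hx => hasDerivAt_glue hx) (intervalIntegrable_glue' h.mem)
    (intervalIntegrable_norm_sq_glue' h.mem) hτ hx).trans ?_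
  gcongr
  · exact integral_norm_sq_glue_le_glueNormSq
  · rfl

lemma IsGlued.norm_sq_left_le (h : R.IsGlued z y A B s) {τ : ℝ} (hτ : 0 < τ) :
    ‖A * R.psi z R.a‖ ^ 2 ≤
      (1 / (R.b - R.a) + 1 / τ) * R.glueNormSq z y A B + τ * R.glueDirichlet z y A B := by
  have hleft : R.glue z y A B R.a = A * R.psi z R.a := if_pos h.mem.1
  exact hleft ▸ h.norm_sq_glue_le hτ R.left_mem

lemma IsGlued.norm_sq_right_le (h : R.IsGlued z y A B s) {τ : ℝ} (hτ : 0 < τ) :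
    ‖B * R.chi z R.b‖ ^ 2 ≤
      (1 / (R.b - R.a) + 1 / τ) * R.glueNormSq z y A B + τ * R.glueDirichlet z y A B := by
  have hright : R.glue z y A B R.b = B * R.chi z R.b := by
    rcases h.mem.2.eq_or_lt with rfl | hlt
    · rw [glue, if_pos le_rfl, h.eq]
    · exact if_neg hlt.not_ge
  exact hright ▸ h.norm_sq_glue_le hτ R.right_mem

end Glue

section Energy

variable (R) in
/-- The real part, up to the multiple `ρ z` of `z`, of the boundary term at `b` in the energy
identity. -/
def boundaryForm (z : ℂ) : ℝ :=
  2 * z.re * (R.α₁ * R.α₂') + ‖z‖ ^ 2 * (R.α₁' * R.α₂') + R.α₁ * R.α₂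

lemma chi'_mul_conj_chi_right (z : ℂ) :
    R.chi' z R.b * starRingEnd ℂ (R.chi z R.b) = z * R.ρ + R.boundaryForm z := by
  have hre : ((2 * z.re : ℝ) : ℂ) = z + starRingEnd ℂ z := (Complex.add_conj z).symm
  rw [chi_right, chi'_right, boundaryForm, ρ, Complex.ofReal_add, Complex.ofReal_add,
    Complex.ofReal_mul, Complex.ofReal_mul (‖z‖ ^ 2), hre, ofReal_norm_sq_eq_mul_conj]
  simp only [Complex.ofReal_mul, Complex.ofReal_sub, map_add, map_mul, Complex.conj_ofReal]
  ring

lemma psi'_mul_conj_psi_left (z : ℂ) : R.psi' z R.a * starRingEnd ℂ (R.psi z R.a) =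
    -((R.β₁ / R.β₂ * ‖R.psi z R.a‖ ^ 2 : ℝ) : ℂ) := by
  have hβ : R.β₁ / R.β₂ * R.β₂ ^ 2 = R.β₁ * R.β₂ := by
    rcases eq_or_ne R.β₂ 0 with h | h
    · simp only [h, div_zero, mul_zero, ne_eq, OfNat.ofNat_ne_zero, not_false_eq_true, zero_pow]
    · field_simp
  rw [psi_left, psi'_left, Complex.norm_real, Real.norm_eq_abs, sq_abs, hβ, Complex.conj_ofReal]
  push_cast
  ring

lemma boundaryForm_eq (h : R.α₂' ≠ 0) (z : ℂ) : R.boundaryForm z =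
    R.α₁' / R.α₂' * ‖R.chi z R.b‖ ^ 2 - 2 * (R.ρ / R.α₂') * (R.chi z R.b).re +
      R.ρ / R.α₂' * R.α₂ := by
  rw [chi_right, boundaryForm, ρ, Complex.sq_norm, Complex.sq_norm, Complex.normSq_apply,
    Complex.normSq_apply]
  simp only [Complex.add_re, Complex.add_im, Complex.mul_re, Complex.mul_im, Complex.ofReal_re,
    Complex.ofReal_im]
  field_simp
  ring

lemma exists_boundaryForm_le :
    ∃ C : ℝ, 0 ≤ C ∧ ∀ z : ℂ, R.boundaryForm z ≤ C * (1 + ‖R.chi z R.b‖ ^ 2) := by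
  by_cases h : R.α₂' = 0
  · refine ⟨|R.α₁ * R.α₂|, abs_nonneg _, fun z => ?_⟩
    have hform : R.boundaryForm z = R.α₁ * R.α₂ := by simp [boundaryForm, h]
    rw [hform]
    exact (le_abs_self _).trans
      (le_mul_of_one_le_right (abs_nonneg _) (le_add_of_nonneg_right (sq_nonneg _)))
  · set c₀ := |R.α₁' / R.α₂'|
    set c₁ := |R.ρ / R.α₂'|
    set c₂ := |R.ρ / R.α₂' * R.α₂|
    refine ⟨c₀ + c₁ + c₂, by positivity, fun z => ?_⟩
    set w := R.chi z R.b
    have hre : -(2 * (R.ρ / R.α₂') * w.re) ≤ c₁ * (1 + ‖w‖ ^ 2) := by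
      calc -(2 * (R.ρ / R.α₂') * w.re) ≤ |2 * (R.ρ / R.α₂') * w.re| := neg_le_abs _
        _ = c₁ * (2 * |w.re|) := by rw [abs_mul, abs_mul, abs_two]; ring
        _ ≤ c₁ * (1 + ‖w‖ ^ 2) := by
          gcongr
          nlinarith [Complex.abs_re_le_norm w, sq_nonneg (‖w‖ - 1)]
    have hsq : R.α₁' / R.α₂' * ‖w‖ ^ 2 ≤ c₀ * (1 + ‖w‖ ^ 2) :=
      mul_le_mul (le_abs_self _) (le_add_of_nonneg_left zero_le_one) (sq_nonneg _) (abs_nonneg _)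
    have hconst : R.ρ / R.α₂' * R.α₂ ≤ c₂ * (1 + ‖w‖ ^ 2) :=
      (le_abs_self _).trans
        (le_mul_of_one_le_right (abs_nonneg _) (le_add_of_nonneg_right (sq_nonneg _)))
    rw [boundaryForm_eq h]
    linarith

namespace IsGlued

lemma energy (h : R.IsGlued z y A B s) :
    ((R.glueDirichlet z y A B : ℝ) : ℂ) +
      ((∫ x in R.a..R.b, R.Q x * ‖R.glue z y A B x‖ ^ 2 : ℝ) : ℂ) -
      z * (R.glueNormSq z y A B : ℝ) =
    -(s * starRingEnd ℂ (A * R.psi z y)) +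
      ((R.β₁ / R.β₂ * ‖A * R.psi z R.a‖ ^ 2 + ‖B‖ ^ 2 * R.boundaryForm z : ℝ) : ℂ) := by
  have hpsi := ((isSol_psi z).const_mul A).energy R.left_mem h.mem
  have hchi := ((isSol_chi z).const_mul B).energy h.mem R.right_mem
  have hjump : B * R.chi' z y = s + A * R.psi' z y := sub_eq_iff_eq_add.1 h.jump
  have hleft : A * R.psi' z R.a * starRingEnd ℂ (A * R.psi z R.a) =
      -((R.β₁ / R.β₂ * ‖A * R.psi z R.a‖ ^ 2 : ℝ) : ℂ) := by
    rw [map_mul, mul_mul_mul_comm, psi'_mul_conj_psi_left, ← ofReal_norm_sq_eq_mul_conj, norm_mul]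
    push_cast
    ring
  have hright : B * R.chi' z R.b * starRingEnd ℂ (B * R.chi z R.b) =
      ((‖B‖ ^ 2 : ℝ) : ℂ) * (z * R.ρ + R.boundaryForm z) := by
    rw [map_mul, mul_mul_mul_comm, chi'_mul_conj_chi_right, ofReal_norm_sq_eq_mul_conj]
  rw [hleft] at hpsi
  rw [hright, ← h.eq, hjump] at hchi
  rw [glueNormSq, glueDirichlet_eq_add h.mem, integral_norm_sq_glue h.mem,
    integral_Q_mul_norm_sq_glue h.mem]
  push_cast at hpsi hchi ⊢
  linear_combination hpsi + hchi

lemma abs_integral_Q_le (h : R.IsGlued z y A B s) :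
    |∫ x in R.a..R.b, R.Q x * ‖R.glue z y A B x‖ ^ 2| ≤ R.bound * R.glueNormSq z y A B := by
  rw [← Real.norm_eq_abs]
  calc ‖∫ x in R.a..R.b, R.Q x * ‖R.glue z y A B x‖ ^ 2‖
      ≤ ∫ x in R.a..R.b, R.bound * ‖R.glue z y A B x‖ ^ 2 := by
        refine intervalIntegral.norm_integral_le_of_norm_le R.a_le_b (.of_forall fun t _ => ?_)
          ((continuous_const.mul (h.continuous_glue.norm.pow 2)).intervalIntegrable _ _)
        rw [norm_mul, norm_pow, norm_norm]
        exact mul_le_mul_of_nonneg_right (R.abs_le t) (sq_nonneg _)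
    _ = R.bound * ∫ x in R.a..R.b, ‖R.glue z y A B x‖ ^ 2 :=
        intervalIntegral.integral_const_mul _ _
    _ ≤ R.bound * R.glueNormSq z y A B :=
        mul_le_mul_of_nonneg_left integral_norm_sq_glue_le_glueNormSq R.bound_nonneg

lemma abs_im_mul_glueNormSq_le (h : R.IsGlued z y A B s) :
    |z.im| * R.glueNormSq z y A B ≤ ‖s‖ * ‖A * R.psi z y‖ := by
  have him := congrArg Complex.im h.energy
  simp only [Complex.sub_im, Complex.add_im, Complex.ofReal_im, Complex.im_mul_ofReal,
    Complex.neg_im] at him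
  calc |z.im| * R.glueNormSq z y A B
      = |(s * starRingEnd ℂ (A * R.psi z y)).im| := by
        rw [← abs_of_nonneg (glueNormSq_nonneg (R := R)), ← abs_mul]
        congr 1
        linarith
    _ ≤ ‖s * starRingEnd ℂ (A * R.psi z y)‖ := Complex.abs_im_le_norm _
    _ = ‖s‖ * ‖A * R.psi z y‖ := by rw [norm_mul, RCLike.norm_conj]

lemma glueDirichlet_le (h : R.IsGlued z y A B s) : R.glueDirichlet z y A B ≤
    (R.bound + z.re) * R.glueNormSq z y A B + ‖s‖ * ‖A * R.psi z y‖ +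
      R.β₁ / R.β₂ * ‖A * R.psi z R.a‖ ^ 2 + ‖B‖ ^ 2 * R.boundaryForm z := by
  have hre := congrArg Complex.re h.energy
  simp only [Complex.sub_re, Complex.add_re, Complex.ofReal_re, Complex.re_mul_ofReal,
    Complex.neg_re] at hre
  have hQ := neg_le_of_abs_le h.abs_integral_Q_le
  have hjump : -(s * starRingEnd ℂ (A * R.psi z y)).re ≤ ‖s‖ * ‖A * R.psi z y‖ := by
    rw [← RCLike.norm_conj (A * R.psi z y), ← norm_mul]
    exact (neg_le_abs _).trans (Complex.abs_re_le_norm _)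
  linarith

end IsGlued

lemma exists_glueDirichlet_le : ∃ C : ℝ, 0 ≤ C ∧
    ∀ {z : ℂ} {y : ℝ} {A B s : ℂ}, R.IsGlued z y A B s → R.glueDirichlet z y A B ≤
      2 * ((C + z.re) * R.glueNormSq z y A B + ‖s‖ * ‖A * R.psi z y‖) := by
  obtain ⟨C₁, hC₁, hform⟩ := exists_boundaryForm_le (R := R)
  set c := |R.β₁ / R.β₂|
  set τ : ℝ := 1 / (2 * (c + C₁ + 1)) with hτ
  set K := 1 / (R.b - R.a) + 1 / τ
  have hτ0 : 0 < τ := by positivity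
  have hba := sub_pos.2 R.a_lt_b
  have hρ := R.rho_pos
  have hbound := R.bound_nonneg
  refine ⟨R.bound + (c + C₁) * K + C₁ / R.ρ, by positivity, fun {z y A B s} h => ?_⟩
  set n := R.glueNormSq z y A B
  set d := R.glueDirichlet z y A B
  have hd0 : 0 ≤ d := glueDirichlet_nonneg
  have hleft : R.β₁ / R.β₂ * ‖A * R.psi z R.a‖ ^ 2 ≤ c * (K * n + τ * d) :=
    mul_le_mul (le_abs_self _) (h.norm_sq_left_le hτ0) (sq_nonneg _) (abs_nonneg _)
  have hB : ‖B‖ ^ 2 ≤ n / R.ρ := (le_div_iff₀' hρ).2 rho_mul_norm_sq_le_glueNormSq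
  have hright : ‖B‖ ^ 2 * R.boundaryForm z ≤ C₁ / R.ρ * n + C₁ * (K * n + τ * d) := by
    calc ‖B‖ ^ 2 * R.boundaryForm z ≤ ‖B‖ ^ 2 * (C₁ * (1 + ‖R.chi z R.b‖ ^ 2)) := by
          gcongr
          exact hform z
      _ = C₁ * ‖B‖ ^ 2 + C₁ * ‖B * R.chi z R.b‖ ^ 2 := by rw [norm_mul]; ring
      _ ≤ C₁ * (n / R.ρ) + C₁ * (K * n + τ * d) := by
          gcongr
          exact h.norm_sq_right_le hτ0
      _ = C₁ / R.ρ * n + C₁ * (K * n + τ * d) := by ring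
  have hhalf : (c + C₁) * τ * d ≤ 1 / 2 * d := by
    refine mul_le_mul_of_nonneg_right ?_ hd0
    rw [hτ, mul_one_div, div_le_div_iff₀ (by positivity) two_pos]
    linarith
  linarith [h.glueDirichlet_le]

end Energy

section Eigenvalue

lemma im_eq_zero_of_wronskian_eq_zero (hz : R.wronskian z = 0) : z.im = 0 := by
  obtain ⟨k, hk0, hk⟩ := exists_isRatio hz
  have him := (hk.isGlued R.left_mem).abs_im_mul_glueNormSq_le
  rw [norm_zero, zero_mul] at him
  exact abs_nonpos_iff.1 (nonpos_of_mul_nonpos_left him (glueNormSq_pos hk0))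

lemma wronskian_ne_zero_of_im_ne_zero (hz : z.im ≠ 0) : R.wronskian z ≠ 0 :=
  mt im_eq_zero_of_wronskian_eq_zero hz

lemma exists_le_re_of_wronskian_eq_zero : ∃ C : ℝ, ∀ z : ℂ, R.wronskian z = 0 → -C ≤ z.re := by
  obtain ⟨C, -, hC⟩ := exists_glueDirichlet_le (R := R)
  refine ⟨C, fun z hz => ?_⟩
  obtain ⟨k, hk0, hk⟩ := exists_isRatio hz
  have hd := glueDirichlet_nonneg.trans (hC (hk.isGlued R.left_mem))
  rw [norm_zero, zero_mul, add_zero] at hd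
  have hpos : 0 ≤ C + z.re :=
    nonneg_of_mul_nonneg_left (nonneg_of_mul_nonneg_right hd two_pos) (glueNormSq_pos hk0)
  linarith

variable {l : ℝ}

lemma lagrange_glue (hk : R.IsRatio l k) (h : R.IsGlued z y A B s) :
    (z - l) * ((∫ x in R.a..R.b, R.glue z y A B x * starRingEnd ℂ (R.psi l x)) +
      R.ρ * B * starRingEnd ℂ k) = s * starRingEnd ℂ (R.psi l y) := by
  have hconj := (isSol_psi (R := R) (l : ℂ)).conj
  rw [Complex.conj_ofReal] at hconj
  have hpsi := ((isSol_psi z).const_mul A).lagrange hconj R.left_mem h.mem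
  have hchi := ((isSol_chi z).const_mul B).lagrange hconj h.mem R.right_mem
  have hcont := Complex.continuous_conj.comp (continuous_psi (R := R) (l : ℂ))
  have hsplit : ∫ x in R.a..R.b, R.glue z y A B x * starRingEnd ℂ (R.psi l x) =
      (∫ x in R.a..y, A * R.psi z x * starRingEnd ℂ (R.psi l x)) +
        ∫ x in y..R.b, B * R.chi z x * starRingEnd ℂ (R.psi l x) := by
    simp_rw [glue, ite_mul]
    exact integral_ite_le_eq_add h.mem
      (((continuous_const.mul (continuous_psi z)).mul hcont).intervalIntegrable _ _)
      (((continuous_const.mul (continuous_chi z)).mul hcont).intervalIntegrable _ _)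
  obtain ⟨hkb, hkb'⟩ := hk R.b R.right_mem
  have hjump : B * R.chi' z y = s + A * R.psi' z y := sub_eq_iff_eq_add.1 h.jump
  rw [hjump, ← h.eq, hkb, hkb', chi_right, chi'_right, chi_right, chi'_right] at hchi
  rw [psi_left, psi'_left, psi_left, psi'_left] at hpsi
  simp only [map_add, map_mul, map_neg, Complex.conj_ofReal] at hpsi hchi
  rw [hsplit, ρ]
  push_cast
  linear_combination hpsi + hchi

lemma IsRatio.glueNormSq_eq (hk : R.IsRatio z k) (y : ℝ) :
    R.glueNormSq z y 1 k = (∫ x in R.a..R.b, ‖R.psi z x‖ ^ 2) + R.ρ * ‖k‖ ^ 2 := by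
  rw [glueNormSq]
  congr 1
  refine intervalIntegral.integral_congr fun x hx => ?_
  rw [Set.uIcc_of_le R.a_le_b] at hx
  simp only [hk.glue_eq_psi y hx]

lemma IsRatio.sub_mul_integral_psi_mul_conj (hk : R.IsRatio l k) (z : ℂ) :
    (z - l) * ((∫ x in R.a..R.b, R.psi z x * starRingEnd ℂ (R.psi l x)) +
      starRingEnd ℂ k * (R.α₁' * R.psi z R.b - R.α₂' * R.psi' z R.b)) =
    starRingEnd ℂ k * R.wronskian z := by
  have hconj := (isSol_psi (R := R) (l : ℂ)).conj
  rw [Complex.conj_ofReal] at hconj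
  have hpsi := (isSol_psi z).lagrange hconj R.left_mem R.right_mem
  obtain ⟨hkb, hkb'⟩ := hk R.b R.right_mem
  rw [hkb, hkb', chi_right, chi'_right, psi_left, psi'_left, psi_left, psi'_left] at hpsi
  simp only [map_add, map_mul, map_neg, Complex.conj_ofReal] at hpsi
  rw [wronskian_eq_right]
  linear_combination hpsi

lemma IsRatio.conj_mul_deriv_wronskian (hk : R.IsRatio l k) (y : ℝ) :
    starRingEnd ℂ k * deriv R.wronskian l = R.glueNormSq l y 1 k := by
  have hcont := Complex.continuous_conj.comp (continuous_psi (R := R) (l : ℂ))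
  have hdiff : Differentiable ℂ fun z =>
      (∫ x in R.a..R.b, R.psi z x * starRingEnd ℂ (R.psi l x)) +
        starRingEnd ℂ k * (R.α₁' * R.psi z R.b - R.α₂' * R.psi' z R.b) :=
    (Potential.differentiable_integral_sol_mul (differentiable_const _)
      (hcont.intervalIntegrable _ _)).add
      ((((differentiable_psi _).const_mul _).sub ((differentiable_psi' _).const_mul _)).const_mul _)
  obtain ⟨hkb, hkb'⟩ := hk R.b R.right_mem
  rw [← deriv_const_mul _ (differentiable_wronskian _),
    deriv_eq_of_sub_mul_eq (hdiff l) hk.sub_mul_integral_psi_mul_conj, hk.glueNormSq_eq,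
    integral_mul_conj_self, hkb, hkb', chi_right, chi'_right, Complex.ofReal_add,
    Complex.ofReal_mul, ofReal_norm_sq_eq_mul_conj, ρ]
  push_cast
  ring

lemma deriv_wronskian_ne_zero (hl : R.wronskian l = 0) : deriv R.wronskian l ≠ 0 := by
  obtain ⟨k, hk0, hk⟩ := exists_isRatio hl
  intro hderiv
  have hnorm := hk.conj_mul_deriv_wronskian R.a
  rw [hderiv, mul_zero] at hnorm
  exact (glueNormSq_pos hk0).ne (Complex.ofReal_eq_zero.1 hnorm.symm).symm

end Eigenvalue

section Green

lemma exists_abs_im_mul_glueDirichlet_le : ∃ C : ℝ, 0 ≤ C ∧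
    ∀ {z : ℂ} {y : ℝ} {A B : ℂ}, R.IsGlued z y A B 1 →
      |z.im| * R.glueDirichlet z y A B ≤ C * (1 + ‖z‖) * ‖A * R.psi z y‖ := by
  obtain ⟨C, hC0, hC⟩ := exists_glueDirichlet_le (R := R)
  refine ⟨2 * (C + 2), by positivity, fun {z y A B} h => ?_⟩
  have hd := hC h
  have hn := h.abs_im_mul_glueNormSq_le
  rw [norm_one, one_mul] at hd hn
  set n := R.glueNormSq z y A B
  have hn0 : 0 ≤ n := glueNormSq_nonneg
  calc |z.im| * R.glueDirichlet z y A B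
      ≤ |z.im| * (2 * ((C + z.re) * n + ‖A * R.psi z y‖)) := by gcongr
    _ ≤ |z.im| * (2 * ((C + ‖z‖) * n + ‖A * R.psi z y‖)) := by
        gcongr
        exact Complex.re_le_norm z
    _ = 2 * ((C + ‖z‖) * (|z.im| * n) + |z.im| * ‖A * R.psi z y‖) := by ring
    _ ≤ 2 * ((C + ‖z‖) * ‖A * R.psi z y‖ + ‖z‖ * ‖A * R.psi z y‖) := by
        gcongr
        exact Complex.abs_im_le_norm z
    _ = (2 * C + 4 * ‖z‖) * ‖A * R.psi z y‖ := by ring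
    _ ≤ 2 * (C + 2) * (1 + ‖z‖) * ‖A * R.psi z y‖ := by
        gcongr
        nlinarith [norm_nonneg z]

lemma exists_abs_im_mul_norm_le : ∃ C : ℝ, 0 ≤ C ∧
    ∀ {z : ℂ} {y : ℝ} {A B : ℂ}, R.IsGlued z y A B 1 →
      |z.im| * ‖A * R.psi z y‖ ≤ C * √(1 + ‖z‖) := by
  obtain ⟨C, hC0, hC⟩ := exists_abs_im_mul_glueDirichlet_le (R := R)
  have hba := sub_pos.2 R.a_lt_b
  set κ := 1 / (R.b - R.a)
  have hκ : 0 ≤ κ := by positivity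
  refine ⟨κ + 1 + C, by positivity, fun {z y A B} h => ?_⟩
  have hd := hC h
  have hn := h.abs_im_mul_glueNormSq_le
  rw [norm_one, one_mul] at hn
  set r := √(1 + ‖z‖)
  have hr2 : r ^ 2 = 1 + ‖z‖ := Real.sq_sqrt (by positivity)
  have hr1 : 1 ≤ r := Real.one_le_sqrt.2 (le_add_of_nonneg_right (norm_nonneg z))
  have hr0 : 0 < r := one_pos.trans_le hr1
  have hsob := h.norm_sq_glue_le (inv_pos.2 hr0) h.mem
  rw [glue, if_pos le_rfl, one_div r⁻¹, inv_inv] at hsob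
  rw [← hr2] at hd
  have hn0 : 0 ≤ R.glueNormSq z y A B := glueNormSq_nonneg
  set n := R.glueNormSq z y A B
  set d := R.glueDirichlet z y A B
  rcases (norm_nonneg (A * R.psi z y)).eq_or_lt with h0 | h0
  · rw [← h0, mul_zero]
    positivity
  refine le_of_mul_le_mul_right ?_ h0
  set N := ‖A * R.psi z y‖
  calc |z.im| * N * N = |z.im| * N ^ 2 := by ring
    _ ≤ |z.im| * ((κ + r) * n + r⁻¹ * d) := by gcongr
    _ = (κ + r) * (|z.im| * n) + r⁻¹ * (|z.im| * d) := by ring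
    _ ≤ (κ * r + r) * N + r⁻¹ * (C * r ^ 2 * N) := by
        gcongr
        exact le_mul_of_one_le_right hκ hr1
    _ = (κ + 1 + C) * r * N := by field_simp

lemma exists_glueNormSq_green_le : ∃ C : ℝ, 0 ≤ C ∧ ∀ {z : ℂ}, z.im ≠ 0 → ∀ {y : ℝ},
    y ∈ Set.Icc R.a R.b →
    R.glueNormSq z y (R.chi z y / R.wronskian z) (R.psi z y / R.wronskian z) ≤
      C * √(1 + ‖z‖) / z.im ^ 2 := by
  obtain ⟨C, hC0, hC⟩ := exists_abs_im_mul_norm_le (R := R)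
  refine ⟨C, hC0, fun {z} hz {y} hy => ?_⟩
  have hgreen := isGlued_green (wronskian_ne_zero_of_im_ne_zero hz) hy
  have hn := hgreen.abs_im_mul_glueNormSq_le
  rw [norm_one, one_mul] at hn
  rw [le_div_iff₀' (sq_pos_of_ne_zero hz), ← sq_abs, sq, mul_assoc]
  exact (mul_le_mul_of_nonneg_left hn (abs_nonneg _)).trans (hC hgreen)

lemma exists_sqrt_glueNormSq_green_le : ∃ C : ℝ, 0 ≤ C ∧ ∀ {z : ℂ}, z.im ≠ 0 → ∀ {y : ℝ},
    y ∈ Set.Icc R.a R.b →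
    √(R.glueNormSq z y (R.chi z y / R.wronskian z) (R.psi z y / R.wronskian z)) * |z.im| ≤
      C * (1 + √‖z‖) := by
  obtain ⟨C, hC0, hC⟩ := exists_glueNormSq_green_le (R := R)
  refine ⟨√C, Real.sqrt_nonneg C, fun {z} hz {y} hy => ?_⟩
  have hn := (le_div_iff₀ (sq_pos_of_ne_zero hz)).1 (hC hz hy)
  rw [← Real.sqrt_sq_eq_abs, ← Real.sqrt_mul glueNormSq_nonneg,
    ← Real.sqrt_sq (x := 1 + √‖z‖) (by positivity), ← Real.sqrt_mul hC0]
  refine Real.sqrt_le_sqrt (hn.trans (mul_le_mul_of_nonneg_left ?_ hC0))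
  rw [Real.sqrt_le_left (by positivity)]
  have hsq : 1 + ‖z‖ ≤ (1 + √‖z‖) ^ 2 := by
    nlinarith [Real.sq_sqrt (norm_nonneg z), Real.sqrt_nonneg ‖z‖]
  exact hsq.trans (le_self_pow₀ (one_le_pow₀ (le_add_of_nonneg_right (Real.sqrt_nonneg _)))
    two_ne_zero)

end Green

end RegularSL

namespace RegularSL

variable {R : RegularSL} {z A B s : ℂ} {y : ℝ} {h : ℝ → ℂ}

section StateSpace

variable (R) in
/-- Lebesgue measure on `[a, b]`. -/
abbrev vol : Measure ℝ := volume.restrict (Set.Ioc R.a R.b)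

variable (R) in
/-- The Hilbert space `L²(a, b) ⊕ ℂ`, in which the problem is self-adjoint. -/
abbrev StateSpace : Type := WithLp 2 (Lp ℂ 2 R.vol × ℂ)

/-- The vector with components `u` and `√ρ k`. -/
def vec {u : ℝ → ℂ} (hu : MemLp u 2 R.vol) (k : ℂ) : R.StateSpace :=
  WithLp.toLp 2 (hu.toLp u, (√R.ρ : ℂ) * k)

lemma memLp_of_continuous {u : ℝ → ℂ} (hu : Continuous u) : MemLp u 2 R.vol := by
  obtain ⟨C, hC⟩ := (isCompact_Icc (a := R.a) (b := R.b)).exists_bound_of_continuousOn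
    hu.continuousOn
  exact MemLp.of_bound hu.aestronglyMeasurable C <| (ae_restrict_iff' measurableSet_Ioc).2 <|
    .of_forall fun x hx => hC x (Set.Ioc_subset_Icc_self hx)

lemma intervalIntegrable_of_memLp (hh : MemLp h 2 R.vol) :
    IntervalIntegrable h volume R.a R.b := by
  rw [intervalIntegrable_iff_integrableOn_Ioc_of_le R.a_le_b]
  exact hh.integrable one_le_two

lemma inner_vec {u v : ℝ → ℂ} (hu : MemLp u 2 R.vol) (hv : MemLp v 2 R.vol) (k l : ℂ) :
    inner ℂ (vec hu k) (vec hv l) =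
      (∫ x in R.a..R.b, v x * starRingEnd ℂ (u x)) + R.ρ * l * starRingEnd ℂ k := by
  rw [WithLp.prod_inner_apply, intervalIntegral.integral_of_le R.a_le_b]
  congr 1
  · rw [L2.inner_def]
    refine integral_congr_ae ?_
    filter_upwards [hu.coeFn_toLp, hv.coeFn_toLp] with x hux hvx
    rw [vec, vec, hux, hvx, RCLike.inner_apply]
  · have hsqrt : ((√R.ρ : ℝ) : ℂ) * √R.ρ = R.ρ := by
      rw [← Complex.ofReal_mul, Real.mul_self_sqrt R.rho_pos.le]
    rw [vec, vec, RCLike.inner_apply, map_mul, Complex.conj_ofReal, ← hsqrt]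
    ring

lemma norm_vec_sq {u : ℝ → ℂ} (hu : MemLp u 2 R.vol) (k : ℂ) :
    ‖vec hu k‖ ^ 2 = (∫ x in R.a..R.b, ‖u x‖ ^ 2) + R.ρ * ‖k‖ ^ 2 := by
  have hinner := inner_self_eq_norm_sq_to_K (𝕜 := ℂ) (vec hu k)
  rw [inner_vec, integral_mul_conj_self, mul_assoc, ← ofReal_norm_sq_eq_mul_conj] at hinner
  have hreal : ((‖vec hu k‖ ^ 2 : ℝ) : ℂ) =
      (((∫ x in R.a..R.b, ‖u x‖ ^ 2) + R.ρ * ‖k‖ ^ 2 : ℝ) : ℂ) := by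
    rw [Complex.ofReal_add, Complex.ofReal_mul, hinner, Complex.ofReal_pow]
    rfl
  exact Complex.ofReal_injective hreal

/-- The vector that represents the functional `u ↦ ∫ u h`. -/
def dualVec (hh : MemLp h 2 R.vol) : R.StateSpace := vec hh.star 0

lemma inner_dualVec {u : ℝ → ℂ} (hh : MemLp h 2 R.vol) (hu : MemLp u 2 R.vol) (k : ℂ) :
    inner ℂ (dualVec hh) (vec hu k) = ∫ x in R.a..R.b, u x * h x := by
  rw [dualVec, inner_vec, map_zero, mul_zero, add_zero]
  exact intervalIntegral.integral_congr fun x _ => congrArg (u x * ·) (star_star (h x))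

/-- The vector with components `glue z y A B` and `√ρ B`. -/
def glueVec (hg : R.IsGlued z y A B s) : R.StateSpace :=
  vec (memLp_of_continuous hg.continuous_glue) B

lemma norm_glueVec (hg : R.IsGlued z y A B s) : ‖glueVec hg‖ = √(R.glueNormSq z y A B) := by
  rw [glueNormSq, ← norm_vec_sq (memLp_of_continuous hg.continuous_glue),
    Real.sqrt_sq (norm_nonneg _), glueVec]

lemma norm_integral_glue_mul_le (hh : MemLp h 2 R.vol) (hg : R.IsGlued z y A B s) :
    ‖∫ x in R.a..R.b, R.glue z y A B x * h x‖ ≤ √(R.glueNormSq z y A B) * ‖dualVec hh‖ := by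
  rw [← inner_dualVec hh (memLp_of_continuous hg.continuous_glue) B, ← norm_glueVec hg, mul_comm]
  exact norm_inner_le_norm _ _

end StateSpace

section Eigenvector

variable (R) in
/-- The type of eigenvalues. -/
abbrev Eigenvalue : Type := {l : ℝ // R.wronskian l = 0}

/-- The factor of proportionality `ψ / χ` at an eigenvalue. -/
def ratio (l : R.Eigenvalue) : ℂ := (exists_isRatio l.2).choose

lemma ratio_ne_zero (l : R.Eigenvalue) : ratio l ≠ 0 := (exists_isRatio l.2).choose_spec.1

lemma isRatio_ratio (l : R.Eigenvalue) : R.IsRatio (l : ℝ) (ratio l) :=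
  (exists_isRatio l.2).choose_spec.2

/-- The eigenvector of an eigenvalue. -/
def eigenvector (l : R.Eigenvalue) : R.StateSpace :=
  vec (memLp_of_continuous (continuous_psi (R := R) ((l : ℝ) : ℂ))) (ratio l)

lemma norm_eigenvector_sq (l : R.Eigenvalue) (y : ℝ) :
    ‖eigenvector l‖ ^ 2 = R.glueNormSq (l : ℝ) y 1 (ratio l) := by
  rw [eigenvector, norm_vec_sq, (isRatio_ratio l).glueNormSq_eq]

lemma eigenvector_ne_zero (l : R.Eigenvalue) : eigenvector l ≠ 0 := by
  intro h
  have hnorm := norm_eigenvector_sq l R.a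
  rw [h, norm_zero, zero_pow two_ne_zero] at hnorm
  exact (glueNormSq_pos (ratio_ne_zero l)).ne hnorm

lemma sub_mul_inner_eigenvector_glueVec (l : R.Eigenvalue) (hg : R.IsGlued z y A B s) :
    (z - (l : ℝ)) * inner ℂ (eigenvector l) (glueVec hg) =
      s * starRingEnd ℂ (R.psi (l : ℝ) y) := by
  rw [eigenvector, glueVec, inner_vec, lagrange_glue (isRatio_ratio l) hg]

lemma pairwise_inner_eigenvector_eq_zero :
    Pairwise fun l m : R.Eigenvalue => inner ℂ (eigenvector l) (eigenvector m) = 0 := by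
  intro l m hlm
  have hlagrange := lagrange_glue (isRatio_ratio l) ((isRatio_ratio m).isGlued R.left_mem)
  have hne : ((m : ℝ) : ℂ) - (l : ℝ) ≠ 0 :=
    sub_ne_zero.2 fun h => hlm (Subtype.ext (Complex.ofReal_injective h.symm))
  rw [zero_mul] at hlagrange
  rw [eigenvector, eigenvector, inner_vec]
  refine Eq.trans ?_ ((mul_eq_zero.1 hlagrange).resolve_left hne)
  congr 1
  refine intervalIntegral.integral_congr fun x hx => ?_
  rw [Set.uIcc_of_le R.a_le_b] at hx
  simp only [(isRatio_ratio m).glue_eq_psi _ hx]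

end Eigenvector

section Transform

variable (R) in
/-- The transform of `h` whose kernel is the Wronskian times Green's function. -/
def transform (y : ℝ) (h : ℝ → ℂ) (z : ℂ) : ℂ :=
  ∫ x in R.a..R.b, R.glue z y (R.chi z y) (R.psi z y) x * h x

/-- The coefficient of the sampling series, divided by the value of `Ω` at `z`. -/
def samplingCoeff (y : ℝ) (h : ℝ → ℂ) (l : R.Eigenvalue) : ℂ :=
  R.transform y h (l : ℝ) / deriv R.wronskian (l : ℝ)

lemma transform_eq_wronskian_mul (hz : R.wronskian z ≠ 0) (y : ℝ) (h : ℝ → ℂ) :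
    R.transform y h z = R.wronskian z * ∫ x in R.a..R.b,
      R.glue z y (R.chi z y / R.wronskian z) (R.psi z y / R.wronskian z) x * h x := by
  rw [transform, ← intervalIntegral.integral_const_mul]
  refine intervalIntegral.integral_congr fun x _ => ?_
  rw [← mul_assoc, ← glue_const_mul, mul_div_cancel₀ _ hz, mul_div_cancel₀ _ hz]

lemma transform_eq_add (hy : y ∈ Set.Icc R.a R.b) (hh : IntervalIntegrable h volume R.a R.b)
    (z : ℂ) : R.transform y h z = R.chi z y * (∫ x in R.a..y, R.psi z x * h x) +
      R.psi z y * ∫ x in y..R.b, R.chi z x * h x := by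
  have hleft := hh.mono_set (Set.uIcc_subset_uIcc_left (Set.Icc_subset_uIcc hy))
  have hright := hh.mono_set (Set.uIcc_subset_uIcc_right (Set.Icc_subset_uIcc hy))
  rw [transform, ← intervalIntegral.integral_const_mul, ← intervalIntegral.integral_const_mul]
  simp_rw [glue, ite_mul, mul_assoc]
  exact integral_ite_le_eq_add hy
    ((hleft.continuousOn_mul (continuous_psi z).continuousOn).const_mul _)
    ((hright.continuousOn_mul (continuous_chi z).continuousOn).const_mul _)

lemma differentiable_transform (hy : y ∈ Set.Icc R.a R.b)
    (hh : IntervalIntegrable h volume R.a R.b) : Differentiable ℂ (R.transform y h) := by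
  have hleft := hh.mono_set (Set.uIcc_subset_uIcc_left (Set.Icc_subset_uIcc hy))
  have hright := hh.mono_set (Set.uIcc_subset_uIcc_right (Set.Icc_subset_uIcc hy))
  rw [funext (transform_eq_add hy hh)]
  exact ((differentiable_chi y).mul
    (Potential.differentiable_integral_sol_mul (differentiable_const _) hleft)).add
    ((differentiable_psi y).mul
      (Potential.differentiable_integral_solRight_mul (by fun_prop) hright))

lemma ratio_mul_transform (hy : y ∈ Set.Icc R.a R.b) (h : ℝ → ℂ) (l : R.Eigenvalue) :
    ratio l * R.transform y h (l : ℝ) =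
      R.psi (l : ℝ) y * ∫ x in R.a..R.b, R.psi (l : ℝ) x * h x := by
  rw [transform, ← intervalIntegral.integral_const_mul, ← intervalIntegral.integral_const_mul]
  refine intervalIntegral.integral_congr fun x hx => ?_
  rw [Set.uIcc_of_le R.a_le_b] at hx
  rw [← mul_assoc, ← mul_assoc, ← glue_const_mul, ← (isRatio_ratio l y hy).1, glue,
    mul_assoc, mul_left_comm, ← (isRatio_ratio l x hx).1, ite_self]

lemma norm_samplingCoeff (hy : y ∈ Set.Icc R.a R.b) (hh : MemLp h 2 R.vol) (l : R.Eigenvalue) :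
    ‖samplingCoeff y h l‖ =
      ‖R.psi (l : ℝ) y‖ * ‖inner ℂ (eigenvector l) (dualVec hh)‖ / ‖eigenvector l‖ ^ 2 := by
  have hderiv := congrArg norm ((isRatio_ratio l).conj_mul_deriv_wronskian R.a)
  have htransform := congrArg norm (ratio_mul_transform hy h l)
  rw [norm_mul, norm_mul] at htransform
  rw [norm_mul, RCLike.norm_conj, Complex.norm_real, Real.norm_eq_abs, ← norm_eigenvector_sq,
    abs_of_nonneg (sq_nonneg _)] at hderiv
  rw [samplingCoeff, norm_div, norm_inner_symm, eigenvector, inner_dualVec, ← eigenvector,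
    ← htransform, ← hderiv, mul_div_mul_left _ _ (norm_ne_zero_iff.2 (ratio_ne_zero l))]

lemma norm_samplingCoeff_div_eq (hh : MemLp h 2 R.vol) (hg : R.IsGlued z y A B 1)
    (hz : z.im ≠ 0) (l : R.Eigenvalue) :
    ‖samplingCoeff y h l‖ / ‖z - (l : ℝ)‖ =
      ‖inner ℂ (eigenvector l) (glueVec hg)‖ * ‖inner ℂ (eigenvector l) (dualVec hh)‖ /
        ‖eigenvector l‖ ^ 2 := by
  have hinner := congrArg norm (sub_mul_inner_eigenvector_glueVec l hg)
  rw [one_mul, norm_mul, RCLike.norm_conj] at hinner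
  have hzl : ‖z - (l : ℝ)‖ ≠ 0 := by
    rw [norm_ne_zero_iff, sub_ne_zero]
    rintro rfl
    exact hz (Complex.ofReal_im _)
  rw [norm_samplingCoeff hg.mem hh, ← hinner]
  field_simp

lemma sum_norm_samplingCoeff_div_le (hh : MemLp h 2 R.vol) (hz : z.im ≠ 0)
    (hy : y ∈ Set.Icc R.a R.b) (s : Finset R.Eigenvalue) :
    ∑ l ∈ s, ‖samplingCoeff y h l‖ / ‖z - (l : ℝ)‖ ≤
      √(R.glueNormSq z y (R.chi z y / R.wronskian z) (R.psi z y / R.wronskian z)) *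
        ‖dualVec hh‖ := by
  have hg := isGlued_green (wronskian_ne_zero_of_im_ne_zero hz) hy
  simp_rw [norm_samplingCoeff_div_eq hh hg hz, ← norm_glueVec hg]
  exact sum_norm_inner_mul_norm_inner_div_le eigenvector_ne_zero
    pairwise_inner_eigenvector_eq_zero s _ _

lemma summable_norm_samplingCoeff_div (hh : MemLp h 2 R.vol) (hz : z.im ≠ 0)
    (hy : y ∈ Set.Icc R.a R.b) :
    Summable fun l : R.Eigenvalue => ‖samplingCoeff y h l‖ / ‖z - (l : ℝ)‖ :=
  summable_of_sum_le (fun _ => by positivity) (sum_norm_samplingCoeff_div_le hh hz hy)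

end Transform

end RegularSL

namespace RegularSL

variable {R : RegularSL} {z : ℂ} {y : ℝ} {h : ℝ → ℂ}

section Sampling

/-- A term of the sampling series with `Ω` the Wronskian. -/
def samplingTerm (y : ℝ) (h : ℝ → ℂ) (l : R.Eigenvalue) (z : ℂ) : ℂ :=
  R.transform y h (l : ℝ) * samplingFun R.wronskian (l : ℝ) z

lemma samplingTerm_eq_mul_dslope (l : R.Eigenvalue) (z : ℂ) :
    samplingTerm y h l z = samplingCoeff y h l * dslope R.wronskian (l : ℝ) z := by
  rw [samplingTerm, samplingFun_eq_dslope l.2 (deriv_wronskian_ne_zero l.2), samplingCoeff]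
  ring

lemma samplingTerm_of_im_ne_zero (l : R.Eigenvalue) (hz : z.im ≠ 0) :
    samplingTerm y h l z = R.wronskian z * (samplingCoeff y h l / (z - (l : ℝ))) := by
  have hzl : z ≠ (l : ℝ) := by
    rintro rfl
    exact hz (Complex.ofReal_im _)
  rw [samplingTerm_eq_mul_dslope, dslope_of_ne _ hzl, slope_def_field, l.2, sub_zero]
  ring

lemma exists_summable_norm_samplingTerm_le (hh : MemLp h 2 R.vol) (hy : y ∈ Set.Icc R.a R.b)
    {K : Set ℂ} (hK : IsCompact K) :
    ∃ u : R.Eigenvalue → ℝ, Summable u ∧ ∀ l, ∀ z ∈ K, ‖samplingTerm y h l z‖ ≤ u l := by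
  obtain ⟨M, hM⟩ := exists_norm_dslope_mul_le (differentiable_wronskian (R := R)) hK Complex.I
  have hI : Complex.I.im ≠ 0 := by rw [Complex.I_im]; exact one_ne_zero
  refine ⟨fun l => M * (‖samplingCoeff y h l‖ / ‖Complex.I - (l : ℝ)‖),
    (summable_norm_samplingCoeff_div hh hI hy).mul_left M, fun l z hz => ?_⟩
  have hpos : 0 < ‖Complex.I - ((l : ℝ) : ℂ)‖ := by
    rw [norm_pos_iff, sub_ne_zero]
    exact fun h => hI (h ▸ Complex.ofReal_im _)
  beta_reduce
  rw [← mul_div_assoc, le_div_iff₀ hpos, samplingTerm_eq_mul_dslope, norm_mul, mul_assoc, mul_comm]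
  exact mul_le_mul_of_nonneg_right (hM z hz _ l.2) (norm_nonneg _)

lemma summable_norm_samplingTerm (hh : MemLp h 2 R.vol) (hy : y ∈ Set.Icc R.a R.b) (z : ℂ) :
    Summable fun l => ‖samplingTerm (R := R) y h l z‖ := by
  obtain ⟨u, hu, hle⟩ :=
    exists_summable_norm_samplingTerm_le hh hy (isCompact_singleton (x := z))
  exact hu.of_nonneg_of_le (fun _ => norm_nonneg _) fun l => hle l z rfl

lemma differentiable_tsum_samplingTerm (hh : MemLp h 2 R.vol) (hy : y ∈ Set.Icc R.a R.b) :
    Differentiable ℂ fun z => ∑' l, samplingTerm (R := R) y h l z := by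
  intro z
  obtain ⟨u, hu, hle⟩ :=
    exists_summable_norm_samplingTerm_le hh hy (isCompact_closedBall z 1)
  have hterm : ∀ l : R.Eigenvalue, Differentiable ℂ (samplingTerm y h l) := fun l => by
    rw [funext (samplingTerm_eq_mul_dslope l)]
    exact (differentiable_dslope differentiable_wronskian _).const_mul _
  exact (Complex.differentiableOn_tsum_of_summable_norm hu (fun l => (hterm l).differentiableOn)
    Metric.isOpen_ball fun l w hw => hle l w (Metric.ball_subset_closedBall hw)).differentiableAt
    (Metric.ball_mem_nhds z one_pos)

lemma tsum_samplingTerm_eigenvalue (l : R.Eigenvalue) :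
    ∑' m, samplingTerm (R := R) y h m (l : ℝ) = R.transform y h (l : ℝ) := by
  rw [tsum_eq_single l fun m hm => ?_, samplingTerm, samplingFun, if_pos rfl, mul_one]
  have hne : ((l : ℝ) : ℂ) ≠ (m : ℝ) :=
    fun h => hm (Subtype.ext (Complex.ofReal_injective h.symm))
  rw [samplingTerm, samplingFun, if_neg hne, l.2, zero_div, mul_zero]

lemma exists_transform_sub_tsum_eq_mul (hh : MemLp h 2 R.vol) (hy : y ∈ Set.Icc R.a R.b) :
    ∃ H : ℂ → ℂ, Differentiable ℂ H ∧ ∀ z,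
      R.transform y h z - ∑' l, samplingTerm (R := R) y h l z = H z * R.wronskian z := by
  refine exists_eq_mul_of_simple_zeros
    ((differentiable_transform hy (intervalIntegrable_of_memLp hh)).sub
      (differentiable_tsum_samplingTerm hh hy)) differentiable_wronskian fun c hc => ?_
  obtain ⟨l, rfl⟩ : ∃ l : ℝ, (l : ℂ) = c :=
    ⟨c.re, Complex.ext rfl (im_eq_zero_of_wronskian_eq_zero hc).symm⟩
  exact ⟨sub_eq_zero.2 (tsum_samplingTerm_eigenvalue ⟨l, hc⟩).symm, deriv_wronskian_ne_zero hc⟩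

lemma norm_tsum_samplingCoeff_div_le (hh : MemLp h 2 R.vol) (hz : z.im ≠ 0)
    (hy : y ∈ Set.Icc R.a R.b) :
    ‖∑' l : R.Eigenvalue, samplingCoeff y h l / (z - (l : ℝ))‖ ≤
      √(R.glueNormSq z y (R.chi z y / R.wronskian z) (R.psi z y / R.wronskian z)) *
        ‖dualVec hh‖ := by
  have hsum : Summable fun l : R.Eigenvalue => ‖samplingCoeff y h l / (z - (l : ℝ))‖ := by
    simp_rw [norm_div]
    exact summable_norm_samplingCoeff_div hh hz hy
  refine (norm_tsum_le_tsum_norm hsum).trans (hsum.tsum_le_of_sum_le fun s => ?_)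
  simp_rw [norm_div]
  exact sum_norm_samplingCoeff_div_le hh hz hy s

lemma norm_le_of_transform_sub_tsum_eq (hh : MemLp h 2 R.vol) (hz : z.im ≠ 0)
    (hy : y ∈ Set.Icc R.a R.b) {w : ℂ}
    (hw : R.transform y h z - ∑' l, samplingTerm (R := R) y h l z = w * R.wronskian z) :
    ‖w‖ ≤ 2 * ‖dualVec hh‖ *
      √(R.glueNormSq z y (R.chi z y / R.wronskian z) (R.psi z y / R.wronskian z)) := by
  have hne := wronskian_ne_zero_of_im_ne_zero (R := R) hz
  have hdiff : w = (∫ x in R.a..R.b,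
      R.glue z y (R.chi z y / R.wronskian z) (R.psi z y / R.wronskian z) x * h x) -
      ∑' l : R.Eigenvalue, samplingCoeff y h l / (z - (l : ℝ)) := by
    refine mul_right_cancel₀ hne ?_
    simp_rw [← hw, transform_eq_wronskian_mul hne, samplingTerm_of_im_ne_zero _ hz, tsum_mul_left]
    ring
  rw [hdiff]
  linarith [norm_sub_le (∫ x in R.a..R.b,
    R.glue z y (R.chi z y / R.wronskian z) (R.psi z y / R.wronskian z) x * h x)
    (∑' l : R.Eigenvalue, samplingCoeff y h l / (z - (l : ℝ))),
    norm_integral_glue_mul_le hh (isGlued_green hne hy), norm_tsum_samplingCoeff_div_le hh hz hy]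

lemma tsum_samplingTerm (hh : MemLp h 2 R.vol) (hy : y ∈ Set.Icc R.a R.b) (z : ℂ) :
    ∑' l, samplingTerm (R := R) y h l z = R.transform y h z := by
  obtain ⟨H, hH, hmul⟩ := exists_transform_sub_tsum_eq_mul hh hy
  obtain ⟨C, hC0, hC⟩ := exists_sqrt_glueNormSq_green_le (R := R)
  set K := 2 * ‖dualVec hh‖ * C
  have hK : 0 ≤ K := by positivity
  have hbound : ∀ w, ‖H w‖ * |w.im| ≤ K + K * √‖w‖ := by
    intro w
    rcases eq_or_ne w.im 0 with hw | hw
    · rw [hw, abs_zero, mul_zero]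
      exact add_nonneg hK (mul_nonneg hK (Real.sqrt_nonneg _))
    calc ‖H w‖ * |w.im|
        ≤ 2 * ‖dualVec hh‖ * √(R.glueNormSq w y (R.chi w y / R.wronskian w)
            (R.psi w y / R.wronskian w)) * |w.im| := by
          gcongr
          exact norm_le_of_transform_sub_tsum_eq hh hw hy (hmul w)
      _ ≤ 2 * ‖dualVec hh‖ * (C * (1 + √‖w‖)) := by
          rw [mul_assoc (2 * ‖dualVec hh‖)]
          exact mul_le_mul_of_nonneg_left (hC hw hy) (by positivity)
      _ = K + K * √‖w‖ := by ring
  have hzero := eq_zero_of_norm_mul_abs_im_le hH (tendsto_add_mul_sqrt_div_atTop K K) hbound z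
  refine (sub_eq_zero.1 ?_).symm
  rw [hmul, hzero, zero_mul]

lemma hasSum_samplingTerm (hh : MemLp h 2 R.vol) (hy : y ∈ Set.Icc R.a R.b) (z : ℂ) :
    HasSum (fun l => samplingTerm (R := R) y h l z) (R.transform y h z) :=
  tsum_samplingTerm hh hy z ▸ (summable_norm_samplingTerm hh hy z).of_norm.hasSum

end Sampling

section Infinite

lemma IsGlued.eq_zero_of_hasDerivAt {A B s c : ℂ} (hg : R.IsGlued z y A B s)
    (hy : y ∈ Set.Ioo R.a R.b \ R.S) (hd : HasDerivAt (R.glue z y A B) c y) : s = 0 := by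
  have hnhds := Icc_mem_nhds hy.1.1 hy.1.2
  have hyS : y ∈ Set.Icc R.a R.b \ R.S := ⟨hg.mem, hy.2⟩
  have hleft : HasDerivWithinAt (R.glue z y A B) (A * R.psi' z y) (Set.Iic y) y :=
    (((isSol_psi z).deriv y hyS).hasDerivAt hnhds).const_mul A |>.hasDerivWithinAt.congr
      (fun x hx => if_pos hx) (if_pos le_rfl)
  have hright : HasDerivWithinAt (R.glue z y A B) (B * R.chi' z y) (Set.Ici y) y := by
    refine (((isSol_chi z).deriv y hyS).hasDerivAt hnhds).const_mul B |>.hasDerivWithinAt.congr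
      (fun x hx => ?_) ((if_pos le_rfl).trans hg.eq)
    rcases (Set.mem_Ici.1 hx).eq_or_lt with rfl | hlt
    · exact (if_pos le_rfl).trans hg.eq
    · exact if_neg hlt.not_ge
  rw [← hg.jump, ← (uniqueDiffWithinAt_Iic y).eq_deriv _ hd.hasDerivWithinAt hleft,
    ← (uniqueDiffWithinAt_Ici y).eq_deriv _ hd.hasDerivWithinAt hright, sub_self]

lemma exists_samplingCoeff_div_eq_mul_integral (hy : y ∈ Set.Icc R.a R.b) (z : ℂ) :
    ∃ d : R.Eigenvalue → ℂ, ∀ (h : ℝ → ℂ) (l : R.Eigenvalue),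
      samplingCoeff y h l / (z - (l : ℝ)) = d l * ∫ x in R.a..R.b, R.psi (l : ℝ) x * h x := by
  refine ⟨fun l => R.psi (l : ℝ) y / ratio l / deriv R.wronskian (l : ℝ) / (z - (l : ℝ)),
    fun h l => ?_⟩
  rw [samplingCoeff, ← mul_div_cancel_left₀ (R.transform y h (l : ℝ)) (ratio_ne_zero l),
    ratio_mul_transform hy]
  ring

lemma exists_glue_green_eq_sum [Fintype R.Eigenvalue] (hy : y ∈ Set.Icc R.a R.b)
    (hz : z.im ≠ 0) : ∃ d : R.Eigenvalue → ℂ, ∀ x ∈ Set.Icc R.a R.b,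
      R.glue z y (R.chi z y / R.wronskian z) (R.psi z y / R.wronskian z) x =
        ∑ l, d l * R.psi (l : ℝ) x := by
  have hw := wronskian_ne_zero_of_im_ne_zero (R := R) hz
  have hgreen := (isGlued_green hw hy).continuous_glue
  set G := R.glue z y (R.chi z y / R.wronskian z) (R.psi z y / R.wronskian z)
  obtain ⟨d, hd⟩ := exists_samplingCoeff_div_eq_mul_integral hy z
  have hterm : ∀ l : R.Eigenvalue, Continuous fun x => d l * R.psi (l : ℝ) x :=
    fun l => continuous_const.mul (continuous_psi _)
  have hsum : Continuous fun x => ∑ l : R.Eigenvalue, d l * R.psi (l : ℝ) x :=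
    continuous_finsetSum _ fun l _ => hterm l
  have horth : ∀ h : ℝ → ℂ, Continuous h →
      ∫ x in R.a..R.b, (G x - ∑ l, d l * R.psi (l : ℝ) x) * h x = 0 := by
    intro h hh
    have hseries := (hasSum_samplingTerm (memLp_of_continuous hh) hy z).unique (hasSum_fintype _)
    simp_rw [samplingTerm_of_im_ne_zero _ hz] at hseries
    rw [transform_eq_wronskian_mul hw, ← Finset.mul_sum] at hseries
    have hGh : IntervalIntegrable (fun x => G x * h x) volume R.a R.b :=
      (hgreen.mul hh).intervalIntegrable _ _
    have hsumh : IntervalIntegrable (fun x => (∑ l : R.Eigenvalue, d l * R.psi (l : ℝ) x) * h x)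
        volume R.a R.b := (hsum.mul hh).intervalIntegrable _ _
    simp_rw [sub_mul]
    rw [intervalIntegral.integral_sub hGh hsumh, mul_left_cancel₀ hw hseries, sub_eq_zero]
    simp_rw [Finset.sum_mul]
    have hlh : ∀ l, IntervalIntegrable (fun x => d l * R.psi (l : ℝ) x * h x) volume R.a R.b :=
      fun l => ((hterm l).mul hh).intervalIntegrable _ _
    rw [intervalIntegral.integral_finsetSum fun l _ => hlh l]
    refine Finset.sum_congr rfl fun l _ => ?_
    rw [hd, ← intervalIntegral.integral_const_mul]
    simp_rw [mul_assoc]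
  have hsub : Continuous fun x => G x - ∑ l : R.Eigenvalue, d l * R.psi (l : ℝ) x :=
    hgreen.sub hsum
  exact ⟨d, fun x hx => sub_eq_zero.1 (eq_zero_of_integral_mul_conj_eq_zero R.a_lt_b hsub
    (horth _ (Complex.continuous_conj.comp hsub)) hx)⟩

-- Otherwise Green's function would be a combination of eigenfunctions, hence smooth at `y`.
lemma infinite_eigenvalue : Infinite R.Eigenvalue := by
  rw [← not_finite_iff_infinite]
  intro hfin
  have := Fintype.ofFinite R.Eigenvalue
  have hI : Complex.I.im ≠ 0 := by rw [Complex.I_im]; exact one_ne_zero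
  obtain ⟨y, hyS, hyI⟩ := (R.countable.dense_compl ℝ).exists_mem_open isOpen_Ioo
    (Set.nonempty_Ioo.2 R.a_lt_b)
  have hy := Set.Ioo_subset_Icc_self hyI
  have hnhds := Icc_mem_nhds hyI.1 hyI.2
  obtain ⟨d, hd⟩ := exists_glue_green_eq_sum (R := R) hy hI
  have hderiv : HasDerivAt (fun x => ∑ l : R.Eigenvalue, d l * R.psi (l : ℝ) x)
      (∑ l : R.Eigenvalue, d l * R.psi' (l : ℝ) y) y :=
    HasDerivAt.fun_sum fun l _ => (((isSol_psi _).deriv y ⟨hy, hyS⟩).hasDerivAt hnhds).const_mul _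
  exact one_ne_zero ((isGlued_green (wronskian_ne_zero_of_im_ne_zero hI) hy).eq_zero_of_hasDerivAt
    ⟨hyI, hyS⟩ (hderiv.congr_of_eventuallyEq (eventually_of_mem hnhds hd)))

end Infinite

end RegularSL

lemma norm_sq_mul_add_le {s : ℂ} (hs : 1 ≤ ‖s‖) (c d : ℝ) :
    ‖s ^ 2 * (c : ℂ) + d‖ ≤ ‖s‖ ^ 2 * (|c| + |d|) := by
  calc ‖s ^ 2 * (c : ℂ) + d‖ ≤ ‖s‖ ^ 2 * |c| + |d| := by
        refine (norm_add_le _ _).trans_eq ?_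
        rw [norm_mul, norm_pow, Complex.norm_real, Complex.norm_real, Real.norm_eq_abs,
          Real.norm_eq_abs]
    _ ≤ ‖s‖ ^ 2 * |c| + ‖s‖ ^ 2 * |d| := by
        gcongr
        exact le_mul_of_one_le_left (abs_nonneg d) (one_le_pow₀ hs)
    _ = ‖s‖ ^ 2 * (|c| + |d|) := (mul_add _ _ _).symm

namespace RegularSL

variable {R : RegularSL} {s : ℂ} {x y : ℝ}

lemma norm_psi_le (hs : 1 ≤ ‖s‖) (hx : x ∈ Set.Icc R.a R.b) :
    ‖R.psi (s ^ 2) x‖ ≤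
      (|R.β₁| + |R.β₂|) * ‖s‖ * Real.exp ((‖s‖ + R.bound) * (x - R.a)) ∧
    ‖R.psi' (s ^ 2) x‖ ≤
      (|R.β₁| + |R.β₂|) * ‖s‖ * Real.exp ((‖s‖ + R.bound) * (x - R.a)) := by
  refine (isSol_psi (s ^ 2)).norm_le hs hx ?_
  rw [psi_left, psi'_left, norm_neg, Complex.norm_real, Complex.norm_real, Real.norm_eq_abs,
    Real.norm_eq_abs]
  nlinarith [abs_nonneg R.β₁]

lemma norm_chi_le (hs : 1 ≤ ‖s‖) (hx : x ∈ Set.Icc R.a R.b) :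
    ‖R.chi (s ^ 2) x‖ ≤ (|R.α₁| + |R.α₂| + |R.α₁'| + |R.α₂'|) * ‖s‖ ^ 3 *
      Real.exp ((‖s‖ + R.bound) * (R.b - x)) ∧
    ‖R.chi' (s ^ 2) x‖ ≤ (|R.α₁| + |R.α₂| + |R.α₁'| + |R.α₂'|) * ‖s‖ ^ 3 *
      Real.exp ((‖s‖ + R.bound) * (R.b - x)) := by
  refine (isSol_chi (s ^ 2)).norm_le_of_right hs hx ?_
  have hpow : ‖s‖ ^ 2 ≤ ‖s‖ ^ 3 := pow_le_pow_right₀ hs (by norm_num)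
  rw [chi_right, chi'_right]
  calc ‖s‖ * ‖s ^ 2 * (R.α₂' : ℂ) + R.α₂‖ + ‖s ^ 2 * (R.α₁' : ℂ) + R.α₁‖
      ≤ ‖s‖ * (‖s‖ ^ 2 * (|R.α₂'| + |R.α₂|)) + ‖s‖ ^ 2 * (|R.α₁'| + |R.α₁|) := by
        gcongr <;> exact norm_sq_mul_add_le hs _ _
    _ ≤ ‖s‖ * (‖s‖ ^ 2 * (|R.α₂'| + |R.α₂|)) + ‖s‖ ^ 3 * (|R.α₁'| + |R.α₁|) := by gcongr
    _ = (|R.α₁| + |R.α₂| + |R.α₁'| + |R.α₂'|) * ‖s‖ ^ 3 := by ring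

variable (R) in
/-- The constant in the growth bounds for the Wronskian and Green's function; the exponential comes
from bounding `exp ((‖s‖ + R.bound) * (R.b - R.a))` by a multiple of `exp (‖s‖ * (R.b - R.a))`. -/
def growthConst : ℝ := (|R.β₁| + |R.β₂|) * (|R.α₁| + |R.α₂| + |R.α₁'| + |R.α₂'|) *
  Real.exp (R.bound * (R.b - R.a))

lemma mul_le_growthConst {u v : ℝ} (hxy : x ≤ y) (hu0 : 0 ≤ u)
    (hu : u ≤ (|R.β₁| + |R.β₂|) * ‖s‖ * Real.exp ((‖s‖ + R.bound) * (x - R.a)))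
    (hv : v ≤ (|R.α₁| + |R.α₂| + |R.α₁'| + |R.α₂'|) * ‖s‖ ^ 3 *
      Real.exp ((‖s‖ + R.bound) * (R.b - y))) :
    u * v ≤ R.growthConst * ‖s‖ ^ 4 * Real.exp ((R.b - R.a) * ‖s‖) := by
  set B := |R.β₁| + |R.β₂|
  set A := |R.α₁| + |R.α₂| + |R.α₁'| + |R.α₂'|
  have hbound := R.bound_nonneg
  have hexponent : (‖s‖ + R.bound) * (x - R.a) + (‖s‖ + R.bound) * (R.b - y) ≤
      R.bound * (R.b - R.a) + (R.b - R.a) * ‖s‖ := by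
    nlinarith [norm_nonneg s]
  calc u * v
      ≤ (B * ‖s‖ * Real.exp ((‖s‖ + R.bound) * (x - R.a))) *
          (A * ‖s‖ ^ 3 * Real.exp ((‖s‖ + R.bound) * (R.b - y))) :=
        mul_le_mul_of_nonneg hu hv hu0 (by positivity)
    _ = B * A * ‖s‖ ^ 4 *
          Real.exp ((‖s‖ + R.bound) * (x - R.a) + (‖s‖ + R.bound) * (R.b - y)) := by
        rw [Real.exp_add]
        ring
    _ ≤ B * A * ‖s‖ ^ 4 * Real.exp (R.bound * (R.b - R.a) + (R.b - R.a) * ‖s‖) := by gcongr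
    _ = R.growthConst * ‖s‖ ^ 4 * Real.exp ((R.b - R.a) * ‖s‖) := by
        rw [Real.exp_add, growthConst]
        ring

lemma norm_glue_chi_psi_le (hs : 1 ≤ ‖s‖) (hx : x ∈ Set.Icc R.a R.b) (hy : y ∈ Set.Icc R.a R.b) :
    ‖R.glue (s ^ 2) y (R.chi (s ^ 2) y) (R.psi (s ^ 2) y) x‖ ≤
      R.growthConst * ‖s‖ ^ 4 * Real.exp ((R.b - R.a) * ‖s‖) := by
  rw [glue]
  split_ifs with hxy
  · rw [norm_mul, mul_comm]
    exact mul_le_growthConst hxy (norm_nonneg _) (norm_psi_le hs hx).1 (norm_chi_le hs hy).1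
  · rw [norm_mul]
    exact mul_le_growthConst (not_le.1 hxy).le (norm_nonneg _) (norm_psi_le hs hy).1
      (norm_chi_le hs hx).1

lemma norm_transform_le (hs : 1 ≤ ‖s‖) (hy : y ∈ Set.Icc R.a R.b) {h : ℝ → ℂ}
    (hh : IntervalIntegrable h volume R.a R.b) :
    ‖R.transform y h (s ^ 2)‖ ≤ (R.growthConst * ∫ x in R.a..R.b, ‖h x‖) * ‖s‖ ^ 4 *
      Real.exp ((R.b - R.a) * ‖s‖) := by
  calc ‖R.transform y h (s ^ 2)‖
      ≤ ∫ x in R.a..R.b,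
          (R.growthConst * ‖s‖ ^ 4 * Real.exp ((R.b - R.a) * ‖s‖)) * ‖h x‖ := by
        refine intervalIntegral.norm_integral_le_of_norm_le R.a_le_b
          (Eventually.of_forall fun x hx => ?_) (hh.norm.const_mul _)
        rw [norm_mul]
        exact mul_le_mul_of_nonneg_right (norm_glue_chi_psi_le hs ⟨hx.1.le, hx.2⟩ hy)
          (norm_nonneg _)
    _ = (R.growthConst * ∫ x in R.a..R.b, ‖h x‖) * ‖s‖ ^ 4 * Real.exp ((R.b - R.a) * ‖s‖) := by
        rw [intervalIntegral.integral_const_mul]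
        ring

lemma norm_wronskian_le (hs : 1 ≤ ‖s‖) :
    ‖R.wronskian (s ^ 2)‖ ≤ (2 * R.growthConst) * ‖s‖ ^ 4 * Real.exp ((R.b - R.a) * ‖s‖) := by
  have hpsi := norm_psi_le hs (R.left_mem)
  have hchi := norm_chi_le hs (R.left_mem)
  have hfirst := mul_le_growthConst le_rfl (norm_nonneg _) hpsi.1 hchi.2
  have hsecond := mul_le_growthConst le_rfl (norm_nonneg _) hpsi.2 hchi.1
  rw [← norm_mul] at hfirst hsecond
  rw [wronskian]
  linarith [norm_sub_le (R.psi (s ^ 2) R.a * R.chi' (s ^ 2) R.a)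
    (R.psi' (s ^ 2) R.a * R.chi (s ^ 2) R.a)]

lemma entireOfExpType_transform (hy : y ∈ Set.Icc R.a R.b) {h : ℝ → ℂ}
    (hh : IntervalIntegrable h volume R.a R.b) :
    EntireOfExpType (R.b - R.a) (R.transform y h) ∧
      EntireOfExpType (R.b - R.a) fun s => R.transform y h (s ^ 2) :=
  entireOfExpType_of_sq_growth (differentiable_transform hy hh) (sub_nonneg.2 R.a_le_b)
    fun _ hs => norm_transform_le hs hy hh

lemma exists_norm_wronskian_sq_le :
    ∃ C c : ℝ, ∀ s : ℂ, ‖R.wronskian (s ^ 2)‖ ≤ C * Real.exp (c * ‖s‖) := by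
  obtain ⟨C, -, hC⟩ := exists_sq_growth_bound (differentiable_wronskian (R := R))
    (fun s hs => norm_wronskian_le hs) (sub_nonneg.2 R.a_le_b) one_pos
  exact ⟨C, _, hC⟩

lemma eventually_wronskian_ne_zero (z : ℂ) : ∀ᶠ w in 𝓝[≠] z, R.wronskian w ≠ 0 := by
  by_contra hfreq
  have hzero := (differentiable_wronskian (R := R)).differentiableOn.analyticOnNhd isOpen_univ
    |>.eqOn_zero_of_preconnected_of_frequently_eq_zero isPreconnected_univ (Set.mem_univ z)
      (by simpa only [Filter.not_eventually, not_not] using hfreq)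
  exact wronskian_ne_zero_of_im_ne_zero (R := R) (z := Complex.I) (by simp)
    (hzero (Set.mem_univ _))

lemma finite_zeros_inter_Iic (r : ℝ) : ({l : ℝ | R.wronskian l = 0} ∩ Set.Iic r).Finite := by
  obtain ⟨C, hC⟩ := exists_le_re_of_wronskian_eq_zero (R := R)
  by_contra hinf
  have hsub : {l : ℝ | R.wronskian l = 0} ∩ Set.Iic r ⊆ Set.Icc (-C) r := fun l hl =>
    ⟨by simpa using hC l hl.1, hl.2⟩
  obtain ⟨x, -, hx⟩ := Set.Infinite.exists_accPt_of_subset_isCompact hinf isCompact_Icc hsub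
  rw [accPt_iff_frequently_nhdsNE] at hx
  have hcoe : Tendsto (fun l : ℝ => (l : ℂ)) (𝓝[≠] x) (𝓝[≠] (x : ℂ)) :=
    Complex.continuous_ofReal.continuousWithinAt.tendsto_nhdsWithin fun _ hl =>
      Complex.ofReal_injective.ne hl
  have hfreq := hcoe.frequently (p := fun z => R.wronskian z = 0) (hx.mono fun l hl => hl.1)
  exact hfreq (eventually_wronskian_ne_zero _)

variable (R) in
lemma exists_eigenvalue_enumeration :
    ∃ e : ℕ ≃ R.Eigenvalue, StrictMono (fun n => (e n : ℝ)) ∧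
      Tendsto (fun n => (e n : ℝ)) atTop atTop ∧
      ∀ z : ℂ, R.wronskian z = 0 ↔ ∃ n, z = ((e n : ℝ) : ℂ) := by
  obtain ⟨e, he⟩ := exists_strictMono_enumeration
    (Set.infinite_coe_iff.1 (infinite_eigenvalue (R := R))) finite_zeros_inter_Iic
  refine ⟨e, he, tendsto_atTop_of_enumeration finite_zeros_inter_Iic he fun n => (e n).2,
    fun z => ⟨fun hz => ?_, fun ⟨n, hn⟩ => hn ▸ (e n).2⟩⟩
  have hre : ((z.re : ℝ) : ℂ) = z := Complex.ext rfl (im_eq_zero_of_wronskian_eq_zero hz).symm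
  obtain ⟨n, hn⟩ := e.surjective ⟨z.re, hre.symm ▸ hz⟩
  exact ⟨n, by rw [hn, hre]⟩

lemma exists_canonicalProduct {lam : ℕ → ℝ} (hmono : StrictMono lam)
    (htop : Tendsto lam atTop atTop)
    (hzeros : ∀ z : ℂ, R.wronskian z = 0 ↔ ∃ n, z = (lam n : ℂ)) :
    (∀ z : ℂ, Multipliable (canonicalFactor lam z)) ∧
      ∃ c : ℂ, c ≠ 0 ∧ ∀ z, R.wronskian z = c * canonicalProduct lam z := by
  obtain ⟨C, c, hgrowth⟩ := exists_norm_wronskian_sq_le (R := R)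
  exact exists_eq_mul_canonicalProduct differentiable_wronskian hmono htop hzeros
    (fun n => deriv_wronskian_ne_zero ((hzeros _).2 ⟨n, rfl⟩)) hgrowth

end RegularSL

namespace SLProblem

variable (P : SLProblem)

lemma a_lt_θm : P.a < P.θm := by
  rw [θm]
  linarith [P.ε_lt]

lemma θm_lt_θp : P.θm < P.θp := by
  rw [θm, θp]
  linarith [P.ε_pos]

lemma θp_lt_b : P.θp < P.b := by
  rw [θp]
  linarith [P.ε_lt]

lemma a_lt_b : P.a < P.b := P.a_lt_θm.trans (P.θm_lt_θp.trans P.θp_lt_b)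

lemma left_mem_I : P.a ∈ P.I := Or.inl (Or.inl ⟨le_rfl, P.a_lt_θm⟩)

lemma right_mem_I : P.b ∈ P.I := Or.inr ⟨P.θp_lt_b, le_rfl⟩

lemma measurableSet_I : MeasurableSet P.I :=
  (measurableSet_Ico.union measurableSet_Ioo).union measurableSet_Ioc

lemma I_eq : P.I = Set.Icc P.a P.b \ {P.θm, P.θp} := by
  have ham := P.a_lt_θm
  have hmp := P.θm_lt_θp
  have hpb := P.θp_lt_b
  ext x
  simp only [I, Set.mem_union, Set.mem_Ico, Set.mem_Ioo, Set.mem_Ioc, Set.mem_sdiff, Set.mem_Icc,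
    Set.mem_insert_iff, Set.mem_singleton_iff]
  grind

lemma closure_I : closure P.I = Set.Icc P.a P.b := by
  rw [I, closure_union, closure_union, closure_Ico P.a_lt_θm.ne, closure_Ioo P.θm_lt_θp.ne,
    closure_Ioc P.θp_lt_b.ne, Set.Icc_union_Icc_eq_Icc P.a_lt_θm.le P.θm_lt_θp.le,
    Set.Icc_union_Icc_eq_Icc (P.a_lt_θm.trans P.θm_lt_θp).le P.θp_lt_b.le]

variable {P} {x y : ℝ} {z : ℂ}

lemma I_subset_Icc : P.I ⊆ Set.Icc P.a P.b := P.closure_I ▸ subset_closure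

lemma I_mem_nhdsWithin (hx : x ∈ P.I) : P.I ∈ 𝓝[Set.Icc P.a P.b] x := by
  rw [I_eq] at hx ⊢
  exact inter_mem self_mem_nhdsWithin (mem_nhdsWithin_of_mem_nhds
    ((Set.toFinite {P.θm, P.θp}).isClosed.isOpen_compl.mem_nhds hx.2))

variable (P)

lemma continuousOn_q : ContinuousOn P.q P.I := by
  rintro x ((hx | hx) | hx)
  · refine (P.q_cont_left x hx).mono_of_mem_nhdsWithin ?_
    filter_upwards [self_mem_nhdsWithin, mem_nhdsWithin_of_mem_nhds (Iio_mem_nhds hx.2)]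
      with y hyI hyθ using ⟨(I_subset_Icc hyI).1, hyθ⟩
  · exact (P.q_cont_mid x hx).mono_of_mem_nhdsWithin
      (mem_nhdsWithin_of_mem_nhds (Ioo_mem_nhds hx.1 hx.2))
  · refine (P.q_cont_right x hx).mono_of_mem_nhdsWithin ?_
    filter_upwards [self_mem_nhdsWithin, mem_nhdsWithin_of_mem_nhds (Ioi_mem_nhds hx.1)]
      with y hyI hyθ using ⟨hyθ, (I_subset_Icc hyI).2⟩

lemma isBounded_image_q : Bornology.IsBounded (P.q '' P.I) := by
  obtain ⟨_, hm_left⟩ := P.q_lim₁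
  obtain ⟨_, hm_right⟩ := P.q_lim₂
  obtain ⟨_, hp_left⟩ := P.q_lim₃
  obtain ⟨_, hp_right⟩ := P.q_lim₄
  have ha : Tendsto P.q (𝓝[>] P.a) (𝓝 (P.q P.a)) :=
    (P.q_cont_left P.a ⟨le_rfl, P.a_lt_θm⟩).mono_left
      (nhdsWithin_le_of_mem (mem_of_superset (Ioo_mem_nhdsGT P.a_lt_θm) Set.Ioo_subset_Ico_self))
  have hb : Tendsto P.q (𝓝[<] P.b) (𝓝 (P.q P.b)) :=
    (P.q_cont_right P.b ⟨P.θp_lt_b, le_rfl⟩).mono_left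
      (nhdsWithin_le_of_mem (mem_of_superset (Ioo_mem_nhdsLT P.θp_lt_b) Set.Ioo_subset_Ioc_self))
  rw [I, ← Set.Ioo_insert_left P.a_lt_θm, ← Set.Ioo_insert_right P.θp_lt_b, Set.image_union,
    Set.image_union, Set.image_insert_eq, Set.image_insert_eq]
  exact (((isBounded_image_Ioo (P.q_cont_left.mono Set.Ioo_subset_Ico_self) ha hm_left).insert
    _).union (isBounded_image_Ioo P.q_cont_mid hm_right hp_left)).union
    ((isBounded_image_Ioo (P.q_cont_right.mono Set.Ioo_subset_Ioc_self) hp_right hb).insert _)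

lemma exists_abs_q_le : ∃ M, 0 < M ∧ ∀ x ∈ P.I, |P.q x| ≤ M := by
  obtain ⟨M, hM, hq⟩ := P.isBounded_image_q.exists_pos_norm_le
  exact ⟨M, hM, fun x hx => hq _ ⟨x, hx, rfl⟩⟩

/-- The Sturm-Liouville problem without transmission conditions that is obtained from `P` by
multiplying its solutions by `P.weight`. Its potential is `q`, with the value `0` off `I`. -/
def regular : RegularSL where
  a := P.a
  b := P.b
  bound := P.exists_abs_q_le.choose
  Q := P.I.indicator P.q
  S := {P.θm, P.θp}
  a_lt_b := P.a_lt_b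
  measurable := by
    classical
    rw [← Set.piecewise_eq_indicator]
    exact P.continuousOn_q.measurable_piecewise continuousOn_const P.measurableSet_I
  abs_le x := by
    obtain ⟨hpos, hle⟩ := P.exists_abs_q_le.choose_spec
    by_cases hx : x ∈ P.I
    · rw [Set.indicator_of_mem hx]
      exact hle x hx
    · rw [Set.indicator_of_notMem hx, abs_zero]
      exact hpos.le
  countable := (Set.toFinite _).countable
  continuousWithinAt x hx := by
    rw [← I_eq] at hx
    exact ((P.continuousOn_q x hx).congr (fun y hy => Set.indicator_of_mem hy _)
      (Set.indicator_of_mem hx _)).mono_of_mem_nhdsWithin (I_mem_nhdsWithin hx)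
  β₁ := P.β₁
  β₂ := P.β₂
  α₁ := P.α₁
  α₂ := P.α₂
  α₁' := P.α₁'
  α₂' := P.α₂'
  β_ne h := P.β_ne (by rw [h.1, h.2, abs_zero, add_zero])
  ρ_pos := P.ρ_pos

variable {P}

lemma regular_Q (hx : x ∈ P.I) : P.regular.Q x = P.q x := Set.indicator_of_mem hx _

lemma mem_regular_iff : x ∈ Set.Icc P.regular.a P.regular.b \ P.regular.S ↔ x ∈ P.I := by
  rw [I_eq]
  rfl

variable (P) in
lemma regular_psi_left (z : ℂ) : P.regular.psi z P.a = P.β₂ := RegularSL.psi_left z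

variable (P) in
lemma regular_psi'_left (z : ℂ) : P.regular.psi' z P.a = -P.β₁ := RegularSL.psi'_left z

variable (P) in
lemma regular_chi_right (z : ℂ) : P.regular.chi z P.b = z * P.α₂' + P.α₂ :=
  RegularSL.chi_right z

variable (P) in
lemma regular_chi'_right (z : ℂ) : P.regular.chi' z P.b = z * P.α₁' + P.α₁ :=
  RegularSL.chi'_right z

section Weight

variable (P) in
/-- The step function with the values `1`, `δ`, `γ` on the three subintervals: a solution that
satisfies the transmission conditions becomes continuous when multiplied by it. -/
def weight (x : ℝ) : ℂ := if x < P.θm then 1 else if x < P.θp then P.δ else P.γ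

lemma weight_of_lt (hx : x < P.θm) : P.weight x = 1 := if_pos hx

lemma weight_of_mem (hx : x ∈ Set.Ioo P.θm P.θp) : P.weight x = P.δ := by
  rw [weight, if_neg hx.1.not_gt, if_pos hx.2]

lemma weight_of_gt (hx : P.θp < x) : P.weight x = P.γ := by
  rw [weight, if_neg (P.θm_lt_θp.trans hx).not_gt, if_neg hx.not_gt]

lemma ofReal_δ_ne_zero : (P.δ : ℂ) ≠ 0 := Complex.ofReal_ne_zero.2 P.δ_ne

lemma ofReal_γ_ne_zero : (P.γ : ℂ) ≠ 0 := Complex.ofReal_ne_zero.2 P.γ_ne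

variable (P) in
lemma weight_ne_zero (x : ℝ) : P.weight x ≠ 0 := by
  rw [weight]
  split_ifs
  exacts [one_ne_zero, ofReal_δ_ne_zero, ofReal_γ_ne_zero]

variable (P) in
lemma weight_left : P.weight P.a = 1 := weight_of_lt P.a_lt_θm

variable (P) in
lemma weight_right : P.weight P.b = P.γ := weight_of_gt P.θp_lt_b

lemma weight_eventuallyEq (hx : x ∈ P.I) : P.weight =ᶠ[𝓝 x] fun _ => P.weight x := by
  rcases hx with (hx | hx) | hx
  · filter_upwards [Iio_mem_nhds hx.2] with y hy
    rw [weight_of_lt hx.2, weight_of_lt hy]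
  · filter_upwards [Ioo_mem_nhds hx.1 hx.2] with y hy
    rw [weight_of_mem hx, weight_of_mem hy]
  · filter_upwards [Ioi_mem_nhds hx.1] with y hy
    rw [weight_of_gt hx.1, weight_of_gt hy]

variable (P) in
lemma weight_eventuallyEq_nhdsLT_θm : P.weight =ᶠ[𝓝[<] P.θm] fun _ => 1 :=
  eventually_nhdsWithin_of_forall fun _ hy => weight_of_lt hy

variable (P) in
lemma weight_eventuallyEq_nhdsGT_θm : P.weight =ᶠ[𝓝[>] P.θm] fun _ => (P.δ : ℂ) := by
  filter_upwards [Ioo_mem_nhdsGT P.θm_lt_θp] with y hy using weight_of_mem hy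

variable (P) in
lemma weight_eventuallyEq_nhdsLT_θp : P.weight =ᶠ[𝓝[<] P.θp] fun _ => (P.δ : ℂ) := by
  filter_upwards [Ioo_mem_nhdsLT P.θm_lt_θp] with y hy using weight_of_mem hy

variable (P) in
lemma weight_eventuallyEq_nhdsGT_θp : P.weight =ᶠ[𝓝[>] P.θp] fun _ => (P.γ : ℂ) :=
  eventually_nhdsWithin_of_forall fun _ hy => weight_of_gt hy

lemma measurable_weight : Measurable P.weight :=
  Measurable.ite measurableSet_Iio measurable_const
    (Measurable.ite measurableSet_Iio measurable_const measurable_const)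

lemma apply_weight_le (f : ℂ → ℝ) (x : ℝ) :
    f (P.weight x) ≤ max (f 1) (max (f P.δ) (f P.γ)) := by
  rw [weight]
  split_ifs
  exacts [le_max_left _ _, (le_max_left _ _).trans (le_max_right _ _),
    (le_max_right _ _).trans (le_max_right _ _)]

end Weight

section Correspondence

variable {u u' v v' : ℝ → ℂ} {c d : ℂ}

lemma jumpCondition_div_weight_θm (hv : ContinuousAt v P.θm) :
    JumpCondition P.θm 1 P.δ fun x => v x / P.weight x := by
  refine ⟨v P.θm / 1, v P.θm / P.δ,
    ((hv.mono_left nhdsWithin_le_nhds).div_const 1).congr' ?_,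
    ((hv.mono_left nhdsWithin_le_nhds).div_const (P.δ : ℂ)).congr' ?_, ?_⟩
  · filter_upwards [P.weight_eventuallyEq_nhdsLT_θm] with x hx
    rw [hx]
  · filter_upwards [P.weight_eventuallyEq_nhdsGT_θm] with x hx
    rw [hx]
  · rw [one_mul, div_one, mul_div_cancel₀ _ ofReal_δ_ne_zero]

lemma jumpCondition_div_weight_θp (hv : ContinuousAt v P.θp) :
    JumpCondition P.θp P.δ P.γ fun x => v x / P.weight x := by
  refine ⟨v P.θp / P.δ, v P.θp / P.γ,
    ((hv.mono_left nhdsWithin_le_nhds).div_const (P.δ : ℂ)).congr' ?_,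
    ((hv.mono_left nhdsWithin_le_nhds).div_const (P.γ : ℂ)).congr' ?_, ?_⟩
  · filter_upwards [P.weight_eventuallyEq_nhdsLT_θp] with x hx
    rw [hx]
  · filter_upwards [P.weight_eventuallyEq_nhdsGT_θp] with x hx
    rw [hx]
  · rw [mul_div_cancel₀ _ ofReal_δ_ne_zero, mul_div_cancel₀ _ ofReal_γ_ne_zero]

lemma transmission_div_weight (hv : ContinuousOn v (Set.Icc P.a P.b))
    (hv' : ContinuousOn v' (Set.Icc P.a P.b)) :
    P.Transmission (fun x => v x / P.weight x) fun x => v' x / P.weight x := by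
  have hθm : Set.Icc P.a P.b ∈ 𝓝 P.θm := Icc_mem_nhds P.a_lt_θm (P.θm_lt_θp.trans P.θp_lt_b)
  have hθp : Set.Icc P.a P.b ∈ 𝓝 P.θp := Icc_mem_nhds (P.a_lt_θm.trans P.θm_lt_θp) P.θp_lt_b
  exact ⟨jumpCondition_div_weight_θm (hv.continuousAt hθm),
    jumpCondition_div_weight_θm (hv'.continuousAt hθm),
    jumpCondition_div_weight_θp (hv.continuousAt hθp),
    jumpCondition_div_weight_θp (hv'.continuousAt hθp)⟩

lemma hasDerivWithinAt_div_weight (hx : x ∈ P.I)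
    (hv : HasDerivWithinAt v d (Set.Icc P.a P.b) x) :
    HasDerivWithinAt (fun x => v x / P.weight x) (d / P.weight x) P.I x := by
  refine ((hv.mono I_subset_Icc).div_const (P.weight x)).congr_of_eventuallyEq ?_ rfl
  filter_upwards [mem_nhdsWithin_of_mem_nhds (weight_eventuallyEq hx)] with y hy
  rw [hy]

lemma hasDerivWithinAt_weight_mul (hx : x ∈ P.I) (hu : HasDerivWithinAt u d P.I x) :
    HasDerivWithinAt (fun x => P.weight x * u x) (P.weight x * d) P.I x := by
  refine (hu.const_mul (P.weight x)).congr_of_eventuallyEq ?_ rfl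
  filter_upwards [mem_nhdsWithin_of_mem_nhds (weight_eventuallyEq hx)] with y hy
  rw [hy]

lemma isSolution_div_weight (h : P.regular.IsSol z v v') :
    P.IsSolution z (fun x => v x / P.weight x) fun x => v' x / P.weight x := fun x hx => by
  refine ⟨hasDerivWithinAt_div_weight hx (h.deriv x (mem_regular_iff.2 hx)), ?_⟩
  rw [← mul_div_assoc, ← regular_Q hx]
  exact hasDerivWithinAt_div_weight hx (h.deriv' x (mem_regular_iff.2 hx))

lemma JumpCondition.exists_tendsto_mul {p : ℝ} {w : ℝ → ℂ} (h : JumpCondition p c d u)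
    (hc : w =ᶠ[𝓝[<] p] fun _ => c) (hd : w =ᶠ[𝓝[>] p] fun _ => d) :
    ∃ L, Tendsto (fun x => w x * u x) (𝓝[≠] p) (𝓝 L) := by
  obtain ⟨l, r, hl, hr, hlr⟩ := h
  have hleft : Tendsto (fun x => w x * u x) (𝓝[<] p) (𝓝 (c * l)) :=
    (hl.const_mul c).congr' (by filter_upwards [hc] with x hx; rw [hx])
  have hright : Tendsto (fun x => w x * u x) (𝓝[>] p) (𝓝 (c * l)) :=
    hlr ▸ (hr.const_mul d).congr' (by filter_upwards [hd] with x hx; rw [hx])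
  exact ⟨c * l, nhdsLT_sup_nhdsGT p ▸ hleft.sup hright⟩

lemma exists_continuousOn_eqOn_weight_mul (hu : ContinuousOn u P.I)
    (hm : JumpCondition P.θm 1 P.δ u) (hp : JumpCondition P.θp P.δ P.γ u) :
    ∃ v : ℝ → ℂ, ContinuousOn v (Set.Icc P.a P.b) ∧
      Set.EqOn v (fun x => P.weight x * u x) P.I := by
  have hI : ContinuousOn (fun x => P.weight x * u x) P.I := fun x hx =>
    ((continuousAt_const.congr (weight_eventuallyEq hx).symm).continuousWithinAt).mul (hu x hx)
  have hne : ∀ {p}, p ∉ P.I → 𝓝[P.I] p ≤ 𝓝[≠] p := fun hp =>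
    nhdsWithin_mono _ fun x hx => ne_of_mem_of_not_mem hx hp
  refine ⟨extendFrom P.I fun x => P.weight x * u x,
    continuousOn_extendFrom P.closure_I.ge fun x hx => ?_, extendFrom_extends hI⟩
  by_cases hxI : x ∈ P.I
  · exact ⟨_, hI x hxI⟩
  have hxθ : x = P.θm ∨ x = P.θp := by
    rw [I_eq] at hxI
    exact by_contra fun h => hxI ⟨hx, h⟩
  rcases hxθ with rfl | rfl
  · exact (hm.exists_tendsto_mul P.weight_eventuallyEq_nhdsLT_θm
      P.weight_eventuallyEq_nhdsGT_θm).imp fun _ h => h.mono_left (hne hxI)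
  · exact (hp.exists_tendsto_mul P.weight_eventuallyEq_nhdsLT_θp
      P.weight_eventuallyEq_nhdsGT_θp).imp fun _ h => h.mono_left (hne hxI)

lemma IsSolution.exists_isSol_eq_weight_mul (h : P.IsSolution z u u')
    (ht : P.Transmission u u') : ∃ v v' : ℝ → ℂ, P.regular.IsSol z v v' ∧
      (∀ x ∈ P.I, v x = P.weight x * u x) ∧ ∀ x ∈ P.I, v' x = P.weight x * u' x := by
  obtain ⟨htm, htm', htp, htp'⟩ := ht
  obtain ⟨v, hv, hvu⟩ := exists_continuousOn_eqOn_weight_mul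
    (fun x hx => (h x hx).1.continuousWithinAt) htm htp
  obtain ⟨v', hv', hvu'⟩ := exists_continuousOn_eqOn_weight_mul
    (fun x hx => (h x hx).2.continuousWithinAt) htm' htp'
  have hderiv : ∀ {w W : ℝ → ℂ} {d : ℂ} {x}, x ∈ P.I →
      Set.EqOn W (fun x => P.weight x * w x) P.I → HasDerivWithinAt w d P.I x →
      HasDerivWithinAt W (P.weight x * d) (Set.Icc P.a P.b) x := fun hx hW hw =>
    ((hasDerivWithinAt_weight_mul hx hw).congr hW (hW hx)).mono_of_mem_nhdsWithin
      (I_mem_nhdsWithin hx)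
  refine ⟨v, v', ⟨hv, hv', fun x hx => ?_, fun x hx => ?_⟩, fun x hx => hvu hx,
    fun x hx => hvu' hx⟩
  · rw [mem_regular_iff] at hx
    rw [hvu' hx]
    exact hderiv hx hvu (h x hx).1
  · rw [mem_regular_iff] at hx
    rw [hvu hx, regular_Q hx, mul_left_comm]
    exact hderiv hx hvu' (h x hx).2

lemma isPhi_phiPair (z : ℂ) : P.IsPhi z (P.phiPair z) := by
  have hψ := RegularSL.isSol_psi (R := P.regular) z
  refine Classical.epsilon_spec (p := P.IsPhi z)
    ⟨(fun x => P.regular.psi z x / P.weight x, fun x => P.regular.psi' z x / P.weight x),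
      isSolution_div_weight hψ, transmission_div_weight hψ.cont hψ.cont', ?_, ?_⟩
  · simp only [P.weight_left, P.regular_psi_left, div_one]
  · simp only [P.weight_left, P.regular_psi'_left, div_one]

lemma isChi_chiPair (z : ℂ) : P.IsChi z (P.chiPair z) := by
  have hχ := (RegularSL.isSol_chi (R := P.regular) z).const_mul (P.γ : ℂ)
  refine Classical.epsilon_spec (p := P.IsChi z)
    ⟨(fun x => P.γ * P.regular.chi z x / P.weight x,
      fun x => P.γ * P.regular.chi' z x / P.weight x),
      isSolution_div_weight hχ, transmission_div_weight hχ.cont hχ.cont', ?_, ?_⟩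
  · simp only [P.weight_right, P.regular_chi_right, mul_div_cancel_left₀ _ ofReal_γ_ne_zero]
  · simp only [P.weight_right, P.regular_chi'_right, mul_div_cancel_left₀ _ ofReal_γ_ne_zero]

lemma phi_eq (z : ℂ) (hx : x ∈ P.I) :
    P.phi z x = P.regular.psi z x / P.weight x ∧ P.phi' z x = P.regular.psi' z x / P.weight x := by
  obtain ⟨hφ, ht, hleft, hleft'⟩ := isPhi_phiPair (P := P) z
  obtain ⟨v, v', hv, hvφ, hvφ'⟩ := hφ.exists_isSol_eq_weight_mul ht
  have hva : v P.a = P.regular.psi z P.a := by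
    rw [hvφ _ P.left_mem_I, hleft, P.weight_left, one_mul, P.regular_psi_left]
  have hva' : v' P.a = P.regular.psi' z P.a := by
    rw [hvφ' _ P.left_mem_I, hleft', P.weight_left, one_mul, P.regular_psi'_left]
  obtain ⟨hvψ, hvψ'⟩ := hv.eq_of_left_eq (RegularSL.isSol_psi z) hva hva' (I_subset_Icc hx)
  rw [← hvψ, ← hvψ', hvφ x hx, hvφ' x hx, mul_div_cancel_left₀ _ (P.weight_ne_zero x),
    mul_div_cancel_left₀ _ (P.weight_ne_zero x)]
  exact ⟨rfl, rfl⟩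

lemma chi_eq (z : ℂ) (hx : x ∈ P.I) :
    P.chi z x = P.γ * P.regular.chi z x / P.weight x ∧
      P.chi' z x = P.γ * P.regular.chi' z x / P.weight x := by
  obtain ⟨hχ, ht, hright, hright'⟩ := isChi_chiPair (P := P) z
  obtain ⟨v, v', hv, hvχ, hvχ'⟩ := hχ.exists_isSol_eq_weight_mul ht
  have hvb : v P.b = P.γ * P.regular.chi z P.b := by
    rw [hvχ _ P.right_mem_I, hright, P.weight_right, P.regular_chi_right]
  have hvb' : v' P.b = P.γ * P.regular.chi' z P.b := by
    rw [hvχ' _ P.right_mem_I, hright', P.weight_right, P.regular_chi'_right]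
  obtain ⟨hvγ, hvγ'⟩ := hv.eq_of_right_eq ((RegularSL.isSol_chi z).const_mul (P.γ : ℂ)) hvb hvb'
    (I_subset_Icc hx)
  rw [← hvγ, ← hvγ', hvχ x hx, hvχ' x hx, mul_div_cancel_left₀ _ (P.weight_ne_zero x),
    mul_div_cancel_left₀ _ (P.weight_ne_zero x)]
  exact ⟨rfl, rfl⟩

lemma omega_eq (z : ℂ) : P.omega z = P.γ * P.regular.wronskian z := by
  obtain ⟨hφ, hφ'⟩ := phi_eq z P.left_mem_I
  obtain ⟨hχ, hχ'⟩ := chi_eq z P.left_mem_I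
  have hw : P.regular.wronskian z = P.regular.psi z P.a * P.regular.chi' z P.a -
    P.regular.psi' z P.a * P.regular.chi z P.a := rfl
  rw [omega, hφ, hφ', hχ, hχ', P.weight_left, hw]
  ring

lemma omega_eq_zero_iff : P.omega z = 0 ↔ P.regular.wronskian z = 0 := by
  rw [omega_eq, mul_eq_zero, or_iff_right ofReal_γ_ne_zero]

end Correspondence

section Green

variable {k : ℂ} {g : ℝ → ℂ}

variable (P) in
/-- The product of the Wronskian and Green's function of `P.regular`, an entire function of `z`. -/
def kernel (y x : ℝ) (z : ℂ) : ℂ :=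
  P.regular.glue z y (P.regular.chi z y) (P.regular.psi z y) x

lemma differentiable_kernel (y x : ℝ) : Differentiable ℂ (P.kernel y x) := by
  by_cases h : x ≤ y
  · have hk : P.kernel y x = fun z => P.regular.chi z y * P.regular.psi z x :=
      funext fun z => if_pos h
    exact hk ▸ (RegularSL.differentiable_chi y).mul (RegularSL.differentiable_psi x)
  · have hk : P.kernel y x = fun z => P.regular.psi z y * P.regular.chi z x :=
      funext fun z => if_neg h
    exact hk ▸ (RegularSL.differentiable_psi y).mul (RegularSL.differentiable_chi x)

lemma continuous_kernel (y : ℝ) (z : ℂ) : Continuous fun x => P.kernel y x z :=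
  Continuous.if_le (continuous_const.mul (RegularSL.continuous_psi z))
    (continuous_const.mul (RegularSL.continuous_chi z)) continuous_id continuous_const
    (fun x hx => by rw [hx]; exact mul_comm _ _)

lemma green_eq (hx : x ∈ P.I) (hy : y ∈ P.I) (z : ℂ) :
    P.green x y z = P.kernel y x z / (P.regular.wronskian z * (P.weight x * P.weight y)) := by
  have hk : P.kernel y x z = if y ≤ x then P.regular.psi z y * P.regular.chi z x
      else P.regular.chi z y * P.regular.psi z x := by
    rw [kernel, RegularSL.glue]
    rcases lt_trichotomy x y with h | rfl | h
    · rw [if_pos h.le, if_neg h.not_ge]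
    · rw [if_pos le_rfl, if_pos le_rfl, mul_comm]
    · rw [if_neg h.not_ge, if_pos h.le]
  have hγ := ofReal_γ_ne_zero (P := P)
  rw [green, hk, omega_eq, (phi_eq z hx).1, (phi_eq z hy).1, (chi_eq z hx).1, (chi_eq z hy).1]
  split_ifs <;> field_simp

lemma regGreen_eq (hx : x ∈ P.I) (hy : y ∈ P.I) (k z : ℂ) :
    P.regGreen (fun z => k * P.regular.wronskian z) y x z =
      k / (P.weight x * P.weight y) * P.kernel y x z := by
  refine Tendsto.limUnder_eq (Tendsto.congr' ?_
    ((((differentiable_kernel y x).continuous.tendsto z).mono_left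
      nhdsWithin_le_nhds).const_mul _))
  filter_upwards [RegularSL.eventually_wronskian_ne_zero z] with s hs
  rw [green_eq hx hy]
  field_simp

lemma differentiable_regGreen (hx : x ∈ P.I) (hy : y ∈ P.I) (k : ℂ) :
    Differentiable ℂ (P.regGreen (fun z => k * P.regular.wronskian z) y x) := by
  rw [funext (regGreen_eq hx hy k)]
  exact (differentiable_kernel y x).const_mul _

lemma regGreen_eq_mul_green (hx : x ∈ P.I) (hy : y ∈ P.I) (k : ℂ) (hz : P.omega z ≠ 0) :
    P.regGreen (fun z => k * P.regular.wronskian z) y x z =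
      k * P.regular.wronskian z * P.green x y z := by
  have hw : P.regular.wronskian z ≠ 0 := omega_eq_zero_iff.not.1 hz
  rw [regGreen_eq hx hy, green_eq hx hy]
  field_simp

variable (P) in
/-- The conjugate of `g` times the weight: up to a constant, its transform for `P.regular` is the
transform of `g` for `P`. -/
def weighted (g : ℝ → ℂ) (x : ℝ) : ℂ := P.weight x * starRingEnd ℂ (g x)

lemma memLp_weighted (hg : MemLp g 2 (volume.restrict (Set.Ioo P.a P.b))) :
    MemLp (P.weighted g) 2 P.regular.vol := by
  have hvol : P.regular.vol = volume.restrict (Set.Ioo P.a P.b) :=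
    (Measure.restrict_congr_set Ioo_ae_eq_Ioc).symm
  rw [hvol]
  refine hg.star.of_le_mul (c := max ‖(1 : ℂ)‖ (max ‖(P.δ : ℂ)‖ ‖(P.γ : ℂ)‖))
    (measurable_weight.aestronglyMeasurable.mul hg.star.1) (Eventually.of_forall fun x => ?_)
  rw [weighted, norm_mul]
  exact mul_le_mul_of_nonneg_right (apply_weight_le _ x) (norm_nonneg _)

lemma intervalIntegrable_kernel_mul_weighted
    (hg : MemLp g 2 (volume.restrict (Set.Ioo P.a P.b))) (y : ℝ) (z : ℂ) :
    IntervalIntegrable (fun x => P.kernel y x z * P.weighted g x) volume P.a P.b :=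
  (RegularSL.intervalIntegrable_of_memLp (memLp_weighted hg)).continuousOn_mul
    (continuous_kernel y z).continuousOn

lemma regGreen_mul_conj_eq (hx : x ∈ P.I) (hy : y ∈ P.I) (k z : ℂ) (g : ℝ → ℂ) :
    P.regGreen (fun z => k * P.regular.wronskian z) y x z * starRingEnd ℂ (g x) =
      k / P.weight y * ((P.weight x ^ 2)⁻¹ * (P.kernel y x z * P.weighted g x)) := by
  have hwx := P.weight_ne_zero x
  rw [regGreen_eq hx hy, weighted]
  field_simp

lemma integrableOn_regGreen_mul_conj (hy : y ∈ P.I)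
    (hg : MemLp g 2 (volume.restrict (Set.Ioo P.a P.b))) (k z : ℂ) :
    IntegrableOn (fun x => P.regGreen (fun z => k * P.regular.wronskian z) y x z *
      starRingEnd ℂ (g x)) (Set.Ioo P.a P.b) := by
  have hint : IntervalIntegrable (fun x => k / P.weight y * ((P.weight x ^ 2)⁻¹ *
      (P.kernel y x z * P.weighted g x))) volume P.a P.b :=
    (intervalIntegrable_bdd_mul (measurable_weight.pow_const 2).inv
      (apply_weight_le fun w => ‖(w ^ 2)⁻¹‖)
      (intervalIntegrable_kernel_mul_weighted hg y z)).const_mul (k / P.weight y)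
  rw [intervalIntegrable_iff_integrableOn_Ioo_of_le P.a_lt_b.le] at hint
  refine hint.congr ?_
  have hθ : ∀ᵐ x : ℝ, x ∉ ({P.θm, P.θp} : Set ℝ) := (Set.toFinite _).countable.ae_notMem volume
  filter_upwards [ae_restrict_of_ae hθ, ae_restrict_mem measurableSet_Ioo] with x hxθ hx
  exact (regGreen_mul_conj_eq (P.I_eq ▸ ⟨Set.Ioo_subset_Icc_self hx, hxθ⟩) hy k z g).symm

lemma sq_mul_integral_regGreen_mul_conj {c d : ℝ} {w : ℂ} (hcd : c ≤ d) (hw : w ≠ 0)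
    (hsub : Set.Ioo c d ⊆ P.I) (hwI : ∀ x ∈ Set.Ioo c d, P.weight x = w) (hy : y ∈ P.I) (k z : ℂ)
    (g : ℝ → ℂ) :
    w ^ 2 * (∫ x in c..d, P.regGreen (fun z => k * P.regular.wronskian z) y x z *
      starRingEnd ℂ (g x)) = k / P.weight y * ∫ x in c..d, P.kernel y x z * P.weighted g x := by
  rw [← intervalIntegral.integral_const_mul, ← intervalIntegral.integral_const_mul]
  refine intervalIntegral.integral_congr_Ioo_of_le hcd fun x hx => ?_
  simp only [regGreen_mul_conj_eq (hsub hx) hy, hwI x hx]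
  field_simp

lemma transform_eq (hy : y ∈ P.I) (hg : MemLp g 2 (volume.restrict (Set.Ioo P.a P.b)))
    (k z : ℂ) : P.transform (fun z => k * P.regular.wronskian z) y g z =
      k / P.weight y * P.regular.transform y (P.weighted g) z := by
  have ham := P.a_lt_θm.le
  have hmp := P.θm_lt_θp.le
  have hpb := P.θp_lt_b.le
  have hint {c d : ℝ} (hc : P.a ≤ c) (hcd : c ≤ d) (hd : d ≤ P.b) :
      IntervalIntegrable (fun x => P.kernel y x z * P.weighted g x) volume c d :=
    (intervalIntegrable_kernel_mul_weighted hg y z).mono_set (by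
      rw [Set.uIcc_of_le hcd, Set.uIcc_of_le (hc.trans (hcd.trans hd))]
      exact Set.Icc_subset_Icc hc hd)
  have hleft := sq_mul_integral_regGreen_mul_conj ham one_ne_zero
    (fun x hx => Or.inl (Or.inl ⟨hx.1.le, hx.2⟩)) (fun x hx => weight_of_lt hx.2) hy k z g
  have hmid := sq_mul_integral_regGreen_mul_conj hmp ofReal_δ_ne_zero
    (fun x hx => Or.inl (Or.inr hx)) (fun x hx => weight_of_mem hx) hy k z g
  have hright := sq_mul_integral_regGreen_mul_conj hpb ofReal_γ_ne_zero
    (fun x hx => Or.inr ⟨hx.1, hx.2.le⟩) (fun x hx => weight_of_gt hx.1) hy k z g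
  rw [one_pow, one_mul] at hleft
  rw [transform, hleft, hmid, hright, ← mul_add, ← mul_add,
    intervalIntegral.integral_add_adjacent_intervals (hint le_rfl ham (hmp.trans hpb))
      (hint ham hmp hpb),
    intervalIntegral.integral_add_adjacent_intervals (hint le_rfl (ham.trans hmp) hpb)
      (hint (ham.trans hmp) hpb le_rfl)]
  rfl

lemma entireOfExpType_transform (hy : y ∈ P.I)
    (hg : MemLp g 2 (volume.restrict (Set.Ioo P.a P.b))) (k : ℂ) :
    EntireOfExpType (P.b - P.a) (P.transform (fun z => k * P.regular.wronskian z) y g) ∧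
      EntireOfExpType (P.b - P.a)
        fun s => P.transform (fun z => k * P.regular.wronskian z) y g (s ^ 2) := by
  obtain ⟨hz, hs⟩ := RegularSL.entireOfExpType_transform (R := P.regular) (I_subset_Icc hy)
    (RegularSL.intervalIntegrable_of_memLp (memLp_weighted hg))
  simp only [funext (transform_eq hy hg k)]
  exact ⟨hz.const_mul _, hs.const_mul _⟩

end Green

section Sampling

variable {k : ℂ} {g : ℝ → ℂ}

lemma transform_mul_samplingFun (hk : k ≠ 0) (hy : y ∈ P.I)
    (hg : MemLp g 2 (volume.restrict (Set.Ioo P.a P.b))) (l : P.regular.Eigenvalue) (z : ℂ) :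
    P.transform (fun z => k * P.regular.wronskian z) y g (l : ℝ) *
      samplingFun (fun z => k * P.regular.wronskian z) (l : ℝ) z =
        k / P.weight y * RegularSL.samplingTerm y (P.weighted g) l z := by
  rw [transform_eq hy hg, samplingFun_const_mul hk, RegularSL.samplingTerm, mul_assoc]

variable (e : ℕ ≃ P.regular.Eigenvalue)

lemma exists_summable_norm_sampling_le (hk : k ≠ 0) (hy : y ∈ P.I)
    (hg : MemLp g 2 (volume.restrict (Set.Ioo P.a P.b))) {K : Set ℂ} (hK : IsCompact K) :
    ∃ u : ℕ → ℝ, Summable u ∧ ∀ n, ∀ z ∈ K,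
      ‖P.transform (fun z => k * P.regular.wronskian z) y g (e n : ℝ) *
        samplingFun (fun z => k * P.regular.wronskian z) (e n : ℝ) z‖ ≤ u n := by
  obtain ⟨u, hu, hle⟩ := RegularSL.exists_summable_norm_samplingTerm_le (memLp_weighted hg)
    (I_subset_Icc hy) hK
  refine ⟨fun n => ‖k / P.weight y‖ * u (e n), (e.summable_iff.2 hu).mul_left _, fun n z hz => ?_⟩
  rw [transform_mul_samplingFun hk hy hg, norm_mul]
  exact mul_le_mul_of_nonneg_left (hle _ z hz) (norm_nonneg _)

lemma summable_norm_sampling (hk : k ≠ 0) (hy : y ∈ P.I)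
    (hg : MemLp g 2 (volume.restrict (Set.Ioo P.a P.b))) (z : ℂ) :
    Summable fun n => ‖P.transform (fun z => k * P.regular.wronskian z) y g (e n : ℝ) *
      samplingFun (fun z => k * P.regular.wronskian z) (e n : ℝ) z‖ := by
  obtain ⟨u, hu, hle⟩ := exists_summable_norm_sampling_le e hk hy hg (isCompact_singleton (x := z))
  exact hu.of_nonneg_of_le (fun _ => norm_nonneg _) fun n => hle n z rfl

lemma hasSum_sampling (hk : k ≠ 0) (hy : y ∈ P.I)
    (hg : MemLp g 2 (volume.restrict (Set.Ioo P.a P.b))) (z : ℂ) :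
    HasSum (fun n => P.transform (fun z => k * P.regular.wronskian z) y g (e n : ℝ) *
      samplingFun (fun z => k * P.regular.wronskian z) (e n : ℝ) z)
      (P.transform (fun z => k * P.regular.wronskian z) y g z) := by
  simp only [transform_mul_samplingFun hk hy hg]
  rw [transform_eq hy hg]
  exact (e.hasSum_iff.2 (RegularSL.hasSum_samplingTerm (memLp_weighted hg)
    (I_subset_Icc hy) z)).mul_left _

lemma tendstoUniformlyOn_sampling (hk : k ≠ 0) (hy : y ∈ P.I)
    (hg : MemLp g 2 (volume.restrict (Set.Ioo P.a P.b))) {K : Set ℂ} (hK : IsCompact K) :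
    TendstoUniformlyOn (fun (N : ℕ) z => ∑ n ∈ Finset.range N,
      P.transform (fun z => k * P.regular.wronskian z) y g (e n : ℝ) *
        samplingFun (fun z => k * P.regular.wronskian z) (e n : ℝ) z)
      (P.transform (fun z => k * P.regular.wronskian z) y g) atTop K := by
  obtain ⟨u, hu, hle⟩ := exists_summable_norm_sampling_le e hk hy hg hK
  exact (tendstoUniformlyOn_tsum_nat hu hle).congr_right fun z _ =>
    (hasSum_sampling e hk hy hg z).tsum_eq

end Sampling

lemma exists_eq_const_mul_wronskian {Ω f : ℂ → ℂ} {c : ℂ} (hc : c ≠ 0)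
    (hf : ∀ z, P.regular.wronskian z = c * f z) (hΩ : Ω = P.omega ∨ Ω = f) :
    ∃ k : ℂ, k ≠ 0 ∧ Ω = fun z => k * P.regular.wronskian z := by
  rcases hΩ with rfl | rfl
  · exact ⟨P.γ, ofReal_γ_ne_zero, funext omega_eq⟩
  · exact ⟨c⁻¹, inv_ne_zero hc, funext fun z => by rw [hf, inv_mul_cancel_left₀ hc]⟩

lemma deriv_const_mul_wronskian_ne_zero {k : ℂ} (hk : k ≠ 0) (l : P.regular.Eigenvalue) :
    deriv (fun z => k * P.regular.wronskian z) (l : ℝ) ≠ 0 := by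
  rw [deriv_const_mul_field]
  exact mul_ne_zero hk (RegularSL.deriv_wronskian_ne_zero l.2)

end SLProblem

theorem theorem2 (P : SLProblem) (y₀ : ℝ) (hy₀ : y₀ ∈ P.I) (g : ℝ → ℂ)
    (hg : MeasureTheory.MemLp g 2 (MeasureTheory.volume.restrict (Set.Ioo P.a P.b))) :
    -- the zeros of `ω` form a strictly increasing real sequence, with convergent canonical product
    ∃ lam : ℕ → ℝ, StrictMono lam ∧
      (∀ z : ℂ, P.omega z = 0 ↔ ∃ n, z = (lam n : ℂ)) ∧
      (∀ z : ℂ, Multipliable (canonicalFactor lam z)) ∧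
      -- the regularizing factor is `ω` or its canonical product
      ∀ Ω : ℂ → ℂ, Ω = P.omega ∨ Ω = canonicalProduct lam →
        -- the zeros of `Ω` are simple, and multiplication by `Ω` removes the poles of `G(x, y₀, ·)`
        (∀ n, deriv Ω (lam n : ℂ) ≠ 0) ∧
        (∀ x ∈ P.I, Differentiable ℂ (P.regGreen Ω y₀ x) ∧
          ∀ z : ℂ, P.omega z ≠ 0 → P.regGreen Ω y₀ x z = Ω z * P.green x y₀ z) ∧
        -- the integrals defining `F` exist
        (∀ z : ℂ, MeasureTheory.IntegrableOn
          (fun x => P.regGreen Ω y₀ x z * (starRingEnd ℂ) (g x)) (Set.Ioo P.a P.b)) ∧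
        -- `F` is entire of exponential type `b - a`, even as a function of the square root of `z`
        EntireOfExpType (P.b - P.a) (P.transform Ω y₀ g) ∧
        EntireOfExpType (P.b - P.a) (fun s => P.transform Ω y₀ g (s ^ 2)) ∧
        -- the sampling representation, absolutely convergent and uniformly so on compact sets
        (∀ z : ℂ, Summable fun n =>
          ‖P.transform Ω y₀ g (lam n : ℂ) * samplingFun Ω (lam n : ℂ) z‖) ∧
        (∀ z : ℂ, HasSum
          (fun n => P.transform Ω y₀ g (lam n : ℂ) * samplingFun Ω (lam n : ℂ) z)
          (P.transform Ω y₀ g z)) ∧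
        (∀ K : Set ℂ, IsCompact K → TendstoUniformlyOn
          (fun (N : ℕ) (z : ℂ) => ∑ n ∈ Finset.range N,
            P.transform Ω y₀ g (lam n : ℂ) * samplingFun Ω (lam n : ℂ) z)
          (P.transform Ω y₀ g) Filter.atTop K) := by
  obtain ⟨e, hmono, htop, hzeros⟩ := P.regular.exists_eigenvalue_enumeration
  obtain ⟨hmul, c, hc, hprod⟩ := RegularSL.exists_canonicalProduct hmono htop hzeros
  refine ⟨fun n => e n, hmono, fun z => SLProblem.omega_eq_zero_iff.trans (hzeros z), hmul,
    fun Ω hΩ => ?_⟩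
  obtain ⟨k, hk, rfl⟩ := SLProblem.exists_eq_const_mul_wronskian hc hprod hΩ
  obtain ⟨hexp, hexp_sq⟩ := SLProblem.entireOfExpType_transform hy₀ hg k
  exact ⟨fun n => SLProblem.deriv_const_mul_wronskian_ne_zero hk (e n),
    fun x hx => ⟨SLProblem.differentiable_regGreen hx hy₀ k,
      fun z hz => SLProblem.regGreen_eq_mul_green hx hy₀ k hz⟩,
    SLProblem.integrableOn_regGreen_mul_conj hy₀ hg k, hexp, hexp_sq,
    SLProblem.summable_norm_sampling e hk hy₀ hg, SLProblem.hasSum_sampling e hk hy₀ hg,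
    fun K hK => SLProblem.tendstoUniformlyOn_sampling e hk hy₀ hg hK⟩

end
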